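/- Let $k$ be an algebraically closed field of characteristic zero, let $e,n\ge 1$ be integers, and let $\zeta\in k$ be a primitive $ne$-th root of unity. Let $$G'=\langle \sigma,\tau,\rho \mid \sigma^e=\tau^{ne}=\rho^e=1,\ \sigma\tau=\rho\tau\sigma,\ \rho\sigma=\sigma\rho,\ \rho\tau=\tau\rho\rangle,$$ a central extension of $\mathbb Z/e\times\mathbb Z/ne$ by $\mu_e=\langle\rho\rangle$, act on $k[[s,t]]$ by continuous $k$-algebra automorphisms with $\sigma: s\mapsto \zeta^n s,\ t\mapsto t$; $\tau: s\mapsto s,\ t\mapsto \zeta t$; and $\rho$ acting trivially. Let $k[[s,t]]*G'$ be the skew group ring and let $$\varepsilon=\frac1e\sum_{i=0}^{e-1}\zeta^{ni}\rho^{-i},$$ the central idempotent on which $\rho$ acts as $\zeta^n$. Definitions. Let $R$ be a noetherian complete local normal domain of dimension two with fraction field $K$. An $R$-order is a finite torsion-free $R$-algebra $B$ such that $K\otimes_R B$ is a central simple $K$-algebra. It is normal if it is a reflexive $R$-module and, for every height one prime (curve) $C$ of $R$, the localisation $B_C$ is hereditary and its Jacobson radical is a principal left and right ideal. Put $\tilde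 k(C)=Z(B_C/\operatorname{rad}B_C)$. The ramification index of $B$ at $C$ is $e_C=\dim_{k(C)}\tilde k(C)$, and $C$ is a ramification curve if $e_C>1$. The secondary ramification of $B$ along $C$ at the closed point is the ramification index over the closed point of the normalisation of $R/C$ in $\tilde k(C)$ over the normalisation of $R/C$ in $k(C)$. A normal order $B$ is terminal if $R$ is regular, the ramification curves are smooth and cross normally, a ramification curve that meets no other has secondary ramification $1$, and, for two ramification curves with indices $e_1,e_2$, after possibly swapping them, $e_1\mid e_2$ and both curves have secondary ramification $e_1$. Proposition. Let $A=\varepsilon\, k[[s,t]]*G'$. The map $x\mapsto\varepsilon x$ induces an isomorphism $k[[s,t]]*G'/(\rho-\zeta^n)\simeq A$, and $A$ is a terminal order with the following ramification data. 1. The centre of $A$ is $R=k[[u,v]]$, where $u=s^e$ and $v=t^{ne}$ (embedded by $f\mapsto \varepsilon f$). 2. The ramification index of $A$ is $e$ at $u=0$, $ne$ at $v=0$, and $1$ at every other curve. 3. The secondary ramification of both curves $u=0$ and $v=0$ at the node $u=v=0$ is $e$. -/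

import Mathlib

open scoped TensorProduct

noncomputable section

namespace OrderRamification

/-! ### Orders over a complete local surface and their ramification -/

/-- Left and right hereditary rings: every left ideal and every right ideal is projective. -/
def IsHereditaryRing (B : Type*) [Ring B] : Prop :=
  (∀ I : Ideal B, Module.Projective B I) ∧ ∀ I : Ideal Bᵐᵒᵖ, Module.Projective Bᵐᵒᵖ I

/-- The Jacobson radical is a principal left and right ideal, with a common generator. -/
def HasPrincipalRadical (B : Type*) [Ring B] : Prop :=
  ∃ π : B, (Ring.jacobson B : Set B) = {x | ∃ b, x = b * π} ∧
    (Ring.jacobson B : Set B) = {x | ∃ b, x = π * b}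

/-- Noetherian complete local normal domains of dimension two. -/
structure IsCompleteNormalSurface (R : Type*) [CommRing R] [IsDomain R] [IsLocalRing R] :
    Prop where
  noetherian : IsNoetherianRing R
  integrallyClosed : IsIntegrallyClosed R
  dim_eq_two : ringKrullDim R = 2
  complete : IsAdicComplete (IsLocalRing.maximalIdeal R) R

/-- `A` is an `R`-order in the central simple `Frac R`-algebra `Frac R ⊗ A`. -/
structure IsOrder (R A : Type*) [CommRing R] [IsDomain R] [Ring A] [Algebra R A] : Prop where
  finite : Module.Finite R A
  torsionFree : Module.IsTorsionFree R A
  central : Algebra.IsCentral (FractionRing R) (FractionRing R ⊗[R] A)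
  simple : IsSimpleRing (FractionRing R ⊗[R] A)

section Residue

/-- If `B` is finite over a local ring, then the maximal ideal maps into `rad B`. -/
theorem algebraMap_mem_jacobson {Λ B : Type*} [CommRing Λ] [IsLocalRing Λ] [Ring B] [Algebra Λ B]
    [Module.Finite Λ B] {x : Λ} (hx : x ∈ IsLocalRing.maximalIdeal Λ) :
    algebraMap Λ B x ∈ Ring.jacobson B := by
  rw [Ring.jacobson_eq_sInf_isMaximal]
  refine Submodule.mem_sInf.2 fun M hM => ?_
  change Ideal B at M
  have hM : Ideal.IsMaximal M := hM
  by_contra hxM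
  -- the left ideal `M + x B` is everything, so Nakayama forces `M = B`
  let N : Submodule Λ B := M.restrictScalars Λ
  let P : Ideal B :=
    { carrier := {b | ∃ m ∈ M, ∃ c, b = m + x • c}
      add_mem' := by
        rintro _ _ ⟨m, hm, c, rfl⟩ ⟨m', hm', c', rfl⟩
        exact ⟨m + m', M.add_mem hm hm', c + c', by rw [smul_add]; abel⟩
      zero_mem' := ⟨0, M.zero_mem, 0, by simp⟩
      smul_mem' := by
        rintro r _ ⟨m, hm, c, rfl⟩
        exact ⟨r * m, Ideal.mul_mem_left M r hm, r * c, by simp [mul_add]⟩ }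
  have hle : M ≤ P := fun m hm => ⟨m, hm, 0, by simp⟩
  have hxP : algebraMap Λ B x ∈ P := ⟨0, M.zero_mem, 1, by simp [Algebra.algebraMap_eq_smul_one]⟩
  have hP : P = ⊤ := by
    by_contra h
    exact hxM ((hM.eq_of_le h hle).symm ▸ hxP)
  have hN : (⊤ : Submodule Λ B) ≤ N := by
    refine Submodule.le_of_le_smul_of_le_jacobson_bot (I := IsLocalRing.maximalIdeal Λ)
      Module.Finite.fg_top (IsLocalRing.maximalIdeal_le_jacobson _) ?_
    intro b _
    have hb : b ∈ P := hP ▸ Submodule.mem_top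
    obtain ⟨m, hm, c, rfl⟩ := hb
    exact Submodule.add_mem_sup hm (Submodule.smul_mem_smul hx Submodule.mem_top)
  exact hM.ne_top (Ideal.eq_top_iff_one _ |>.2 (hN (Submodule.mem_top (x := (1 : B)))))

variable (Λ B : Type*) [CommRing Λ] [IsLocalRing Λ] [Ring B] [Algebra Λ B] [Module.Finite Λ B]

/-- `B / rad B` is an algebra over the residue field of `Λ`: the structure map is induced by
`Λ → B`. -/
def residueMap : IsLocalRing.ResidueField Λ →+* B ⧸ Ring.jacobson B :=
  Ideal.Quotient.lift (IsLocalRing.maximalIdeal Λ)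
    ((Ideal.Quotient.mk (Ring.jacobson B)).comp (algebraMap Λ B))
    fun _ hx => Ideal.Quotient.eq_zero_iff_mem.2 (algebraMap_mem_jacobson hx)

theorem residueMap_residue (r : Λ) :
    residueMap Λ B (IsLocalRing.residue Λ r) =
      Ideal.Quotient.mk (Ring.jacobson B) (algebraMap Λ B r) := rfl

theorem residueMap_commutes (r : IsLocalRing.ResidueField Λ) (x : B ⧸ Ring.jacobson B) :
    residueMap Λ B r * x = x * residueMap Λ B r := by
  obtain ⟨r, rfl⟩ := IsLocalRing.residue_surjective r
  obtain ⟨x, rfl⟩ := Ideal.Quotient.mk_surjective x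
  rw [residueMap_residue, ← map_mul, ← map_mul, Algebra.commutes]

/-- The centre `Z(B / rad B)`. -/
def ResidueCentre (B : Type*) [Ring B] : Type _ := Subring.center (B ⧸ Ring.jacobson B)

instance (B : Type*) [Ring B] : CommRing (ResidueCentre B) :=
  inferInstanceAs (CommRing (Subring.center (B ⧸ Ring.jacobson B)))

/-- `Z(B / rad B)` as an algebra over the residue field of `Λ`, through `residueMap`. -/
instance residueCentreAlgebra : Algebra (IsLocalRing.ResidueField Λ) (ResidueCentre B) :=
  RingHom.toAlgebra <| (residueMap Λ B).codRestrict (Subring.center (B ⧸ Ring.jacobson B))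
    fun r => Subring.mem_center_iff.2 fun x => (residueMap_commutes Λ B r x).symm

end Residue

section Cover

variable (D κ L : Type*) [CommRing D] [Field κ] [Algebra D κ] [CommRing L] [Algebra κ L]

/-- Let `κ` be the function field of a curve with coordinate ring `D`, and `L` a finite extension
of `κ` (possibly a product of fields). The normalisation of `D` in `L` has ramification index `r`
over the normalisation of `D` in `κ`, at every closed point. -/
def CoverRamifiesWithIndex (r : ℕ) : Prop :=
  ∀ P : Ideal (integralClosure (integralClosure D κ) L), P.IsMaximal →
    P.ramificationIdx (integralClosure D κ) = r

end Cover

section Local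

variable {R : Type*} [CommRing R]

/-- Prime divisors of `Spec R` are the primes of height one. -/
def IsPrimeDivisor (C : PrimeSpectrum R) : Prop := C.asIdeal.height = 1

variable (A : Type*) [Ring A] [Algebra R A] (C : PrimeSpectrum R)

/-- The localisation `A_C`, an algebra over `R_C`. -/
abbrev LocalizedOrder : Type _ := Localization.AtPrime C.asIdeal ⊗[R] A

variable [Module.Finite R A]

instance : Algebra C.asIdeal.ResidueField (ResidueCentre (LocalizedOrder A C)) :=
  residueCentreAlgebra (Localization.AtPrime C.asIdeal) (LocalizedOrder A C)

/-- The (primary) ramification index `e_C = dim_{k(C)} k̃(C)`, where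
`k̃(C) = Z(A_C / rad A_C)`. -/
def ramificationIndex : ℕ :=
  Module.finrank C.asIdeal.ResidueField (ResidueCentre (LocalizedOrder A C))

/-- `C` is a ramification curve of `A`. -/
def IsRamificationCurve : Prop := IsPrimeDivisor C ∧ 1 < ramificationIndex A C

/-- The secondary ramification index of `A` along `C`, at the closed point of `Spec R`, is `r`: the
cover `D̃_C → D_C` of the normalisation of `C` defined by `k̃(C) / k(C)` has ramification
index `r` at each closed point (in the complete local case, `D_C` has just one). -/
def HasSecondaryRamification (r : ℕ) : Prop :=
  CoverRamifiesWithIndex (R ⧸ C.asIdeal) C.asIdeal.ResidueField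
    (ResidueCentre (LocalizedOrder A C)) r

end Local

/-- Normal orders over a complete local normal surface. -/
structure IsNormalOrder (R A : Type*) [CommRing R] [IsDomain R] [IsLocalRing R] [Ring A]
    [Algebra R A] : Prop where
  base : IsCompleteNormalSurface R
  order : IsOrder R A
  reflexive : Module.IsReflexive R A
  hereditary : ∀ C : PrimeSpectrum R, IsPrimeDivisor C → IsHereditaryRing (LocalizedOrder A C)
  principalRadical : ∀ C : PrimeSpectrum R, IsPrimeDivisor C →
    HasPrincipalRadical (LocalizedOrder A C)

/-- Terminal orders over a complete local normal surface. As `Spec R` has a single closed point,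
any two curves intersect there. -/
structure IsTerminalOrder (R A : Type*) [CommRing R] [IsDomain R] [IsLocalRing R] [Ring A]
    [Algebra R A] [Module.Finite R A] : Prop where
  normal : IsNormalOrder R A
  smooth : IsRegularLocalRing R
  /-- The ramification curves are smooth and cross normally: each is a coordinate line. -/
  normalCrossing : ∃ x y : R, IsLocalRing.maximalIdeal R = Ideal.span {x, y} ∧
    ∀ C : PrimeSpectrum R, IsRamificationCurve A C →
      C.asIdeal = Ideal.span {x} ∨ C.asIdeal = Ideal.span {y}
  /-- There is no secondary ramification on a curve that meets no other ramification curve. -/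
  secondary_single : ∀ C : PrimeSpectrum R, IsRamificationCurve A C →
    (∀ C', IsRamificationCurve A C' → C' = C) → HasSecondaryRamification A C 1
  secondary_pair : ∀ C C' : PrimeSpectrum R, IsRamificationCurve A C →
    IsRamificationCurve A C' → C ≠ C' →
    (ramificationIndex A C ∣ ramificationIndex A C' ∧
      HasSecondaryRamification A C (ramificationIndex A C) ∧
      HasSecondaryRamification A C' (ramificationIndex A C)) ∨
    (ramificationIndex A C' ∣ ramificationIndex A C ∧
      HasSecondaryRamification A C (ramificationIndex A C') ∧
      HasSecondaryRamification A C' (ramificationIndex A C'))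

end OrderRamification

namespace SkewTerminal

/-! ### The group `G'` and its action on `k[[s,t]]` -/

/-- The relations `σ^e = τ^{ne} = ρ^e = 1`, `στ = ρτσ`, `ρσ = σρ`, `ρτ = τρ`, where `σ`, `τ`, `ρ`
are the generators numbered `0`, `1`, `2`. -/
def rels (e n : ℕ) : Set (FreeGroup (Fin 3)) :=
  let σ := FreeGroup.of (0 : Fin 3)
  let τ := FreeGroup.of (1 : Fin 3)
  let ρ := FreeGroup.of (2 : Fin 3)
  {σ ^ e, τ ^ (n * e), ρ ^ e, (σ * τ) * (ρ * τ * σ)⁻¹, (ρ * σ) * (σ * ρ)⁻¹, (ρ * τ) * (τ * ρ)⁻¹}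

/-- The central extension `G'` of `ℤ/e × ℤ/ne` by `μ_e = ⟨ρ⟩`. -/
abbrev ExtGroup (e n : ℕ) : Type := PresentedGroup (rels e n)

def sigma (e n : ℕ) : ExtGroup e n := PresentedGroup.of 0
def tau (e n : ℕ) : ExtGroup e n := PresentedGroup.of 1
def rho (e n : ℕ) : ExtGroup e n := PresentedGroup.of 2

theorem rho_pow (e n : ℕ) : rho e n ^ e = 1 :=
  PresentedGroup.one_of_mem (rels := rels e n) (x := FreeGroup.of 2 ^ e) (by simp [rels])

variable {k : Type*} [Field k] {e n : ℕ} [NeZero e] [NeZero n] {ζ : k}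

/-- `k[[s,t]]`; a copy of the power series ring which remembers `e`, `n` and `ζ`, since the action
of `G'` and the structure of a `k[[u,v]]`-algebra depend on them. -/
def Cover (_ : IsPrimitiveRoot ζ (n * e)) : Type _ := MvPowerSeries (Fin 2) k

variable (hζ : IsPrimitiveRoot ζ (n * e))

instance : CommRing (Cover hζ) := inferInstanceAs (CommRing (MvPowerSeries (Fin 2) k))
instance : Algebra k (Cover hζ) := inferInstanceAs (Algebra k (MvPowerSeries (Fin 2) k))

def s : Cover hζ := (MvPowerSeries.X 0 : MvPowerSeries (Fin 2) k)
def t : Cover hζ := (MvPowerSeries.X 1 : MvPowerSeries (Fin 2) k)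

/-- `ζ` as a unit. -/
def zetaUnit : kˣ :=
  Units.ofPowEqOne ζ (n * e) hζ.pow_eq_one (mul_ne_zero (NeZero.ne n) (NeZero.ne e))

theorem zetaUnit_pow : zetaUnit hζ ^ (n * e) = 1 := Units.pow_ofPowEqOne _ _

/-- The characters through which `G'` scales `s` and `t`: `σ ↦ (ζ^n, 1)`, `τ ↦ (1, ζ)`,
`ρ ↦ (1, 1)`. -/
def weights : ExtGroup e n →* (Fin 2 → kˣ) :=
  PresentedGroup.toGroup (f := ![![zetaUnit hζ ^ n, 1], ![1, zetaUnit hζ], 1]) (by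
    have h := zetaUnit_pow hζ
    intro r hr
    simp only [rels, Set.mem_insert_iff, Set.mem_singleton_iff] at hr
    rcases hr with rfl | rfl | rfl | rfl | rfl | rfl <;> ext i <;> fin_cases i <;>
      simp [← pow_mul, h])

/-- Rescaling the two variables of a power series by units. -/
def scale (a : Fin 2 → kˣ) : MvPowerSeries (Fin 2) k →+* MvPowerSeries (Fin 2) k :=
  MvPowerSeries.rescale fun i => (a i : k)

theorem scale_one (f : MvPowerSeries (Fin 2) k) : scale 1 f = f := by
  change MvPowerSeries.rescale (1 : Fin 2 → k) f = f
  simp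

theorem scale_mul (a b : Fin 2 → kˣ) (f : MvPowerSeries (Fin 2) k) :
    scale (a * b) f = scale a (scale b f) := by
  change _ = MvPowerSeries.rescale _ (MvPowerSeries.rescale _ f)
  rw [MvPowerSeries.rescale_rescale, scale]
  congr 2
  ext i
  simp [mul_comm]

theorem scale_smul (a : Fin 2 → kˣ) (c : k) (f : MvPowerSeries (Fin 2) k) :
    scale a (c • f) = c • scale a f := by
  ext d
  simp [scale, MvPowerSeries.coeff_rescale, mul_left_comm]

/-- The action of `G'` on `k[[s,t]]` by `k`-algebra automorphisms: `σ : s ↦ ζ^n s, t ↦ t`,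
`τ : s ↦ s, t ↦ ζ t`, and `ρ` acts trivially. -/
instance : MulSemiringAction (ExtGroup e n) (Cover hζ) where
  smul g f := scale (weights hζ g) f
  one_smul f := (congrArg (fun a => scale a f) (map_one (weights hζ))).trans (scale_one f)
  mul_smul g h f :=
    (congrArg (fun a => scale a f) (map_mul (weights hζ) g h)).trans (scale_mul _ _ f)
  smul_zero g := map_zero (scale (weights hζ g))
  smul_add g := map_add (scale (weights hζ g))
  smul_one g := map_one (scale (weights hζ g))
  smul_mul g := map_mul (scale (weights hζ g))

instance : SMulCommClass (ExtGroup e n) k (Cover hζ) where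
  smul_comm g c f := scale_smul (weights hζ g) c f

/-! ### The base `R = k[[u,v]]` -/

/-- The ring `R = k[[u,v]]`. -/
abbrev Base (k : Type*) [Field k] : Type _ := MvPowerSeries (Fin 2) k

instance (k : Type*) [Field k] : IsDomain (Base k) := NoZeroDivisors.to_isDomain _

/-- The embedding `k[[u,v]] → k[[s,t]]`, `u ↦ s^e`, `v ↦ t^{ne}`. -/
def baseHom : Base k →ₐ[k] MvPowerSeries (Fin 2) k :=
  MvPowerSeries.substAlgHom
    (a := ![(MvPowerSeries.X 0 : MvPowerSeries (Fin 2) k) ^ e, MvPowerSeries.X 1 ^ (n * e)])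
    (MvPowerSeries.hasSubst_of_constantCoeff_zero (by
      intro i
      fin_cases i <;> simp [NeZero.ne]))

/-- `k[[s,t]]` is a `k[[u,v]]`-algebra through `u ↦ s^e`, `v ↦ t^{ne}`. -/
instance : Algebra (Base k) (Cover hζ) :=
  RingHom.toAlgebra (baseHom (e := e) (n := n) : Base k →ₐ[k] MvPowerSeries (Fin 2) k).toRingHom

theorem weights_zero_pow (g : ExtGroup e n) : weights hζ g 0 ^ e = 1 := by
  have h : ((powMonoidHom e).comp (Pi.evalMonoidHom _ 0)).comp (weights hζ) = 1 := by
    ext x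
    fin_cases x <;> simp [weights, ← pow_mul, zetaUnit_pow]
  exact congrArg (fun φ => φ g) h

theorem weights_one_pow (g : ExtGroup e n) : weights hζ g 1 ^ (n * e) = 1 := by
  have h : ((powMonoidHom (n * e)).comp (Pi.evalMonoidHom _ 1)).comp (weights hζ) = 1 := by
    ext x
    fin_cases x <;> simp [weights, zetaUnit_pow]
  exact congrArg (fun φ => φ g) h

theorem scale_baseHom (g : ExtGroup e n) (f : Base k) :
    scale (weights hζ g) (baseHom (e := e) (n := n) f) = baseHom (e := e) (n := n) f := by
  have h0 : (weights hζ g 0 : k) ^ e = 1 := by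
    rw [← Units.val_pow_eq_pow_val, weights_zero_pow, Units.val_one]
  have h1 : (weights hζ g 1 : k) ^ (n * e) = 1 := by
    rw [← Units.val_pow_eq_pow_val, weights_one_pow, Units.val_one]
  have hs : MvPowerSeries.HasSubst ![(MvPowerSeries.X 0 : MvPowerSeries (Fin 2) k) ^ e,
      MvPowerSeries.X 1 ^ (n * e)] :=
    MvPowerSeries.hasSubst_of_constantCoeff_zero (by
      intro i
      fin_cases i <;> simp [NeZero.ne])
  have hr := MvPowerSeries.HasSubst.smul_X (fun i => (weights hζ g i : k))
  rw [scale, MvPowerSeries.rescale_eq_subst, baseHom, MvPowerSeries.substAlgHom_apply,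
    MvPowerSeries.subst_comp_subst_apply hs hr]
  congr 1
  funext i
  fin_cases i
  · simp [MvPowerSeries.subst_pow hr, MvPowerSeries.subst_X hr, smul_pow, h0]
  · simp [MvPowerSeries.subst_pow hr, MvPowerSeries.subst_X hr, smul_pow, h1]

instance : SMulCommClass (ExtGroup e n) (Base k) (Cover hζ) where
  smul_comm g c f := by
    rw [Algebra.smul_def, Algebra.smul_def, smul_mul']
    exact congrArg (· * g • f) (scale_baseHom hζ g c)

/-! ### The skew group ring and its direct factor -/

/-- The skew group ring `k[[s,t]] * G'`, an algebra over `k` and over `k[[u,v]]`. -/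
abbrev SkewGroupRing : Type _ := SkewMonoidAlgebra (Cover hζ) (ExtGroup e n)

/-- The inclusion of `G'` into the skew group ring. -/
def grp : ExtGroup e n →* SkewGroupRing hζ := SkewMonoidAlgebra.of (Cover hζ) (ExtGroup e n)

/-- The idempotent `ε = (1/e) ∑_{i < e} ζ^{ni} ρ^{-i}` of `k μ_e`, on which `ρ` acts as `ζ^n`. -/
def eps : SkewGroupRing hζ :=
  ((e : k)⁻¹) • ∑ i ∈ Finset.range e, (ζ ^ (n * i)) • grp hζ ((rho e n)⁻¹ ^ i)

theorem eps_eq_geom_sum : eps hζ =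
    ((e : k)⁻¹) • ∑ i ∈ Finset.range e, (ζ ^ n • grp hζ (rho e n)⁻¹) ^ i := by
  simp only [eps, smul_pow, ← pow_mul, ← map_pow]

theorem zeta_rho_pow : (ζ ^ n • grp hζ (rho e n)⁻¹) ^ e = 1 := by
  rw [smul_pow, ← map_pow, inv_pow, rho_pow, ← pow_mul, hζ.pow_eq_one, inv_one, map_one, one_smul]

theorem zeta_rho_mul_eps : (ζ ^ n • grp hζ (rho e n)⁻¹) * eps hζ = eps hζ := by
  have h := mul_geom_sum (ζ ^ n • grp hζ (rho e n)⁻¹) e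
  rw [zeta_rho_pow, sub_self, sub_mul, one_mul, sub_eq_zero] at h
  rw [eps_eq_geom_sum, mul_smul_comm, h]

/-- `ρ` acts as `ζ^n` on the factor cut out by `ε`. -/
theorem rho_mul_eps : grp hζ (rho e n) * eps hζ = ζ ^ n • eps hζ := by
  conv_lhs => rw [← zeta_rho_mul_eps hζ]
  rw [← mul_assoc, mul_smul_comm, ← map_mul, mul_inv_cancel, map_one, smul_mul_assoc, one_mul]

theorem eps_idem [CharZero k] : IsIdempotentElem (eps hζ) := by
  have h : ∀ i, (ζ ^ n • grp hζ (rho e n)⁻¹) ^ i * eps hζ = eps hζ := by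
    intro i
    induction i with
    | zero => rw [pow_zero, one_mul]
    | succ i ih => rw [pow_succ, mul_assoc, zeta_rho_mul_eps, ih]
  have he : (e : k) ≠ 0 := Nat.cast_ne_zero.2 (NeZero.ne e)
  rw [IsIdempotentElem]
  conv_lhs => rw [eps_eq_geom_sum, smul_mul_assoc, Finset.sum_mul, ← eps_eq_geom_sum]
  rw [Finset.sum_congr rfl fun i _ => h i, Finset.sum_const, Finset.card_range,
    ← Nat.cast_smul_eq_nsmul k, smul_smul, inv_mul_cancel₀ he, one_smul]

/-- The direct factor `A = ε (k[[s,t]] * G')` of the skew group ring, with unit `ε`. As `ε` is a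
central idempotent, this is the corner ring `ε (k[[s,t]] * G') ε`. -/
def SkewOrder [CharZero k] : Type _ := (eps_idem hζ).Corner

instance [CharZero k] : Ring (SkewOrder hζ) := inferInstanceAs (Ring (eps_idem hζ).Corner)

/-- The inclusion of `A` into the skew group ring (it does not preserve the unit). -/
def incl [CharZero k] (a : SkewOrder hζ) : SkewGroupRing hζ :=
  Subtype.val (p := fun x => x ∈ Subsemigroup.corner (eps hζ)) a

/-- The structure of a `k[[u,v]]`-algebra on `A`: the structure map is `f ↦ ε f`. -/
instance [CharZero k] : Algebra (Base k) (SkewOrder hζ) :=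
  RingHom.toAlgebra'
    { toFun := fun f => ⟨f • eps hζ, f • 1, by
        change eps hζ * f • (1 : SkewGroupRing hζ) * eps hζ = f • eps hζ
        rw [mul_smul_comm, mul_one, smul_mul_assoc, (eps_idem hζ).eq]⟩
      map_one' := Subtype.ext (one_smul _ _)
      map_mul' := fun f g => Subtype.ext (by
        change (f * g) • eps hζ = (f • eps hζ) * (g • eps hζ)
        rw [smul_mul_smul_comm, (eps_idem hζ).eq])
      map_zero' := Subtype.ext (zero_smul _ _)
      map_add' := fun f g => Subtype.ext (add_smul _ _ _) }
    (by
      rintro f ⟨x, hx⟩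
      refine Subtype.ext ?_
      have h := (Subsemigroup.mem_corner_iff (eps_idem hζ)).1 hx
      change (f • eps hζ) * x = x * (f • eps hζ)
      rw [smul_mul_assoc, mul_smul_comm, h.1, h.2])

theorem incl_algebraMap [CharZero k] (f : Base k) :
    incl hζ (algebraMap (Base k) (SkewOrder hζ) f) = f • eps hζ := rfl

/-! ### The curves `u = 0` and `v = 0` -/

theorem X_dvd_iff_rescale (i : Fin 2) (f : Base k) :
    MvPowerSeries.X i ∣ f ↔ MvPowerSeries.rescale (Function.update 1 i 0) f = 0 := by
  rw [MvPowerSeries.X_dvd_iff, MvPowerSeries.ext_iff]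
  refine forall_congr' fun m => ?_
  rw [MvPowerSeries.coeff_rescale, map_zero, Finsupp.prod_fintype _ _ fun j => pow_zero _]
  fin_cases i <;> simp [zero_pow_eq]

theorem X_prime (i : Fin 2) : Prime (MvPowerSeries.X i : Base k) := by
  refine ⟨fun h => ?_, fun h => ?_, fun f g h => ?_⟩
  · have := congrArg (MvPowerSeries.coeff (Finsupp.single i 1)) h
    simp at this
  · have := h.map (MvPowerSeries.constantCoeff (σ := Fin 2) (R := k))
    simp at this
  · rw [X_dvd_iff_rescale, map_mul, mul_eq_zero] at h
    rwa [X_dvd_iff_rescale, X_dvd_iff_rescale]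

/-- The curves `u = 0` (for `i = 0`) and `v = 0` (for `i = 1`) in `Spec k[[u,v]]`. -/
def axis (k : Type*) [Field k] (i : Fin 2) : PrimeSpectrum (Base k) :=
  ⟨Ideal.span {MvPowerSeries.X i}, (Ideal.span_singleton_prime (X_prime i).ne_zero).2 (X_prime i)⟩

end SkewTerminal
end

open OrderRamification SkewTerminal

/-! In `A` the element `ρ` is the scalar `ζ^n`, so `A` is generated over `R = k[[u,v]]` by `s`, `t`,
`τ`, `σ`. These commute up to powers of `ζ`, and `s^e = u`, `t^{ne} = v`, `τ^{ne} = σ^e = 1`. The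
monomials `s^a t^b τ^c σ^d`, with exponents taken modulo `e`, `ne`, `ne`, `e`, form an `R`-basis
(`orderBasis`). Independence needs the normal forms `ρ^i τ^c σ^d` in `G'` to be distinct, which the
permutation representation `regularAction` shows. The product of two basis elements is a scalar
times the basis element of the summed exponents (`IsTwistedBasis`), so most of the argument is
linear algebra on this basis and survives base change.

Centre and simplicity: conjugation by a generator multiplies each monomial by a root of unity, and
the four resulting characters separate monomials (`commutatorExponent_separates`). Hence only `R` is
central, and over `Frac R`, where all monomials are units, a nonzero ideal contains a unit.

Localisation at a curve `C`: the ring `R_C` is a discrete valuation ring and `k[[s,t]]_C` is a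
Dedekind domain normalised by `G'`, whose order is invertible; averaging over `G'` as in Maschke's
theorem makes `A_C` hereditary. The radical is generated by `s` at `u = 0`, by `t` at `v = 0`, and
by a generator of the maximal ideal of `R_C` elsewhere. That it is no bigger follows from the trace
of left multiplication, which reads off the coefficients of an element and vanishes on nilpotents
(`IsTwistedBasis.mem_jacobson_iff`).

Ramification: `Z(A_C / rad A_C)` has as basis the monomials outside the radical that commute with
the generators that are units. At `u = 0` these are represented by the `e` powers of `w = t^n σ`,
and `w^e = v`. At `v = 0` they number `ne` and are generated by `w = s τ^{-1}` and `y = τ^e`, with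
`y^n = 1` and `w^e = u y^{-1}`; the idempotents of `y` split this algebra into `n` pieces, in each
of which `w^e` is a unit times the uniformiser `u`. Elsewhere only `1` remains. An Eisenstein
argument (`ramificationIdx_integralClosure_eq`) then gives ramification index `e` at every closed
point of the normalised covers. -/

open OrderRamification SkewTerminal

/-! ### The base `k[[u,v]]`, its prime divisors and their local rings -/

/-- A noetherian local domain whose maximal ideal has a single nonzero generator is a discrete
valuation ring. -/
theorem IsDiscreteValuationRing.of_maximalIdeal_eq_span {D : Type*} [CommRing D] [IsDomain D]
    [IsNoetherianRing D] [IsLocalRing D] {x : D}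
    (hx : IsLocalRing.maximalIdeal D = Ideal.span {x}) (h0 : x ≠ 0) :
    IsDiscreteValuationRing D := by
  have hf : ¬ IsField D := fun h => by
    rw [IsLocalRing.isField_iff_maximalIdeal_eq.1 h] at hx
    exact h0 (Ideal.span_singleton_eq_bot.1 hx.symm)
  have h : IsDiscreteValuationRing D ↔ (IsLocalRing.maximalIdeal D).IsPrincipal :=
    (IsDiscreteValuationRing.TFAE D hf).out 0 4
  exact h.2 ⟨⟨x, hx⟩⟩

/-- In a unique factorisation domain the primes of height one are principal. -/
theorem Ideal.IsPrime.exists_prime_eq_span_of_height_eq_one {R : Type*} [CommRing R] [IsDomain R]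
    [UniqueFactorizationMonoid R] {P : Ideal R} (hP : P.IsPrime) (h : P.height = 1) :
    ∃ p, Prime p ∧ P = Ideal.span {p} := by
  obtain ⟨p, hpP, hp⟩ := hP.exists_mem_prime_of_ne_bot (Ideal.ne_bot_of_height_eq_one h)
  exact ⟨p, hp, Ideal.eq_span_singleton_of_height_eq_one h hpP hp⟩

namespace SkewTerminal

section Base
variable (k : Type*) [Field k]

theorem constantCoeff_eq_zero_iff_mem_span (f : Base k) :
    MvPowerSeries.constantCoeff f = 0 ↔
      f ∈ Ideal.span {(MvPowerSeries.X 0 : Base k), MvPowerSeries.X 1} := by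
  constructor
  · intro hf
    -- `ψ` sets the second variable to zero. Then `f - ψ f` is divisible by that variable, and `ψ
    -- f`, a series in the first variable alone without constant term, is divisible by the first.
    let ψ : Base k →+* Base k := MvPowerSeries.rescale (Function.update 1 1 0)
    have h1 : (MvPowerSeries.X 1 : Base k) ∣ f - ψ f := by
      rw [X_dvd_iff_rescale, map_sub, sub_eq_zero, MvPowerSeries.rescale_rescale]
      congr 2
      ext i; fin_cases i <;> simp
    have h0 : (MvPowerSeries.X 0 : Base k) ∣ ψ f := by
      rw [MvPowerSeries.X_dvd_iff]
      intro m hm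
      rw [MvPowerSeries.coeff_rescale, Finsupp.prod_fintype _ _ fun j => pow_zero _]
      by_cases h : m 1 = 0
      · have : m = 0 := by ext i; fin_cases i <;> simp [hm, h]
        rw [this, MvPowerSeries.coeff_zero_eq_constantCoeff_apply, hf, mul_zero]
      · simp [h]
    obtain ⟨a, ha⟩ := h0
    obtain ⟨b, hb⟩ := h1
    exact Ideal.mem_span_pair.2 ⟨a, b, by rw [mul_comm a, mul_comm b, ← ha, ← hb]; abel⟩
  · intro hf
    obtain ⟨a, b, rfl⟩ := Ideal.mem_span_pair.1 hf
    simp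

theorem maximalIdeal_base : IsLocalRing.maximalIdeal (Base k) =
    Ideal.span {MvPowerSeries.X 0, MvPowerSeries.X 1} := by
  ext f
  rw [← constantCoeff_eq_zero_iff_mem_span, IsLocalRing.mem_maximalIdeal, mem_nonunits_iff,
    MvPowerSeries.isUnit_iff_constantCoeff, isUnit_iff_ne_zero, not_not]

/-- Power series in one variable over a field form a principal ideal domain, and power series in one
further variable over such a ring are factorial. This is what makes every curve in `Spec k[[u,v]]`
the zero locus of one equation. -/
instance base_uniqueFactorizationMonoid : UniqueFactorizationMonoid (Base k) := by
  have : IsPrincipalIdealRing (MvPowerSeries (Fin 1) k) :=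
    IsPrincipalIdealRing.of_surjective
      (MvPowerSeries.renameEquiv k (Equiv.ofUnique Unit (Fin 1))).toRingEquiv.toRingHom
      (MvPowerSeries.renameEquiv k (Equiv.ofUnique Unit (Fin 1))).surjective
  have : IsDomain (MvPowerSeries (Fin 1) k) := NoZeroDivisors.to_isDomain _
  exact (MvPowerSeries.finSuccEquiv k 1).toMulEquiv.symm.uniqueFactorizationMonoid inferInstance

theorem two_le_ringKrullDim_base : 2 ≤ ringKrullDim (Base k) := by
  have h0 : ringKrullDim (MvPowerSeries (Fin 0) k) = 0 := by
    rw [ringKrullDim_eq_of_ringEquiv (MvPowerSeries.isEmptyEquiv (Fin 0) k).toRingEquiv,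
      ringKrullDim_eq_zero_of_field]
  have h1 := ringKrullDim_succ_le_ringKrullDim_powerseries (R := MvPowerSeries (Fin 0) k)
  have h2 := ringKrullDim_succ_le_ringKrullDim_powerseries (R := MvPowerSeries (Fin 1) k)
  rw [← ringKrullDim_eq_of_ringEquiv (MvPowerSeries.finSuccEquiv k 0).toRingEquiv, h0] at h1
  rw [← ringKrullDim_eq_of_ringEquiv (MvPowerSeries.finSuccEquiv k 1).toRingEquiv] at h2
  refine le_trans ?_ (le_trans (add_le_add_left h1 1) h2)
  norm_num

theorem spanFinrank_base_le : (IsLocalRing.maximalIdeal (Base k)).spanFinrank ≤ 2 := by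
  rw [maximalIdeal_base]
  refine (Submodule.spanFinrank_span_le_ncard_of_finite (Set.toFinite _)).trans ?_
  exact (Set.ncard_insert_le _ _).trans (by simp)

/-- Each variable raises the dimension by at least one, so two generators of the maximal ideal are
as few as possible. -/
theorem base_isRegularLocalRing : IsRegularLocalRing (Base k) :=
  IsRegularLocalRing.of_spanFinrank_maximalIdeal_le _
    (le_trans (by exact_mod_cast spanFinrank_base_le k) (two_le_ringKrullDim_base k))

theorem ringKrullDim_base : ringKrullDim (Base k) = 2 :=
  le_antisymm ((ringKrullDim_le_spanFinrank_maximalIdeal _).trans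
    (by exact_mod_cast spanFinrank_base_le k)) (two_le_ringKrullDim_base k)

theorem base_isCompleteNormalSurface : IsCompleteNormalSurface (Base k) where
  noetherian := inferInstance
  integrallyClosed := inferInstance
  dim_eq_two := ringKrullDim_base k
  complete := by
    rw [maximalIdeal_base]
    have h : Set.range (MvPowerSeries.X : Fin 2 → Base k) =
        {MvPowerSeries.X 0, MvPowerSeries.X 1} := by
      ext; simp [eq_comm]
    exact h ▸ inferInstanceAs
      (IsAdicComplete (Ideal.span (Set.range (MvPowerSeries.X : Fin 2 → Base k))) (Base k))

theorem axis_isPrimeDivisor (i : Fin 2) : IsPrimeDivisor (axis k i) :=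
  Ideal.height_span_singleton_eq_one_of_mem_nonZeroDivisors
    (mem_nonZeroDivisors_of_ne_zero (X_prime i).ne_zero) (X_prime i).not_isUnit

theorem X_dvd_X_iff (i j : Fin 2) : (MvPowerSeries.X i : Base k) ∣ MvPowerSeries.X j ↔ i = j := by
  refine ⟨fun h => ?_, fun h => h ▸ dvd_rfl⟩
  by_contra hij
  have := MvPowerSeries.X_dvd_iff.1 h (Finsupp.single j 1) (by simp [Ne.symm hij])
  simp at this

theorem axis_injective : Function.Injective (axis k) := by
  intro i j h
  have h := congrArg PrimeSpectrum.asIdeal h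
  exact (X_dvd_X_iff k i j).1 (Ideal.mem_span_singleton.1
    (h.symm ▸ Ideal.mem_span_singleton_self (MvPowerSeries.X j) :
      (MvPowerSeries.X j : Base k) ∈ (axis k i).asIdeal))

instance axis_quotient_isLocalRing (i : Fin 2) : IsLocalRing (Base k ⧸ (axis k i).asIdeal) :=
  .of_surjective' _ Ideal.Quotient.mk_surjective

theorem maximalIdeal_axis_quotient (i j : Fin 2) (hij : i ≠ j) :
    IsLocalRing.maximalIdeal (Base k ⧸ (axis k i).asIdeal) =
      Ideal.span {Ideal.Quotient.mk (axis k i).asIdeal (MvPowerSeries.X j)} := by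
  have h : Ideal.span {(MvPowerSeries.X 0 : Base k), MvPowerSeries.X 1} =
      Ideal.span {MvPowerSeries.X i, MvPowerSeries.X j} := by
    fin_cases i <;> fin_cases j <;> simp [Set.pair_comm] at hij ⊢
  have h0 : Ideal.Quotient.mk (axis k i).asIdeal (MvPowerSeries.X i) = 0 :=
    Ideal.Quotient.eq_zero_iff_mem.2 (Ideal.mem_span_singleton_self _)
  rw [← IsLocalRing.map_maximalIdeal_of_surjective _ Ideal.Quotient.mk_surjective,
    maximalIdeal_base, h, Ideal.map_span, Set.image_pair, h0]
  simp

/-- The coordinate not defining the axis is a uniformiser on it. Hence each axis is already normal,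
and secondary ramification can be computed over this ring itself. -/
instance axis_quotient_isDiscreteValuationRing (i : Fin 2) :
    IsDiscreteValuationRing (Base k ⧸ (axis k i).asIdeal) := by
  obtain ⟨j, hij⟩ : ∃ j : Fin 2, i ≠ j := by fin_cases i; exacts [⟨1, by simp⟩, ⟨0, by simp⟩]
  refine .of_maximalIdeal_eq_span (maximalIdeal_axis_quotient k i j hij) fun h => hij ?_
  rw [Ideal.Quotient.eq_zero_iff_mem] at h
  exact (X_dvd_X_iff k i j).1 (Ideal.mem_span_singleton.1 h)

variable {k}

theorem maximalIdeal_localization_eq_span {C : PrimeSpectrum (Base k)} {p : Base k}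
    (h : C.asIdeal = Ideal.span {p}) :
    IsLocalRing.maximalIdeal (Localization.AtPrime C.asIdeal) =
      Ideal.span {algebraMap (Base k) _ p} := by
  rw [← Localization.AtPrime.map_eq_maximalIdeal, ← Set.image_singleton, ← Ideal.map_span]
  exact congrArg (Ideal.map (algebraMap (Base k) (Localization.AtPrime C.asIdeal))) h

theorem algebraMap_localization_injective (C : PrimeSpectrum (Base k)) :
    Function.Injective (algebraMap (Base k) (Localization.AtPrime C.asIdeal)) :=
  IsLocalization.injective _ C.asIdeal.primeCompl_le_nonZeroDivisors

theorem localization_isDiscreteValuationRing {C : PrimeSpectrum (Base k)} (hC : IsPrimeDivisor C) :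
    IsDiscreteValuationRing (Localization.AtPrime C.asIdeal) := by
  obtain ⟨p, hp, h⟩ := C.isPrime.exists_prime_eq_span_of_height_eq_one hC
  refine .of_maximalIdeal_eq_span (maximalIdeal_localization_eq_span h) ?_
  exact (map_ne_zero_iff _ (algebraMap_localization_injective C)).2 hp.ne_zero

theorem isUnit_X_localization {C : PrimeSpectrum (Base k)} (hC : IsPrimeDivisor C) (i : Fin 2)
    (hi : C ≠ axis k i) :
    IsUnit (algebraMap (Base k) (Localization.AtPrime C.asIdeal) (MvPowerSeries.X i)) := by
  refine IsLocalization.map_units (M := C.asIdeal.primeCompl) _ ⟨MvPowerSeries.X i, fun h => hi ?_⟩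
  exact PrimeSpectrum.ext (Ideal.eq_span_singleton_of_height_eq_one hC h (X_prime i))

end Base
end SkewTerminal

/-! ### Hereditary rings by averaging over a finite group -/

section Average

variable {T B G : Type*} [CommRing T] [Ring B] [Group G] [Finite G] {φ : T →+* B} {γ : G →* B}

/-- Maschke's theorem for a ring `B` generated by a commutative ring `T` and a finite group
normalising it: if the order of the group is invertible, a `B`-module which is projective over `T`
is projective over `B`. -/
theorem Module.Projective.of_average [Module T B] (hB : ∀ (x : T) (b : B), x • b = φ x * b)
    (hγ : ∀ g x, ∃ y, γ g * φ x = φ y * γ g)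
    (hgen : Subring.closure (Set.range φ ∪ Set.range γ) = ⊤)
    (hcard : IsUnit (Nat.card G : B)) {M : Type*} [AddCommGroup M] [Module B M] [Module T M]
    (hM : ∀ (x : T) (m : M), x • m = φ x • m) [Module.Projective T M] :
    Module.Projective B M := by
  classical
  cases nonempty_fintype G
  have hP : ∀ (x : T) (p : M →₀ B), x • p = φ x • p := fun x p => by
    ext m; simp [hB]
  let p : (M →₀ B) →ₗ[B] M := Finsupp.linearCombination B id
  let p' : (M →₀ B) →ₗ[T] M :=
    { toFun := p, map_add' := p.map_add, map_smul' := fun x q => by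
        rw [hP, map_smul, RingHom.id_apply, hM] }
  obtain ⟨f, hf⟩ := Module.projective_lifting_property p' LinearMap.id
    (fun m => ⟨Finsupp.single m 1, by simp [p', p]⟩)
  have hf' : ∀ m : M, p (f m) = m := fun m => LinearMap.congr_fun hf m
  have hinv : ∀ g, γ g⁻¹ * γ g = 1 := fun g => by rw [← map_mul, inv_mul_cancel, map_one]
  have hinv' : ∀ g, γ g * γ g⁻¹ = 1 := fun g => by rw [← map_mul, mul_inv_cancel, map_one]
  -- Sum of the conjugates of the `T`-linear section `f`. It is `B`-linear and is a section up to
  -- the factor `|G|`, which is divided out at the end.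
  let F : M →+ (M →₀ B) :=
    { toFun := fun m => ∑ g : G, γ g • f (γ g⁻¹ • m)
      map_zero' := by simp
      map_add' := fun m m' => by simp [Finset.sum_add_distrib] }
  have hFg : ∀ (h : G) (m : M), F (γ h • m) = γ h • F m := by
    intro h m
    change ∑ g : G, _ = γ h • ∑ g : G, _
    rw [Finset.smul_sum, ← Equiv.sum_comp (Equiv.mulLeft h)]
    refine Finset.sum_congr rfl fun g _ => ?_
    simp only [Equiv.coe_mulLeft, smul_smul, ← map_mul]
    simp
  have hFx : ∀ (x : T) (m : M), F (φ x • m) = φ x • F m := by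
    intro x m
    change ∑ g : G, _ = φ x • ∑ g : G, _
    rw [Finset.smul_sum]
    refine Finset.sum_congr rfl fun g _ => ?_
    -- Inside a single summand `x` moves past `γ g⁻¹` and becomes `y`, passes through the `T`-linear
    -- `f`, and is turned back into `x` by `γ g`.
    obtain ⟨y, hy⟩ := hγ g⁻¹ x
    have hy' : γ g * φ y = φ x * γ g := by
      calc γ g * φ y = γ g * (φ y * γ g⁻¹) * γ g := by rw [mul_assoc, mul_assoc, hinv, mul_one]
        _ = φ x * γ g := by rw [← hy, ← mul_assoc, hinv', one_mul]
    rw [smul_smul, hy, mul_smul, ← hM, map_smul, hP, smul_smul, hy', mul_smul]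
  have hF : ∀ (b : B) (m : M), F (b • m) = b • F m := by
    intro b
    have hb : b ∈ Subring.closure (Set.range φ ∪ Set.range γ) := hgen ▸ Subring.mem_top b
    induction hb using Subring.closure_induction with
    | mem b hb =>
      rcases hb with ⟨x, rfl⟩ | ⟨g, rfl⟩
      exacts [hFx x, hFg g]
    | zero => simp
    | one => simp
    | add a b _ _ ha hb => intro m; rw [add_smul, map_add, ha, hb, add_smul]
    | neg a _ ha => intro m; rw [neg_smul, map_neg, ha, neg_smul]
    | mul a b _ _ ha hb => intro m; rw [mul_smul, ha, hb, mul_smul]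
  have hpF : ∀ m : M, p (F m) = (Nat.card G : B) • m := by
    intro m
    change p (∑ g : G, _) = _
    rw [map_sum]
    have : ∀ g : G, p (γ g • f (γ g⁻¹ • m)) = m := fun g => by
      rw [map_smul, hf', smul_smul, hinv', one_smul]
    simp [this, Nat.card_eq_fintype_card, Nat.cast_smul_eq_nsmul]
  obtain ⟨N, hN⟩ := hcard
  have hNc : ∀ b : B, Commute b (↑N⁻¹ : B) := fun b => by
    refine Commute.units_inv_right ?_
    rw [hN]; exact (Nat.cast_commute _ b).symm
  refine ⟨⟨{ toFun := fun m => (↑N⁻¹ : B) • F m, map_add' := by simp, map_smul' := ?_ }, ?_⟩⟩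
  · intro b m
    rw [hF, RingHom.id_apply, smul_smul, smul_smul, (hNc b).eq]
  · intro m
    change p ((↑N⁻¹ : B) • F m) = m
    rw [map_smul, hpF, ← hN, smul_smul, Units.inv_mul, one_smul]

/-- A left ideal is finite and torsion free over the Dedekind domain `T`, hence flat and finitely
presented, hence projective over `T`; averaging lifts this to `B`. -/
theorem Ideal.projective_of_average [IsDedekindDomain T] [Module T B] [Module.Finite T B]
    [Module.IsTorsionFree T B] (hB : ∀ (x : T) (b : B), x • b = φ x * b)
    (hγ : ∀ g x, ∃ y, γ g * φ x = φ y * γ g)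
    (hgen : Subring.closure (Set.range φ ∪ Set.range γ) = ⊤)
    (hcard : IsUnit (Nat.card G : B)) (I : Ideal B) : Module.Projective B I := by
  let I' : Submodule T B :=
    { carrier := I, add_mem' := I.add_mem, zero_mem' := I.zero_mem
      smul_mem' := fun x b hb => by rw [hB]; exact I.mul_mem_left _ hb }
  let : Module T I := inferInstanceAs (Module T I')
  have : Module.Finite T I := inferInstanceAs (Module.Finite T I')
  have : Module.IsTorsionFree T I := inferInstanceAs (Module.IsTorsionFree T I')
  have : Module.Projective T I :=
    have := Module.finitePresentation_of_finite T I
    Module.Flat.projective_of_finitePresentation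
  exact Module.Projective.of_average hB hγ hgen hcard fun x m => Subtype.ext (hB x m)

section Integral

variable {Λ : Type*} [CommRing Λ] [IsDomain Λ] [Algebra Λ T]

theorem Ideal.projective_of_average_of_isIntegral [Algebra Λ B] [Module.Finite Λ B]
    [Module.IsTorsionFree Λ B] [Algebra.IsIntegral Λ T] [IsDedekindDomain T] {φ : T →ₐ[Λ] B}
    (hγ : ∀ g x, ∃ y, γ g * φ x = φ y * γ g)
    (hgen : Subring.closure (Set.range φ ∪ Set.range γ) = ⊤)
    (hcard : IsUnit (Nat.card G : B)) (I : Ideal B) : Module.Projective B I := by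
  let : Module T B := Module.compHom B φ.toRingHom
  have : IsScalarTower Λ T B := ⟨fun r x b => by
    change φ (r • x) * b = r • (φ x * b)
    rw [map_smul, smul_mul_assoc]⟩
  have : Module.Finite T B := Module.Finite.of_restrictScalars_finite Λ T B
  -- A nonzero element of `T` is integral over `Λ` and so divides a nonzero element of `Λ`, which
  -- acts injectively on `B`.
  have : Module.IsTorsionFree T B := .of_smul_eq_zero fun x b h => by
    by_contra! hxb
    obtain ⟨r, hr, y, hy⟩ :=
      (Algebra.IsIntegral.isIntegral (R := Λ) x).isAlgebraic.exists_nonzero_dvd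
        (mem_nonZeroDivisors_of_ne_zero hxb.1)
    have : r • b = 0 := by
      rw [← algebraMap_smul T r b, hy, mul_comm, mul_smul, h, smul_zero]
    exact hxb.2 ((smul_eq_zero.1 this).resolve_left hr)
  exact Ideal.projective_of_average (φ := φ.toRingHom) (fun _ _ => rfl) hγ hgen hcard I

/-- A ring finite and torsion free over a domain `Λ`, and generated by a Dedekind domain `T`
integral over `Λ` and by a finite group of invertible order normalising `T`, is hereditary. -/
theorem IsHereditaryRing.of_average [Algebra Λ B] [Module.Finite Λ B]
    [Module.IsTorsionFree Λ B] [Algebra.IsIntegral Λ T] [IsDedekindDomain T] {φ : T →ₐ[Λ] B}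
    (hγ : ∀ g x, ∃ y, γ g * φ x = φ y * γ g)
    (hgen : Subring.closure (Set.range φ ∪ Set.range γ) = ⊤)
    (hcard : IsUnit (Nat.card G : B)) : IsHereditaryRing B := by
  refine ⟨Ideal.projective_of_average_of_isIntegral hγ hgen hcard, ?_⟩
  -- Right ideals are left ideals of the opposite ring. There `T` embeds because it is commutative,
  -- and `G` maps multiplicatively after inversion.
  let φ' : T →ₐ[Λ] Bᵐᵒᵖ :=
    { toFun := fun x => MulOpposite.op (φ x)
      map_one' := by simp
      map_mul' := fun x y => by rw [mul_comm, map_mul, MulOpposite.op_mul]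
      map_zero' := by simp
      map_add' := by simp
      commutes' := fun r => by simp }
  let γ' : G →* Bᵐᵒᵖ :=
    { toFun := fun g => MulOpposite.op (γ g⁻¹)
      map_one' := by simp
      map_mul' := fun g h => by rw [mul_inv_rev, map_mul, MulOpposite.op_mul] }
  have : Module.Finite Λ Bᵐᵒᵖ := Module.Finite.equiv (MulOpposite.opLinearEquiv Λ)
  have : Module.IsTorsionFree Λ Bᵐᵒᵖ := .of_smul_eq_zero fun x b h => by
    have h : x • b.unop = 0 := congrArg MulOpposite.unop h
    simpa using h
  refine Ideal.projective_of_average_of_isIntegral (φ := φ') (γ := γ') ?_ ?_ ?_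
  · intro g x
    obtain ⟨y, hy⟩ := hγ g x
    refine ⟨y, congrArg MulOpposite.op (?_ : φ x * γ g⁻¹ = γ g⁻¹ * φ y)⟩
    have h1 : γ g⁻¹ * γ g = 1 := by rw [← map_mul, inv_mul_cancel, map_one]
    have h2 : γ g * γ g⁻¹ = 1 := by rw [← map_mul, mul_inv_cancel, map_one]
    calc φ x * γ g⁻¹ = γ g⁻¹ * (γ g * φ x) * γ g⁻¹ := by rw [← mul_assoc, h1, one_mul]
      _ = γ g⁻¹ * φ y := by rw [hy, mul_assoc, mul_assoc, h2, mul_one]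
  · rw [eq_top_iff]
    rintro b -
    obtain ⟨b, rfl⟩ := MulOpposite.op_surjective b
    have hb : b ∈ Subring.closure (Set.range φ ∪ Set.range γ) := hgen ▸ Subring.mem_top b
    induction hb using Subring.closure_induction with
    | mem b hb =>
      refine Subring.subset_closure ?_
      rcases hb with ⟨x, rfl⟩ | ⟨g, rfl⟩
      exacts [Or.inl ⟨x, rfl⟩, Or.inr ⟨g⁻¹, by simp [γ']⟩]
    | zero => exact Subring.zero_mem _
    | one => exact Subring.one_mem _
    | add a b _ _ ha hb => exact Subring.add_mem _ ha hb
    | neg a _ ha => exact Subring.neg_mem _ ha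
    | mul a b _ _ ha hb => exact Subring.mul_mem _ hb ha
  · have := hcard.op
    rwa [MulOpposite.op_natCast] at this

end Integral

end Average

/-! ### Twisted group bases: trace, radical and residue centre -/

noncomputable section

/-- A basis, indexed by a group, which is multiplicative up to scalars (which may vanish). -/
structure IsTwistedBasis {X Λ B : Type*} [AddCommGroup X] [CommRing Λ] [Ring B] [Algebra Λ B]
    (b : Module.Basis X Λ B) (c : X → X → Λ) : Prop where
  one : b 0 = 1
  mul : ∀ x y, b x * b y = c x y • b (x + y)

namespace IsTwistedBasis

variable {X Λ B : Type*} [AddCommGroup X] [CommRing Λ] [Ring B] [Algebra Λ B]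
  {b : Module.Basis X Λ B} {c : X → X → Λ}

theorem baseChange (h : IsTwistedBasis b c) (Λ' : Type*) [CommRing Λ'] [Algebra Λ Λ'] :
    IsTwistedBasis (b.baseChange Λ') (fun x y => algebraMap Λ Λ' (c x y)) where
  one := by rw [Module.Basis.baseChange_apply, h.one, Algebra.TensorProduct.one_def]
  mul x y := by
    simp only [Module.Basis.baseChange_apply, Algebra.TensorProduct.tmul_mul_tmul, h.mul,
      mul_one, TensorProduct.tmul_smul, algebraMap_smul]

theorem isUnit (h : IsTwistedBasis b c) {x : X} (h1 : IsUnit (c x (-x)))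
    (h2 : IsUnit (c (-x) x)) : IsUnit (b x) := by
  have e1 : b x * b (-x) = algebraMap Λ B (c x (-x)) := by
    rw [h.mul, add_neg_cancel, h.one, Algebra.algebraMap_eq_smul_one]
  have e2 : b (-x) * b x = algebraMap Λ B (c (-x) x) := by
    rw [h.mul, neg_add_cancel, h.one, Algebra.algebraMap_eq_smul_one]
  have h1 := h1.map (algebraMap Λ B)
  have h2 := h2.map (algebraMap Λ B)
  rw [← e1] at h1
  rw [← e2] at h2
  exact isUnit_iff_exists_and_exists.2
    ⟨⟨_, (mul_assoc _ _ _).symm.trans h1.mul_val_inv⟩, ⟨_, (mul_assoc _ _ _).trans h2.val_inv_mul⟩⟩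

variable [Finite X]

/-- Left multiplication by `b y` moves every basis line to a different one unless `y = 0`, so it has
trace zero there. Multiplying `z` by `b (-x)` shifts its `x`-component to `b 0`, and the trace
recovers the coefficient at `x` up to `c x (-x)`. -/
theorem trace_lmul (h : IsTwistedBasis b c) (z : B) (x : X) :
    LinearMap.trace Λ B (LinearMap.mulLeft Λ (z * b (-x))) =
      Nat.card X * (b.repr z x * c x (-x)) := by
  classical
  cases nonempty_fintype X
  have hb : ∀ y, LinearMap.trace Λ B (LinearMap.mulLeft Λ (b y)) =
      if y = 0 then (Nat.card X : Λ) else 0 := by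
    intro y
    rw [LinearMap.trace_eq_matrix_trace Λ b, Matrix.trace]
    simp only [Matrix.diag_apply, LinearMap.toMatrix_apply, LinearMap.mulLeft_apply]
    split_ifs with hy
    · simp [hy, h.one, Nat.card_eq_fintype_card]
    · refine Finset.sum_eq_zero fun w _ => ?_
      rw [h.mul, map_smul, Finsupp.smul_apply, b.repr_self, Finsupp.single_eq_of_ne, smul_zero]
      simpa using hy
  have hz0 : z * b (-x) = ∑ y, (b.repr z y * c y (-x)) • b (y - x) := by
    conv_lhs => rw [← b.sum_repr z]
    rw [Finset.sum_mul]
    simp only [smul_mul_assoc, h.mul, sub_eq_add_neg, smul_smul]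
  have hz : LinearMap.mulLeft Λ (z * b (-x)) =
      ∑ y, (b.repr z y * c y (-x)) • LinearMap.mulLeft Λ (b (y - x)) := by
    ext w
    rw [LinearMap.mulLeft_apply, hz0]
    simp [Finset.sum_mul]
  rw [hz, map_sum]
  simp [hb, sub_eq_zero, mul_comm]

/-- The radical of a finite-dimensional algebra is nilpotent, so `z * b (-x)` acts nilpotently and
has trace zero; the factor `|X|` is invertible in characteristic zero. -/
theorem repr_mul_eq_zero_of_mem_jacobson {κ Q : Type*} [Field κ] [CharZero κ] [Ring Q]
    [Algebra κ Q] {b : Module.Basis X κ Q} {c : X → X → κ} (h : IsTwistedBasis b c) {z : Q}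
    (hz : z ∈ Ring.jacobson Q) (x : X) : b.repr z x * c x (-x) = 0 := by
  have : Module.Finite κ Q := .of_basis b
  have : IsArtinianRing Q := IsArtinianRing.of_finite κ Q
  obtain ⟨N, hN⟩ := IsArtinianRing.isNilpotent_jacobson_bot (R := Q)
  rw [Ideal.jacobson_bot] at hN
  have hzx : z * b (-x) ∈ Ring.jacobson Q := Ideal.mul_mem_right _ _ hz
  have hnil : IsNilpotent (LinearMap.mulLeft κ (z * b (-x))) := by
    have h0 := Ideal.pow_mem_pow hzx N
    rw [hN, Ideal.zero_eq_bot, Ideal.mem_bot] at h0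
    exact ⟨N, by rw [LinearMap.pow_mulLeft, h0, LinearMap.mulLeft_zero_eq_zero]⟩
  have := (LinearMap.isNilpotent_trace_of_isNilpotent hnil).eq_zero
  rw [h.trace_lmul] at this
  exact (mul_eq_zero.1 this).resolve_left (Nat.cast_ne_zero.2 Nat.card_pos.ne')

section Local

variable [IsLocalRing Λ] [CharZero (IsLocalRing.ResidueField Λ)]

/-- Reduction to the residue field is surjective on the algebra and carries radical into radical,
which leaves the case of a field. -/
theorem repr_mul_mem_of_mem_jacobson (h : IsTwistedBasis b c) {z : B}
    (hz : z ∈ Ring.jacobson B) (x : X) : b.repr z x * c x (-x) ∈ IsLocalRing.maximalIdeal Λ := by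
  let κ := IsLocalRing.ResidueField Λ
  let f : B →ₐ[Λ] κ ⊗[Λ] B := Algebra.TensorProduct.includeRight
  have hf : Function.Surjective f :=
    Algebra.TensorProduct.includeRight_surjective _ IsLocalRing.residue_surjective
  have : RingHomSurjective f.toRingHom := ⟨hf⟩
  have hfz : f z ∈ Ring.jacobson (κ ⊗[Λ] B) := Ring.le_comap_jacobson f.toRingHom hz
  have := (h.baseChange κ).repr_mul_eq_zero_of_mem_jacobson hfz x
  rw [show f z = (1 : κ) ⊗ₜ z from rfl, Module.Basis.baseChange_repr_tmul] at this
  rw [← IsLocalRing.residue_eq_zero_iff, map_mul]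
  rwa [Algebra.smul_def, mul_one] at this

variable [Module.Finite Λ B] {X₀ : Set X}

/-- The radical contains the basis elements off `X₀` and the multiples of the maximal ideal. The
trace shows that nothing else occurs, since it controls exactly the coefficients at which `c x (-x)`
is a unit. -/
theorem mem_jacobson_iff (h : IsTwistedBasis b c) (hrad : ∀ x ∉ X₀, b x ∈ Ring.jacobson B)
    (hunit : ∀ x ∈ X₀, IsUnit (c x (-x))) (z : B) :
    z ∈ Ring.jacobson B ↔ ∀ x ∈ X₀, b.repr z x ∈ IsLocalRing.maximalIdeal Λ := by
  cases nonempty_fintype X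
  refine ⟨fun hz x hx => ?_, fun hz => ?_⟩
  · exact ((IsLocalRing.maximalIdeal.isMaximal Λ).isPrime.mem_or_mem
      (h.repr_mul_mem_of_mem_jacobson hz x)).resolve_right fun h' =>
        (IsLocalRing.mem_maximalIdeal _).1 h' (hunit x hx)
  · rw [← b.sum_repr z]
    refine Ideal.sum_mem _ fun x _ => ?_
    rw [Algebra.smul_def]
    by_cases hx : x ∈ X₀
    · exact Ideal.mul_mem_right _ _ (algebraMap_mem_jacobson (hz x hx))
    · exact Ideal.mul_mem_left _ _ (hrad x hx)

end Local

end IsTwistedBasis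

namespace OrderRamification

/-- The inclusion of `Z(B / rad B)` into `B / rad B`. -/
def ResidueCentre.val (B : Type*) [Ring B] : ResidueCentre B →+* B ⧸ Ring.jacobson B :=
  (Subring.center (B ⧸ Ring.jacobson B)).subtype

theorem ResidueCentre.val_injective (B : Type*) [Ring B] :
    Function.Injective (ResidueCentre.val B) := Subtype.val_injective

theorem ResidueCentre.mul_comm_val {B : Type*} [Ring B] (z : ResidueCentre B)
    (y : B ⧸ Ring.jacobson B) : y * val B z = val B z * y :=
  Subring.mem_center_iff.1 z.2 y

theorem ResidueCentre.exists_val_eq {B : Type*} [Ring B] {z : B}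
    (hz : ∀ y, y * z - z * y ∈ Ring.jacobson B) :
    ∃ z', val B z' = Ideal.Quotient.mk (Ring.jacobson B) z :=
  ⟨⟨Ideal.Quotient.mk (Ring.jacobson B) z, Subring.mem_center_iff.2 fun y => by
    obtain ⟨y, rfl⟩ := Ideal.Quotient.mk_surjective y
    rw [← map_mul, ← map_mul, Ideal.Quotient.mk_eq_mk_iff_sub_mem]
    exact hz y⟩, rfl⟩

theorem ResidueCentre.val_residue_smul {Λ B : Type*} [CommRing Λ] [IsLocalRing Λ] [Ring B]
    [Algebra Λ B] [Module.Finite Λ B] (r : Λ) (z : ResidueCentre B) :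
    val B (IsLocalRing.residue Λ r • z) =
      Ideal.Quotient.mk (Ring.jacobson B) (algebraMap Λ B r) * val B z := rfl

end OrderRamification

namespace IsTwistedBasis

variable {X Λ B : Type*} [AddCommGroup X] [Finite X] [CommRing Λ] [Ring B] [Algebra Λ B]
  {b : Module.Basis X Λ B} {c : X → X → Λ}
  [IsLocalRing Λ] [CharZero (IsLocalRing.ResidueField Λ)]
  [Module.Finite Λ B] {X₀ : Set X}

/-- The centre of the residue algebra is spanned by the basis elements which commute with a
system of units. -/
theorem exists_basis_residueCentre (h : IsTwistedBasis b c)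
    (hrad : ∀ x ∉ X₀, b x ∈ Ring.jacobson B) (hunit : ∀ x ∈ X₀, IsUnit (c x (-x)))
    {ι : Type*} {g : ι → B} {χ : ι → X → Λ} (hg : ∀ i, IsUnit (g i))
    (hχ : ∀ i x, g i * b x = χ i x • (b x * g i))
    (hχ1 : ∀ i, ∀ x, χ i x = 1 ∨ IsUnit (χ i x - 1)) {X₁ : Set X}
    (hX₁ : ∀ x, x ∈ X₁ ↔ x ∈ X₀ ∧ ∀ i, χ i x = 1)
    (hcomm : ∀ x ∈ X₁, ∀ y ∈ X₀, b x * b y = b y * b x) :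
    ∃ β : Module.Basis X₁ (IsLocalRing.ResidueField Λ) (ResidueCentre B),
      ∀ x : X₁, ResidueCentre.val B (β x) = Ideal.Quotient.mk (Ring.jacobson B) (b x) := by
  classical
  cases nonempty_fintype X
  have hcentral : ∀ x : X₁, ∃ z', ResidueCentre.val B z' =
      Ideal.Quotient.mk (Ring.jacobson B) (b x) := by
    intro x
    refine ResidueCentre.exists_val_eq fun y => ?_
    rw [← b.sum_repr y, Finset.sum_mul, Finset.mul_sum, ← Finset.sum_sub_distrib]
    refine Ideal.sum_mem _ fun w _ => ?_
    rw [smul_mul_assoc, mul_smul_comm, ← smul_sub, Algebra.smul_def]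
    refine Ideal.mul_mem_left _ _ ?_
    by_cases hw : w ∈ X₀
    · rw [hcomm x x.2 w hw, sub_self]; exact Ideal.zero_mem _
    · exact Ideal.sub_mem _ (Ideal.mul_mem_right _ _ (hrad w hw))
        (Ideal.mul_mem_left _ _ (hrad w hw))
  choose v hv using hcentral
  have hsum : ∀ r : X₁ → Λ, ResidueCentre.val B (∑ x, IsLocalRing.residue Λ (r x) • v x) =
      Ideal.Quotient.mk (Ring.jacobson B) (∑ x, r x • b x) := by
    intro r
    simp only [map_sum, ResidueCentre.val_residue_smul, hv]
    simp only [Algebra.smul_def, map_mul]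
  have hrepr : ∀ (r : X₁ → Λ) (x : X₁), b.repr (∑ x, r x • b x) x = r x := by
    intro r x
    simp [Finsupp.single_apply, Subtype.val_inj]
  have hmem := h.mem_jacobson_iff hrad hunit
  have hli : LinearIndependent (IsLocalRing.ResidueField Λ) v := by
    rw [Fintype.linearIndependent_iff]
    intro r hr x
    choose r' hr' using fun x => IsLocalRing.residue_surjective (r x)
    obtain rfl : r = fun x => IsLocalRing.residue Λ (r' x) := funext fun x => (hr' x).symm
    have h1 := hsum r'
    rw [hr, map_zero, eq_comm, Ideal.Quotient.eq_zero_iff_mem, hmem] at h1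
    rw [IsLocalRing.residue_eq_zero_iff, ← hrepr r' x]
    exact h1 x ((hX₁ x).1 x.2).1
  refine ⟨Module.Basis.mk hli ?_, fun x => by rw [Module.Basis.mk_apply, hv]⟩
  rintro z -
  obtain ⟨y, hy⟩ := Ideal.Quotient.mk_surjective (ResidueCentre.val B z)
  -- The lift `y` commutes with `g i` modulo the radical. The commutator is `∑ (χ i x - 1) y_x b x`
  -- times the unit `g i`, and the description of the radical applies to that sum.
  have hyg : ∀ i, ∀ x ∈ X₀, (χ i x - 1) * b.repr y x ∈ IsLocalRing.maximalIdeal Λ := by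
    intro i
    have h1 : g i * y - y * g i ∈ Ring.jacobson B := by
      rw [← Ideal.Quotient.mk_eq_mk_iff_sub_mem, map_mul, map_mul, hy, ResidueCentre.mul_comm_val]
    have h2 : g i * y - y * g i = (∑ x, ((χ i x - 1) * b.repr y x) • b x) * g i := by
      conv_lhs => rw [← b.sum_repr y]
      rw [Finset.sum_mul, Finset.sum_mul, Finset.mul_sum, ← Finset.sum_sub_distrib]
      refine Finset.sum_congr rfl fun x _ => ?_
      rw [mul_smul_comm, hχ, smul_mul_assoc, smul_mul_assoc, smul_smul, ← sub_smul]
      congr 1; ring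
    have h3 : ∑ x, ((χ i x - 1) * b.repr y x) • b x ∈ Ring.jacobson B := by
      obtain ⟨u, hu⟩ := hg i
      have := Ideal.mul_mem_right (↑u⁻¹ : B) _ h1
      rwa [h2, ← hu, mul_assoc, Units.mul_inv, mul_one] at this
    intro x hx
    have := (hmem _).1 h3 x hx
    simpa [Finsupp.single_apply] using this
  -- Off `X₁` but inside `X₀` some `χ i x - 1` is a unit, by `hχ1`, so the coefficient itself lies
  -- in the maximal ideal and the term can be dropped.
  have h4 : y - ∑ x : X₁, b.repr y x • b x ∈ Ring.jacobson B := by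
    rw [hmem]
    intro x hx
    by_cases hx1 : x ∈ X₁
    · rw [map_sub, Finsupp.sub_apply, hrepr (fun x => b.repr y x) ⟨x, hx1⟩, sub_self]
      exact Ideal.zero_mem _
    · have h0 : b.repr (∑ x : X₁, b.repr y x • b x) x = 0 := by
        rw [map_sum, Finsupp.finsetSum_apply]
        refine Finset.sum_eq_zero fun w _ => ?_
        rw [map_smul, Finsupp.smul_apply, b.repr_self, Finsupp.single_eq_of_ne, smul_zero]
        rintro rfl
        exact hx1 w.2
      rw [map_sub, Finsupp.sub_apply, h0, sub_zero]
      have : ∃ i, χ i x ≠ 1 := by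
        by_contra! hc
        exact hx1 ((hX₁ x).2 ⟨hx, hc⟩)
      obtain ⟨i, hi⟩ := this
      exact (Ideal.unit_mul_mem_iff_mem _ ((hχ1 i x).resolve_left hi)).1 (hyg i x hx)
  have h5 : z = ∑ x : X₁, IsLocalRing.residue Λ (b.repr y x) • v x := by
    apply ResidueCentre.val_injective
    rw [hsum, ← hy, Ideal.Quotient.mk_eq_mk_iff_sub_mem]
    exact h4
  rw [h5]
  exact Submodule.sum_mem _ fun x _ => Submodule.smul_mem _ _ (Submodule.subset_span ⟨x, rfl⟩)

end IsTwistedBasis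

/-! ### Centre and simplicity from a basis of conjugation eigenvectors -/

section Eigenbasis

variable {X ι Λ B : Type*} [Finite X] [CommRing Λ] [IsDomain Λ] [Ring B] [Algebra Λ B]
  {b : Module.Basis X Λ B} {g : ι → B} {χ : ι → X → Λ}

/-- Conjugation by each `g i` scales the basis elements, and these are separated from `x₀`: then
the centre is spanned by `b x₀`. -/
theorem Module.Basis.repr_eq_zero_of_mem_center (hg : ∀ i z, z * g i = 0 → z = 0)
    (hχ : ∀ i x, g i * b x = χ i x • (b x * g i)) {z : B} (hz : z ∈ Subring.center B) {x : X}
    (hx : ∃ i, χ i x ≠ 1) : b.repr z x = 0 := by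
  cases nonempty_fintype X
  obtain ⟨i, hi⟩ := hx
  have h1 : g i * z - z * g i = 0 := by rw [Subring.mem_center_iff.1 hz, sub_self]
  have h2 : g i * z - z * g i = (∑ x, ((χ i x - 1) * b.repr z x) • b x) * g i := by
    conv_lhs => rw [← b.sum_repr z]
    rw [Finset.sum_mul, Finset.sum_mul, Finset.mul_sum, ← Finset.sum_sub_distrib]
    refine Finset.sum_congr rfl fun x _ => ?_
    rw [mul_smul_comm, hχ, smul_mul_assoc, smul_mul_assoc, smul_smul, ← sub_smul]
    congr 1; ring
  have h3 := hg i _ (h2.symm.trans h1)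
  have := congrArg (fun w => b.repr w x) h3
  simp only [map_sum, map_smul, b.repr_self, Finsupp.smul_single, smul_eq_mul, mul_one, map_zero,
    Finsupp.coe_zero, Pi.zero_apply, Finsupp.finsetSum_apply] at this
  classical
  simp only [Finsupp.single_apply, Finset.sum_ite_eq', Finset.mem_univ, if_true] at this
  exact (mul_eq_zero.1 this).resolve_left (sub_ne_zero.2 hi)

/-- An algebra with a basis of units, whose members are separated by the characters through which
they are scaled under conjugation by a set of units, is simple. -/
theorem IsSimpleRing.of_basis {κ Q : Type*} [Field κ] [Ring Q] [Algebra κ Q] [Nontrivial Q]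
    {b : Module.Basis X κ Q} {g : ι → Q} {χ : ι → X → κ} (hb : ∀ x, IsUnit (b x))
    (hg : ∀ i, IsUnit (g i)) (hχ : ∀ i x, g i * b x = χ i x • (b x * g i))
    (hsep : ∀ x y, (∀ i, χ i x = χ i y) → x = y) : IsSimpleRing Q := by
  classical
  cases nonempty_fintype X
  -- Descent on the number of monomials in a nonzero element of the ideal: with one monomial it is a
  -- unit; with two separated by some `χ i`, a conjugate minus `χ i x` times the element loses the
  -- monomial `x` and keeps `y`.
  have key : ∀ (I : TwoSidedIdeal Q) (N : ℕ), ∀ z ∈ I, z ≠ 0 → (b.repr z).support.card = N →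
      I = ⊤ := by
    intro I N
    induction N using Nat.strong_induction_on with
    | _ N ih =>
    intro z hz hz0 hN
    obtain ⟨x, hx⟩ : (b.repr z).support.Nonempty := by simpa using hz0
    by_cases hall : ∀ y ∈ (b.repr z).support, y = x
    · have hzx : z = b.repr z x • b x := by
        conv_lhs => rw [← b.sum_repr z]
        refine Finset.sum_eq_single x (fun y _ hy => ?_) (by simp)
        rw [Finsupp.notMem_support_iff.1 fun h => hy (hall y h), zero_smul]
      have hu : IsUnit z := by
        rw [hzx, Algebra.smul_def]
        exact (((isUnit_iff_ne_zero.2 (Finsupp.mem_support_iff.1 hx)).map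
          (algebraMap κ Q))).mul (hb x)
      obtain ⟨u, rfl⟩ := hu
      have h1 : (1 : Q) ∈ I := by
        have := I.mul_mem_left (↑u⁻¹ : Q) _ hz
        rwa [Units.inv_mul] at this
      exact eq_top_iff.2 fun y _ => by simpa using I.mul_mem_left y _ h1
    · push Not at hall
      obtain ⟨y, hy, hyx⟩ := hall
      obtain ⟨i, hi⟩ : ∃ i, χ i y ≠ χ i x := by
        by_contra! hc
        exact hyx (hsep y x hc)
      obtain ⟨u, hu⟩ := hg i
      have hconj : ∀ w, g i * b w * ↑u⁻¹ = χ i w • b w := by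
        intro w
        rw [hχ, ← hu, smul_mul_assoc, mul_assoc, Units.mul_inv, mul_one]
      let z' : Q := g i * z * ↑u⁻¹ - χ i x • z
      have hz' : z' = ∑ w, ((χ i w - χ i x) * b.repr z w) • b w := by
        simp only [z']
        conv_lhs => rw [← b.sum_repr z]
        rw [Finset.mul_sum, Finset.sum_mul, Finset.smul_sum, ← Finset.sum_sub_distrib]
        refine Finset.sum_congr rfl fun w _ => ?_
        rw [mul_smul_comm, smul_mul_assoc, hconj, smul_smul, smul_smul, ← sub_smul]
        congr 1; ring
      have hrepr : ∀ w, b.repr z' w = (χ i w - χ i x) * b.repr z w := by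
        intro w
        rw [hz']
        simp [Finsupp.single_apply]
      refine ih _ ?_ z' ?_ ?_ rfl
      · rw [← hN]
        refine Finset.card_lt_card ⟨fun w hw => ?_, fun hsub => ?_⟩
        · rw [Finsupp.mem_support_iff, hrepr] at hw
          exact Finsupp.mem_support_iff.2 (right_ne_zero_of_mul hw)
        · have := hsub hx
          rw [Finsupp.mem_support_iff, hrepr, sub_self, zero_mul] at this
          exact this rfl
      · refine I.sub_mem (I.mul_mem_right _ _ (I.mul_mem_left _ _ hz)) ?_
        rw [Algebra.smul_def]
        exact I.mul_mem_left _ _ hz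
      · intro h0
        have := hrepr y
        rw [h0, map_zero, Finsupp.zero_apply, eq_comm] at this
        exact mul_ne_zero (sub_ne_zero.2 hi) (Finsupp.mem_support_iff.1 hy) this
  refine ⟨⟨fun I => ?_⟩⟩
  by_cases hI : I = ⊥
  · exact Or.inl hI
  · obtain ⟨z, hz, hz0⟩ : ∃ z ∈ I, z ≠ 0 := by
      by_contra! hc
      exact hI (eq_bot_iff.2 fun z hz => by simpa using hc z hz)
    exact Or.inr (key I _ z hz hz0 rfl)

end Eigenbasis
end

/-! ### Eisenstein extensions, possibly split, and their ramification index -/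

noncomputable section

theorem IsIdempotentElem.isIntegral (E : Type*) {Z : Type*} [CommRing E] [CommRing Z]
    [Algebra E Z] {ε : Z} (hε : IsIdempotentElem ε) : IsIntegral E ε :=
  ⟨Polynomial.X * (Polynomial.X - Polynomial.C 1), Polynomial.monic_X.mul
    (Polynomial.monic_X_sub_C 1), by simp [mul_sub, hε.eq]⟩

section Eisenstein

variable {E κ Z : Type*} [CommRing E] [IsDomain E] [IsDiscreteValuationRing E] [Field κ]
  [Algebra E κ] [IsFractionRing E κ] [CommRing Z] [Algebra κ Z] [Algebra E Z] [IsScalarTower E κ Z]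
  {ϖ : E} {ε w : Z} {r : ℕ} {c : Eˣ}

theorem IsDiscreteValuationRing.exists_pow_mul_eq_algebraMap (hϖ : Irreducible ϖ) (a : κ) :
    ∃ (M : ℕ) (a' : E), algebraMap E κ ϖ ^ M * a = algebraMap E κ a' := by
  obtain ⟨x, y, hy, rfl⟩ := IsFractionRing.div_surjective (A := E) a
  have hy0 : y ≠ 0 := nonZeroDivisors.ne_zero hy
  obtain ⟨M, u, rfl⟩ := IsDiscreteValuationRing.eq_unit_mul_pow_irreducible hy0 hϖ
  refine ⟨M, x * ↑u⁻¹, ?_⟩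
  have h1 : algebraMap E κ ϖ ≠ 0 :=
    (map_ne_zero_iff _ (IsFractionRing.injective E κ)).2 hϖ.ne_zero
  have h2 : algebraMap E κ ↑u * algebraMap E κ ↑u⁻¹ = 1 := by
    rw [← map_mul, Units.mul_inv, map_one]
  have h3 : algebraMap E κ ↑u ≠ 0 := left_ne_zero_of_mul_eq_one h2
  rw [map_mul, map_mul, map_pow]
  field_simp
  linear_combination (-algebraMap E κ x) * h2

/-- An idempotent in a `κ`-algebra is not divisible by a uniformiser inside the integral
elements. -/
theorem not_isIntegral_of_mul_eq_idempotent {E : Type*} (κ : Type*) {Z : Type*} [CommRing E]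
    [IsDomain E] [IsDiscreteValuationRing E] [Field κ] [Algebra E κ] [IsFractionRing E κ]
    [CommRing Z] [Algebra κ Z] [Algebra E Z] [IsScalarTower E κ Z] {ϖ : E} {ε : Z}
    (hϖ : Irreducible ϖ) (hε : IsIdempotentElem ε)
    (hε0 : ε ≠ 0) {Y : Z} (hY : IsIntegral E Y) (h : algebraMap E Z ϖ * Y = ε) : False := by
  -- Passing to the component cut out by `ε` turns `ε` into `1`; there `Y` would be an integral
  -- inverse of `ϖ`, contradicting that `E` is integrally closed.
  let I : Ideal Z := Ideal.span {1 - ε}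
  have hI : Nontrivial (Z ⧸ I) := by
    refine Ideal.Quotient.nontrivial_iff.2 fun hI => hε0 ?_
    obtain ⟨t, ht⟩ := Ideal.mem_span_singleton.1 ((Ideal.eq_top_iff_one I).1 hI)
    calc ε = ε * 1 := (mul_one ε).symm
      _ = 0 := by rw [ht, ← mul_assoc, mul_sub, mul_one, hε.eq, sub_self, zero_mul]
  let f : Z →ₐ[E] Z ⧸ I := IsScalarTower.toAlgHom E Z (Z ⧸ I)
  have h1 : f ε = 1 := by
    have : f (1 - ε) = 0 := Ideal.Quotient.eq_zero_iff_mem.2 (Ideal.mem_span_singleton_self _)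
    rw [map_sub, map_one, sub_eq_zero] at this
    exact this.symm
  have hϖ0 : algebraMap E κ ϖ ≠ 0 :=
    (map_ne_zero_iff _ (IsFractionRing.injective E κ)).2 hϖ.ne_zero
  have h2 : f Y = algebraMap κ (Z ⧸ I) (algebraMap E κ ϖ)⁻¹ := by
    have h3 : algebraMap κ (Z ⧸ I) (algebraMap E κ ϖ) * f Y = 1 := by
      rw [← h1, ← h, map_mul, AlgHom.commutes, ← IsScalarTower.algebraMap_apply E κ]
    calc f Y = algebraMap κ (Z ⧸ I) (algebraMap E κ ϖ)⁻¹ *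
          (algebraMap κ (Z ⧸ I) (algebraMap E κ ϖ) * f Y) := by
            rw [← mul_assoc, ← map_mul, inv_mul_cancel₀ hϖ0, map_one, one_mul]
      _ = _ := by rw [h3, mul_one]
  have h4 : IsIntegral E (algebraMap E κ ϖ)⁻¹ := by
    have := hY.map f
    rw [h2] at this
    exact (isIntegral_algebraMap_iff (algebraMap κ (Z ⧸ I)).injective).1 this
  obtain ⟨y, hy⟩ := IsIntegrallyClosed.isIntegral_iff.1 h4
  refine hϖ.not_isUnit (IsUnit.of_mul_eq_one y (IsFractionRing.injective E κ ?_))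
  rw [map_mul, hy, mul_inv_cancel₀ hϖ0, map_one]

/-- Modulo `w`, the component at `ε` of the integral closure is generated by `E`, if `w` is
integral, generates that component over `κ`, and is an `r`-th root of a uniformiser there. -/
theorem IsIntegral.exists_idempotent_mul_eq (hϖ : Irreducible ϖ) (hr : r ≠ 0)
    (hε : IsIdempotentElem ε) (hε0 : ε ≠ 0) (hw : IsIntegral E w)
    (hwr : ε * w ^ r = algebraMap E Z (c * ϖ) * ε)
    (hspan : ∀ x, ε * x ∈ Submodule.span κ (Set.range fun j : ℕ => ε * w ^ j)) {x : Z}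
    (hx : IsIntegral E x) : ∃ (d : E) (y : Z), IsIntegral E y ∧
      ε * x = algebraMap E Z d * ε + w * y := by
  classical
  have hεint : IsIntegral E ε := hε.isIntegral E
  -- `S` is `ε E[w]`. The aim is that the component at `ε` of every integral element already lies in
  -- `S`, where division by `w` with remainder in `E` is evident.
  let S : Submodule E Z := Submodule.span E (Set.range fun j : ℕ => ε * w ^ j)
  have hSint : ∀ z ∈ S, IsIntegral E z := by
    intro z hz
    induction hz using Submodule.span_induction with
    | mem z hz => obtain ⟨j, rfl⟩ := hz; exact hεint.mul (hw.pow j)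
    | zero => exact isIntegral_zero
    | add a b _ _ ha hb => exact ha.add hb
    | smul a z _ hz => exact hz.smul a
  have hSε : ∀ z ∈ S, ε * z = z := by
    intro z hz
    induction hz using Submodule.span_induction with
    | mem z hz => obtain ⟨j, rfl⟩ := hz; rw [← mul_assoc, hε.eq]
    | zero => exact mul_zero _
    | add a b _ _ ha hb => rw [mul_add, ha, hb]
    | smul a z _ hz => rw [mul_smul_comm, hz]
  have hSw : ∀ (m : ℕ), ∀ z ∈ S, w ^ m * z ∈ S := by
    intro m z hz
    induction hz using Submodule.span_induction with
    | mem z hz =>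
      obtain ⟨j, rfl⟩ := hz
      exact Submodule.subset_span ⟨m + j, show ε * w ^ (m + j) = w ^ m * (ε * w ^ j) by ring⟩
    | zero => simp
    | add a b _ _ ha hb => rw [mul_add]; exact S.add_mem ha hb
    | smul a z _ hz => rw [mul_smul_comm]; exact S.smul_mem a hz
  have hSdecomp : ∀ z ∈ S, ∃ (d : E), ∃ y ∈ S, z = algebraMap E Z d * ε + w * y := by
    intro z hz
    induction hz using Submodule.span_induction with
    | mem z hz =>
      obtain ⟨j, rfl⟩ := hz
      rcases j with - | j
      · exact ⟨1, 0, S.zero_mem, by simp⟩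
      · exact ⟨0, ε * w ^ j, Submodule.subset_span ⟨j, rfl⟩, by rw [map_zero]; ring⟩
    | zero => exact ⟨0, 0, S.zero_mem, by simp⟩
    | add a b _ _ ha hb =>
      obtain ⟨d, y, hy, rfl⟩ := ha
      obtain ⟨d', y', hy', rfl⟩ := hb
      exact ⟨d + d', y + y', S.add_mem hy hy', by rw [map_add]; ring⟩
    | smul a z _ hz =>
      obtain ⟨d, y, hy, rfl⟩ := hz
      exact ⟨a * d, a • y, S.smul_mem a hy, by simp only [Algebra.smul_def, map_mul]; ring⟩
  have hcancel : ∀ z, w * (ε * z) = 0 → ε * z = 0 := by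
    intro z hz
    have h1 : algebraMap E Z (c * ϖ) * (ε * z) = 0 := by
      rw [← mul_assoc, ← hwr]
      obtain ⟨s, rfl⟩ : ∃ s, r = s + 1 := Nat.exists_eq_succ_of_ne_zero hr
      calc ε * w ^ (s + 1) * z = w ^ s * (w * (ε * z)) := by ring
        _ = 0 := by rw [hz, mul_zero]
    have h2 : algebraMap E κ (c * ϖ) ≠ 0 :=
      (map_ne_zero_iff _ (IsFractionRing.injective E κ)).2 (mul_ne_zero c.ne_zero hϖ.ne_zero)
    rw [IsScalarTower.algebraMap_apply E κ Z, ← Algebra.smul_def] at h1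
    exact (smul_eq_zero.1 h1).resolve_left h2
  have hclear : ∀ z ∈ Submodule.span κ (Set.range fun j : ℕ => ε * w ^ j),
      ∃ M : ℕ, ϖ ^ M • z ∈ S := by
    intro z hz
    induction hz using Submodule.span_induction with
    | mem z hz => exact ⟨0, by simpa using Submodule.subset_span hz⟩
    | zero => exact ⟨0, by simp⟩
    | add a b _ _ ha hb =>
      obtain ⟨M, hM⟩ := ha
      obtain ⟨M', hM'⟩ := hb
      refine ⟨M + M', ?_⟩
      rw [smul_add]
      refine S.add_mem ?_ ?_
      · rw [pow_add, mul_comm, mul_smul]; exact S.smul_mem _ hM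
      · rw [pow_add, mul_smul]; exact S.smul_mem _ hM'
    | smul a z _ hz =>
      obtain ⟨M, hM⟩ := hz
      obtain ⟨M', a', ha'⟩ := IsDiscreteValuationRing.exists_pow_mul_eq_algebraMap hϖ a
      refine ⟨M' + M, ?_⟩
      have : ϖ ^ (M' + M) • a • z = a' • ϖ ^ M • z := by
        rw [pow_add, mul_smul, smul_comm (ϖ ^ M) a z, ← algebraMap_smul κ (ϖ ^ M'), smul_smul,
          map_pow, ha', algebraMap_smul]
      rw [this]
      exact S.smul_mem _ hM
  have hwrpow : ∀ M, ε * w ^ (r * M) = algebraMap E Z ((c : E) ^ M * ϖ ^ M) * ε := by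
    intro M
    induction M with
    | zero => simp
    | succ M ih =>
      calc ε * w ^ (r * (M + 1)) = ε * w ^ (r * M) * w ^ r := by ring
        _ = algebraMap E Z ((c : E) ^ M * ϖ ^ M) * (ε * w ^ r) := by rw [ih]; ring
        _ = _ := by rw [hwr]; simp only [map_mul, map_pow]; ring
  -- A power of `ϖ` clears the denominators of `ε * x`, and on this component `w ^ r` is `ϖ` up to a
  -- unit, so a power of `w` clears them as well.
  have hex : ∃ N : ℕ, w ^ N * (ε * x) ∈ S := by
    obtain ⟨M, hM⟩ := hclear _ (hspan x)
    refine ⟨r * M, ?_⟩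
    have : w ^ (r * M) * (ε * x) = (c : E) ^ M • ϖ ^ M • (ε * x) := by
      calc w ^ (r * M) * (ε * x) = ε * w ^ (r * M) * x := by ring
        _ = _ := by rw [hwrpow]; simp only [Algebra.smul_def, map_mul]; ring
    rw [this]
    exact S.smul_mem _ hM
  -- Take the least exponent `N` and suppose `N = m + 1`. For `z = w ^ m * (ε * x)`, outside `S`,
  -- the product `w * z` equals `d ε + w y` with `y ∈ S`, and both possibilities for `d` are
  -- excluded below.
  have hmem : ε * x ∈ S := by
    have hN := Nat.find_spec hex
    have hmin := fun m => Nat.find_min hex (m := m)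
    set N := Nat.find hex
    rcases hNe : N with - | m
    · simpa [hNe] using hN
    · exfalso
      have hz := hmin m (by omega)
      rw [hNe] at hN
      set z := w ^ m * (ε * x) with hzdef
      have hzint : IsIntegral E z := (hw.pow m).mul (hεint.mul hx)
      have hzε : ε * z = z := by rw [hzdef]; linear_combination w ^ m * x * hε.eq
      obtain ⟨d, y, hy, hdy⟩ := hSdecomp _ hN
      have hwz : w * z = algebraMap E Z d * ε + w * y := by rw [← hdy, hzdef]; ring
      -- If `ϖ` divides `d`, then `d ε` is divisible by `w` in `S`, because `ϖ ε` is a unit times `ε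
      -- * w ^ r`. Cancelling `w` puts `z` in `S`, against minimality.
      by_cases hd : ϖ ∣ d
      · obtain ⟨d', rfl⟩ := hd
        obtain ⟨s, rfl⟩ : ∃ s, r = s + 1 := Nat.exists_eq_succ_of_ne_zero hr
        apply hz
        have hc : algebraMap E Z ↑c⁻¹ * algebraMap E Z c = 1 := by
          rw [← map_mul, Units.inv_mul, map_one]
        have h1 : z - ((d' * ↑c⁻¹ : E) • (ε * w ^ s) + y) = 0 := by
          have h2 : w * (ε * (z - ((d' * ↑c⁻¹ : E) • (ε * w ^ s) + y))) = 0 := by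
            have h3 : ε * w ^ (s + 1) = algebraMap E Z c * algebraMap E Z ϖ * ε := by
              rw [hwr, map_mul]
            rw [map_mul] at hwz
            rw [Algebra.smul_def, map_mul]
            linear_combination ε * hwz + algebraMap E Z ϖ * algebraMap E Z d' * hε.eq
              - algebraMap E Z d' * algebraMap E Z ↑c⁻¹ * w ^ (s + 1) * hε.eq
              - algebraMap E Z d' * algebraMap E Z ↑c⁻¹ * h3
              - algebraMap E Z d' * algebraMap E Z ϖ * ε * hc
          have h3 := hcancel _ h2
          rwa [mul_sub, mul_add, hzε, hSε y hy, mul_smul_comm, ← mul_assoc, hε.eq] at h3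
        rw [sub_eq_zero] at h1
        rw [h1]
        exact S.add_mem (S.smul_mem _ (Submodule.subset_span ⟨s, rfl⟩)) hy
      -- If `d` is a unit, `ε` is `w` times an integral element. Taking `r`-th powers makes `ε`
      -- divisible by `ϖ` among integral elements, which is impossible.
      · have hd : IsUnit d := by
          by_contra h
          refine hd ?_
          have := (IsLocalRing.mem_maximalIdeal d).2 h
          rwa [hϖ.maximalIdeal_eq, Ideal.mem_span_singleton] at this
        obtain ⟨d, rfl⟩ := hd
        have hy' : IsIntegral E (z - y) := hzint.sub (hSint y hy)
        have hdd : algebraMap E Z ↑d⁻¹ * algebraMap E Z d = 1 := by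
          rw [← map_mul, Units.inv_mul, map_one]
        have hwy : ε = w * (algebraMap E Z ↑d⁻¹ * (z - y)) := by
          linear_combination (-algebraMap E Z ↑d⁻¹) * hwz - ε * hdd
        set Y := algebraMap E Z ↑d⁻¹ * (z - y)
        have hY : IsIntegral E Y := isIntegral_algebraMap.mul hy'
        refine not_isIntegral_of_mul_eq_idempotent κ hϖ hε hε0
          (Y := algebraMap E Z c * (ε * Y ^ r))
          (isIntegral_algebraMap.mul (hεint.mul (hY.pow r))) ?_
        calc algebraMap E Z ϖ * (algebraMap E Z c * (ε * Y ^ r))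
            = algebraMap E Z (c * ϖ) * ε * Y ^ r := by rw [map_mul]; ring
          _ = ε * (w * Y) ^ r := by rw [← hwr, mul_pow w, mul_assoc]
          _ = ε := by rw [← hwy, ← pow_succ', hε.pow_succ_eq]
  obtain ⟨d, y, hy, h⟩ := hSdecomp _ hmem
  exact ⟨d, y, hSint y hy, h⟩

end Eisenstein

/-- In a local ring whose maximal ideal is generated by a regular element `w`, the quotient by
`w ^ r` has length `r`. -/
theorem Ring.ord_pow_of_maximalIdeal_eq_span {A : Type*} [CommRing A] [IsLocalRing A] {w : A}
    (h : IsLocalRing.maximalIdeal A = Ideal.span {w}) (hw : w ∈ nonZeroDivisors A) (r : ℕ) :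
    Ring.ord A (w ^ r) = r := by
  have h1 : Ring.ord A w = 1 := by
    rw [Ring.ord, ← h, Module.length_eq_one_iff, isSimpleModule_iff_isCoatom, ← Ideal.isMaximal_def]
    exact IsLocalRing.maximalIdeal.isMaximal A
  rw [Ring.ord_pow hw, h1, nsmul_one]

section Cover

variable {E κ Z : Type*} [CommRing E] [IsDomain E] [IsDiscreteValuationRing E] [Field κ]
  [Algebra E κ] [IsFractionRing E κ] [CommRing Z] [Algebra κ Z] [Algebra E Z] [IsScalarTower E κ Z]
  {ι : Type*} [Fintype ι] {ϖ : E} {ε : ι → Z} {w : Z} {r : ℕ} {c : ι → Eˣ}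

/-- If the algebra `Z` over the fraction field of `E` is a product of copies of totally ramified
extensions of degree `r`, obtained by adjoining roots of uniformisers, then the integral closure of
`E` in `Z` has ramification index `r` at each maximal ideal. -/
theorem ramificationIdx_integralClosure_eq (hϖ : Irreducible ϖ) (hr : r ≠ 0)
    (hε : CompleteOrthogonalIdempotents ε) (hε0 : ∀ i, ε i ≠ 0)
    (hwr : ∀ i, ε i * w ^ r = algebraMap E Z (c i * ϖ) * ε i)
    (hspan : ∀ i x, ε i * x ∈ Submodule.span κ (Set.range fun j : ℕ => ε i * w ^ j))
    (P : Ideal (integralClosure E Z)) (hP : P.IsMaximal) : P.ramificationIdx E = r := by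
  have hwr' : w ^ r = ∑ i, algebraMap E Z (c i * ϖ) * ε i := by
    rw [← one_mul (w ^ r), ← hε.complete, Finset.sum_mul]
    exact Finset.sum_congr rfl fun i _ => hwr i
  have hw : IsIntegral E w := by
    refine IsIntegral.of_pow (Nat.pos_of_ne_zero hr) ?_
    rw [hwr']
    exact IsIntegral.sum _ fun i _ => isIntegral_algebraMap.mul ((hε.idem i).isIntegral E)
  let O := integralClosure E Z
  let w' : O := ⟨w, hw⟩
  let ε' : ι → O := fun i => ⟨ε i, (hε.idem i).isIntegral E⟩
  have hwrO : ∀ i, ε' i * w' ^ r = algebraMap E O (c i * ϖ) * ε' i := fun i => Subtype.ext (hwr i)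
  have hsum : ∑ i, ε' i = 1 := Subtype.ext (by
    rw [AddSubmonoidClass.coe_finsetSum]; exact hε.complete)
  have hPu : P.under E = Ideal.span {ϖ} := by
    rw [← hϖ.maximalIdeal_eq]
    exact IsLocalRing.eq_maximalIdeal (Ideal.isMaximal_comap_of_isIntegral_of_isMaximal P)
  have hϖP : algebraMap E O ϖ ∈ P := by
    have : ϖ ∈ P.under E := hPu ▸ Ideal.mem_span_singleton_self ϖ
    exact this
  have hwP : w' ∈ P := by
    refine hP.isPrime.mem_of_pow_mem r ?_
    rw [← one_mul (w' ^ r), ← hsum, Finset.sum_mul]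
    refine Ideal.sum_mem _ fun i _ => ?_
    rw [hwrO, map_mul, mul_right_comm]
    exact Ideal.mul_mem_left _ _ hϖP
  -- The idempotents sum to `1`, so one avoids `P` and becomes a unit in the localisation. Only
  -- component `i` matters there: `w'` generates the maximal ideal, `ϖ` is a unit times `w' ^ r`,
  -- and the length of the fibre is `r`.
  obtain ⟨i, hi⟩ : ∃ i, ε' i ∉ P := by
    by_contra! hall
    exact hP.ne_top ((Ideal.eq_top_iff_one P).2 (hsum ▸ Ideal.sum_mem _ fun i _ => hall i))
  have hcO : IsUnit (algebraMap E O (c i)) := (c i).isUnit.map _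
  have hPw : ∀ x ∈ P, ∃ y, ε' i * x = w' * y := by
    intro x hx
    obtain ⟨d, y, hy, hdy⟩ := IsIntegral.exists_idempotent_mul_eq hϖ hr (hε.idem i) (hε0 i) hw
      (hwr i) (hspan i) x.2
    have hdy' : ε' i * x = algebraMap E O d * ε' i + w' * ⟨y, hy⟩ := Subtype.ext hdy
    have hd : algebraMap E O d * ε' i ∈ P := by
      rw [← sub_eq_iff_eq_add] at hdy'
      rw [← hdy']
      exact P.sub_mem (P.mul_mem_left _ hx) (P.mul_mem_right _ hwP)
    have hd' : d ∈ P.under E := (hP.isPrime.mem_or_mem hd).resolve_right hi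
    rw [hPu, Ideal.mem_span_singleton] at hd'
    obtain ⟨d', rfl⟩ := hd'
    obtain ⟨s, rfl⟩ : ∃ s, r = s + 1 := Nat.exists_eq_succ_of_ne_zero hr
    have hc : algebraMap E O ↑(c i)⁻¹ * algebraMap E O (c i) = 1 := by
      rw [← map_mul, Units.inv_mul, map_one]
    have h3 := hwrO i
    refine ⟨algebraMap E O (d' * ↑(c i)⁻¹) * ε' i * w' ^ s + ⟨y, hy⟩, ?_⟩
    rw [hdy']
    rw [map_mul] at h3 ⊢
    rw [map_mul]
    linear_combination (-(algebraMap E O d' * algebraMap E O ↑(c i)⁻¹)) * h3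
      - algebraMap E O d' * algebraMap E O ϖ * ε' i * hc
  let A := Localization.AtPrime P
  have hεA : IsUnit (algebraMap O A (ε' i)) :=
    IsLocalization.map_units A (⟨ε' i, hi⟩ : P.primeCompl)
  have hmax : IsLocalRing.maximalIdeal A = Ideal.span {algebraMap O A w'} := by
    rw [← Localization.AtPrime.map_eq_maximalIdeal]
    apply le_antisymm
    · rw [Ideal.map_le_iff_le_comap]
      intro x hx
      obtain ⟨y, hy⟩ := hPw x hx
      rw [Ideal.mem_comap, ← Ideal.unit_mul_mem_iff_mem _ hεA, ← map_mul, hy, map_mul]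
      exact Ideal.mul_mem_right _ _ (Ideal.mem_span_singleton_self _)
    · rw [Ideal.span_singleton_le_iff_mem]
      exact Ideal.mem_map_of_mem _ hwP
  -- Needed for the length count: on each component a multiple of `w` is a unit times `ϖ`, and `ϖ`
  -- is invertible in `κ`, hence kills no nonzero element of `Z`.
  have hwreg : algebraMap O A w' ∈ nonZeroDivisors A := by
    refine IsLocalization.map_nonZeroDivisors_le P.primeCompl A ⟨w', ?_, rfl⟩
    rw [SetLike.mem_coe, mem_nonZeroDivisors_iff_right]
    intro z hz
    have hz : (z : Z) * w = 0 := congrArg Subtype.val hz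
    have hz0 : ∀ j, ε j * (z : Z) = 0 := by
      intro j
      have h1 : algebraMap E Z (c j * ϖ) * (ε j * z) = 0 := by
        obtain ⟨s, rfl⟩ : ∃ s, r = s + 1 := Nat.exists_eq_succ_of_ne_zero hr
        have h3 := hwr j
        linear_combination (-(z : Z)) * h3 + ε j * w ^ s * hz
      have h2 : algebraMap E κ (c j * ϖ) ≠ 0 :=
        (map_ne_zero_iff _ (IsFractionRing.injective E κ)).2
          (mul_ne_zero (c j).ne_zero hϖ.ne_zero)
      rw [IsScalarTower.algebraMap_apply E κ Z, ← Algebra.smul_def] at h1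
      exact (smul_eq_zero.1 h1).resolve_left h2
    apply Subtype.ext
    calc (z : Z) = ∑ j, ε j * (z : Z) := by rw [← Finset.sum_mul, hε.complete, one_mul]
      _ = 0 := Finset.sum_eq_zero fun j _ => hz0 j
  have hmap : (P.under E).map (algebraMap E A) = Ideal.span {algebraMap O A w' ^ r} := by
    rw [hPu, Ideal.map_span, Set.image_singleton]
    have h1 := congrArg (algebraMap O A) (hwrO i)
    rw [map_mul, map_mul, map_mul, map_pow, map_mul] at h1
    obtain ⟨u, hu⟩ := hεA
    obtain ⟨v, hv⟩ := hcO.map (algebraMap O A)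
    rw [← hu, ← hv, ← IsScalarTower.algebraMap_apply E O A] at h1
    have h2 := congrArg (fun t => (↑u⁻¹ : A) * t) h1
    simp only [Units.inv_mul_cancel_left] at h2
    rw [h2, mul_comm (_ * _) (u : A), Units.inv_mul_cancel_left,
      Ideal.span_singleton_mul_left_unit v.isUnit]
  rw [Ideal.ramificationIdx_def, hmap]
  exact congrArg ENat.toNat (Ring.ord_pow_of_maximalIdeal_eq_span hmax hwreg r)

end Cover
end

/-! ### Symbol relations and normally ordered monomials -/

noncomputable section

/-- Elements which commute up to a scalar. -/
theorem pow_mul_pow_of_mul_eq_smul {Λ B : Type*} [CommRing Λ] [Ring B] [Algebra Λ B] {x y : B}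
    {z : Λ} (h : x * y = z • (y * x)) (i j : ℕ) :
    x ^ i * y ^ j = z ^ (i * j) • (y ^ j * x ^ i) := by
  have h1 : ∀ i, x ^ i * y = z ^ i • (y * x ^ i) := by
    intro i
    induction i with
    | zero => simp
    | succ i ih =>
      rw [pow_succ, mul_assoc, h, mul_smul_comm, ← mul_assoc, ih, smul_mul_assoc, smul_smul,
        mul_assoc, ← pow_succ']
  induction j with
  | zero => simp
  | succ j ih =>
    rw [pow_succ, ← mul_assoc, ih, smul_mul_assoc, mul_assoc, h1, mul_smul_comm, smul_smul,
      ← mul_assoc, Nat.mul_succ, pow_add]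

/-- The relations between `s`, `t`, `τ` and `σ` in the order `A` over a base on which `u`, `v` and
the root of unity `z` live. -/
structure SymbolRelations {Λ B : Type*} [CommRing Λ] [Ring B] [Algebra Λ B] (e n : ℕ) (z u v : Λ)
    (s t τ σ : B) : Prop where
  s_t : t * s = s * t
  s_τ : τ * s = s * τ
  s_σ : σ * s = z ^ n • (s * σ)
  t_τ : τ * t = z • (t * τ)
  t_σ : σ * t = t * σ
  τ_σ : σ * τ = z ^ n • (τ * σ)
  s_pow : s ^ e = algebraMap Λ B u
  t_pow : t ^ (n * e) = algebraMap Λ B v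
  τ_pow : τ ^ (n * e) = 1
  σ_pow : σ ^ e = 1

/-- Normally ordered monomials. -/
def monomial4 {B : Type*} [Ring B] (s t τ σ : B) (p : Fin 4 → ℕ) : B :=
  s ^ p 0 * t ^ p 1 * τ ^ p 2 * σ ^ p 3

/-- The exponent of the root of unity which normal ordering produces. -/
def orderingExponent (n : ℕ) (p p' : Fin 4 → ℕ) : ℕ :=
  n * p 3 * (p' 0 + p' 2) + p 2 * p' 1

/-- Exponents of the normally ordered monomials which form a basis. -/
abbrev Exponents (e n : ℕ) : Type := ZMod e × ZMod (n * e) × ZMod (n * e) × ZMod e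

instance (e n : ℕ) [NeZero e] [NeZero n] : Finite (Exponents e n) := inferInstance

/-- The reduced representative of a class of exponents. -/
def Exponents.toNat {e n : ℕ} (x : Exponents e n) : Fin 4 → ℕ :=
  ![x.1.val, x.2.1.val, x.2.2.1.val, x.2.2.2.val]

/-- The class of exponents modulo `e`, `ne`, `ne` and `e`. -/
def Exponents.ofNat (e n : ℕ) (p : Fin 4 → ℕ) : Exponents e n := (p 0, p 1, p 2, p 3)

namespace SymbolRelations

variable {Λ B : Type*} [CommRing Λ] [Ring B] [Algebra Λ B] {e n : ℕ} {z u v : Λ} {s t τ σ : B}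

theorem baseChange (H : SymbolRelations e n z u v s t τ σ) (Λ' : Type*) [CommRing Λ']
    [Algebra Λ Λ'] : SymbolRelations e n (algebraMap Λ Λ' z) (algebraMap Λ Λ' u)
      (algebraMap Λ Λ' v) ((1 : Λ') ⊗ₜ[Λ] s) ((1 : Λ') ⊗ₜ[Λ] t) ((1 : Λ') ⊗ₜ[Λ] τ)
      ((1 : Λ') ⊗ₜ[Λ] σ) := by
  have key : ∀ (m : ℕ) (x y : B), (1 : Λ') ⊗ₜ[Λ] (z ^ m • (x * y)) =
      algebraMap Λ Λ' z ^ m • ((1 : Λ') ⊗ₜ[Λ] (x * y)) := by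
    intro m x y
    rw [TensorProduct.tmul_smul, ← map_pow, algebraMap_smul]
  have key' : ∀ w : Λ, (1 : Λ') ⊗ₜ[Λ] algebraMap Λ B w =
      algebraMap Λ' (Λ' ⊗[Λ] B) (algebraMap Λ Λ' w) := by
    intro w
    rw [Algebra.TensorProduct.algebraMap_apply, Algebra.algebraMap_eq_smul_one,
      TensorProduct.tmul_smul, TensorProduct.smul_tmul', ← Algebra.algebraMap_eq_smul_one]
    rfl
  have key1 := key 1
  simp only [pow_one] at key1
  constructor <;> simp only [Algebra.TensorProduct.tmul_mul_tmul, one_mul,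
    Algebra.TensorProduct.tmul_pow, one_pow, ← key, ← key1, ← key', H.s_t, H.s_τ, H.s_σ, H.t_τ,
    H.t_σ, H.τ_σ, H.s_pow, H.t_pow, H.τ_pow, H.σ_pow, Algebra.TensorProduct.one_def]

/-- Of the six pairs of generators only `σ, s`, then `σ, τ`, then `τ, t` fail to commute, so normal
ordering produces exactly three contributions to the exponent of `z`. -/
theorem monomial4_mul (H : SymbolRelations e n z u v s t τ σ) (p p' : Fin 4 → ℕ) :
    monomial4 s t τ σ p * monomial4 s t τ σ p' =
      z ^ orderingExponent n p p' • monomial4 s t τ σ (p + p') := by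
  have h1 : σ ^ p 3 * s ^ p' 0 = z ^ (n * (p 3 * p' 0)) • (s ^ p' 0 * σ ^ p 3) := by
    rw [pow_mul_pow_of_mul_eq_smul H.s_σ, ← pow_mul]
  have h2 : σ ^ p 3 * τ ^ p' 2 = z ^ (n * (p 3 * p' 2)) • (τ ^ p' 2 * σ ^ p 3) := by
    rw [pow_mul_pow_of_mul_eq_smul H.τ_σ, ← pow_mul]
  have h3 := pow_mul_pow_of_mul_eq_smul H.t_τ (p 2) (p' 1)
  have h4 : σ ^ p 3 * t ^ p' 1 = t ^ p' 1 * σ ^ p 3 :=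
    (Commute.pow_pow (show Commute σ t from H.t_σ) _ _).eq
  have h5 : τ ^ p 2 * s ^ p' 0 = s ^ p' 0 * τ ^ p 2 :=
    (Commute.pow_pow (show Commute τ s from H.s_τ) _ _).eq
  have h6 : t ^ p 1 * s ^ p' 0 = s ^ p' 0 * t ^ p 1 :=
    (Commute.pow_pow (show Commute t s from H.s_t) _ _).eq
  calc monomial4 s t τ σ p * monomial4 s t τ σ p'
      = s ^ p 0 * t ^ p 1 * τ ^ p 2 * (σ ^ p 3 * s ^ p' 0) * t ^ p' 1 * τ ^ p' 2 * σ ^ p' 3 := by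
        simp only [monomial4, mul_assoc]
    _ = z ^ (n * (p 3 * p' 0)) • (s ^ p 0 * t ^ p 1 * (τ ^ p 2 * s ^ p' 0) *
          (σ ^ p 3 * t ^ p' 1) * τ ^ p' 2 * σ ^ p' 3) := by
        rw [h1]; simp only [mul_smul_comm, smul_mul_assoc, mul_assoc]
    _ = z ^ (n * (p 3 * p' 0)) • (s ^ p 0 * (t ^ p 1 * s ^ p' 0) * (τ ^ p 2 * t ^ p' 1) *
          (σ ^ p 3 * τ ^ p' 2) * σ ^ p' 3) := by
        rw [h4, h5]; simp only [mul_assoc]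
    _ = z ^ orderingExponent n p p' • ((s ^ p 0 * s ^ p' 0) * (t ^ p 1 * t ^ p' 1) *
          (τ ^ p 2 * τ ^ p' 2) * (σ ^ p 3 * σ ^ p' 3)) := by
        rw [h2, h3, h6]
        simp only [mul_smul_comm, smul_mul_assoc, mul_assoc, smul_smul]
        congr 1
        rw [orderingExponent]; ring
    _ = _ := by simp only [monomial4, Pi.add_apply, pow_add]

/-- Compare both products with the same normally ordered monomial. As `z ^ (n * e) = 1`, the factor
`n * e - 1` stands for `-1`, which keeps the exponent a natural number. -/
theorem monomial4_commute (H : SymbolRelations e n z u v s t τ σ) (hz : z ^ (n * e) = 1)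
    (hN : n * e ≠ 0) (p p' : Fin 4 → ℕ) :
    monomial4 s t τ σ p' * monomial4 s t τ σ p =
      z ^ (orderingExponent n p' p + (n * e - 1) * orderingExponent n p p') •
        (monomial4 s t τ σ p * monomial4 s t τ σ p') := by
  rw [H.monomial4_mul, H.monomial4_mul, smul_smul, add_comm p, ← pow_add]
  obtain ⟨m, hm⟩ := Nat.exists_eq_succ_of_ne_zero hN
  have : orderingExponent n p' p + (n * e - 1) * orderingExponent n p p' + orderingExponent n p p' =
      orderingExponent n p' p + n * e * orderingExponent n p p' := by
    rw [hm, Nat.succ_sub_one]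
    simp only [Nat.succ_eq_add_one]
    ring
  rw [this, pow_add, pow_mul z (n * e), hz, one_pow, mul_one]

/-- Carrying: full blocks of `s` and `t` come out as powers of `u` and `v`, while those of `τ` and
`σ` disappear. This expresses a product of basis elements through the basis. -/
theorem monomial4_eq_smul (H : SymbolRelations e n z u v s t τ σ) [NeZero e] [NeZero n]
    (p : Fin 4 → ℕ) : monomial4 s t τ σ p =
      (u ^ (p 0 / e) * v ^ (p 1 / (n * e))) •
        monomial4 s t τ σ (Exponents.ofNat e n p).toNat := by
  have h0 : s ^ p 0 = algebraMap Λ B (u ^ (p 0 / e)) * s ^ (p 0 % e) := by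
    conv_lhs => rw [← Nat.div_add_mod (p 0) e, pow_add, pow_mul, H.s_pow, ← map_pow]
  have h1 : t ^ p 1 = algebraMap Λ B (v ^ (p 1 / (n * e))) * t ^ (p 1 % (n * e)) := by
    conv_lhs => rw [← Nat.div_add_mod (p 1) (n * e), pow_add, pow_mul, H.t_pow, ← map_pow]
  have h2 : τ ^ p 2 = τ ^ (p 2 % (n * e)) := pow_eq_pow_mod _ H.τ_pow
  have h3 : σ ^ p 3 = σ ^ (p 3 % e) := pow_eq_pow_mod _ H.σ_pow
  simp only [monomial4, Exponents.ofNat, Exponents.toNat]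
  rw [h0, h1, h2, h3]
  simp only [Matrix.cons_val, ZMod.val_natCast,
    ← Algebra.smul_def, smul_mul_assoc, mul_smul_comm, smul_smul]
  rw [mul_comm (v ^ _)]

end SymbolRelations

/-- The structure constants of the basis of normally ordered monomials. -/
def structureConstant {Λ : Type*} [CommRing Λ] {e n : ℕ} (z u v : Λ) (x y : Exponents e n) : Λ :=
  z ^ orderingExponent n x.toNat y.toNat *
    (u ^ ((x.1.val + y.1.val) / e) * v ^ ((x.2.1.val + y.2.1.val) / (n * e)))

section

variable {Λ B : Type*} [CommRing Λ] [Ring B] [Algebra Λ B] {e n : ℕ} [NeZero e] [NeZero n]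
  {z u v : Λ} {s t τ σ : B}

theorem Exponents.ofNat_toNat_add (x y : Exponents e n) :
    Exponents.ofNat e n (x.toNat + y.toNat) = x + y := by
  simp [Exponents.ofNat, Exponents.toNat, Prod.ext_iff]

theorem SymbolRelations.isTwistedBasis (H : SymbolRelations e n z u v s t τ σ)
    {b : Module.Basis (Exponents e n) Λ B} (hb : ∀ x, b x = monomial4 s t τ σ x.toNat) :
    IsTwistedBasis b (structureConstant z u v) where
  one := by rw [hb]; simp [monomial4, Exponents.toNat]
  mul x y := by
    rw [hb, hb, hb, H.monomial4_mul, H.monomial4_eq_smul, Exponents.ofNat_toNat_add, smul_smul]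
    rfl

/-- A vanishing `s`- or `t`-exponent causes no carry when `x` and `-x` are added, so `u` or `v` can
enter only where it is assumed to be a unit. -/
theorem isUnit_structureConstant_neg (hz : z ^ (n * e) = 1) {x : Exponents e n}
    (hu : x.1 = 0 ∨ IsUnit u) (hv : x.2.1 = 0 ∨ IsUnit v) :
    IsUnit (structureConstant z u v x (-x)) := by
  have hzu : IsUnit z := IsUnit.of_pow_eq_one hz (mul_ne_zero (NeZero.ne n) (NeZero.ne e))
  refine (hzu.pow _).mul (IsUnit.mul ?_ ?_)
  · rcases hu with h | h
    · simp [h]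
    · exact h.pow _
  · rcases hv with h | h
    · simp [h]
    · exact h.pow _

theorem structureConstant_neg_left (hz : z ^ (n * e) = 1) {x : Exponents e n}
    (hu : x.1 = 0 ∨ IsUnit u) (hv : x.2.1 = 0 ∨ IsUnit v) :
    IsUnit (structureConstant z u v (-x) x) := by
  have := isUnit_structureConstant_neg hz (x := -x) (u := u) (v := v) (by simpa using hu)
    (by simpa using hv)
  rwa [neg_neg] at this

end
end

noncomputable section

namespace SkewTerminal

/-! ### `k[[s,t]]` as a free module over `k[[u,v]]` -/

section PowerSeries

variable {k : Type*} [Field k] {e n : ℕ} [NeZero e] [NeZero n]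

/-- The exponent of the monomial `X₀ ^ i * X₁ ^ j`. -/
def expo (i j : ℕ) : Fin 2 →₀ ℕ := Finsupp.single 0 i + Finsupp.single 1 j

@[simp] theorem expo_zero (i j : ℕ) : expo i j 0 = i := by simp [expo]

@[simp] theorem expo_one (i j : ℕ) : expo i j 1 = j := by simp [expo]

theorem eq_expo (m : Fin 2 →₀ ℕ) : m = expo (m 0) (m 1) := by
  ext i; fin_cases i <;> simp

theorem X_pow_mul_X_pow (i j : ℕ) : (MvPowerSeries.X 0 : Base k) ^ i * MvPowerSeries.X 1 ^ j =
    MvPowerSeries.monomial (expo i j) 1 := by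
  rw [MvPowerSeries.X_pow_eq, MvPowerSeries.X_pow_eq, MvPowerSeries.monomial_mul_monomial, one_mul,
    expo]

theorem coeff_baseHom (f : Base k) (m : Fin 2 →₀ ℕ) :
    MvPowerSeries.coeff m (baseHom (e := e) (n := n) f) =
      if e ∣ m 0 ∧ n * e ∣ m 1 then MvPowerSeries.coeff (expo (m 0 / e) (m 1 / (n * e))) f
        else 0 := by
  classical
  have hs : MvPowerSeries.HasSubst ![(MvPowerSeries.X 0 : Base k) ^ e,
      MvPowerSeries.X 1 ^ (n * e)] :=
    MvPowerSeries.hasSubst_of_constantCoeff_zero (by intro i; fin_cases i <;> simp [NeZero.ne])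
  rw [baseHom, MvPowerSeries.substAlgHom_apply, MvPowerSeries.coeff_subst hs]
  have h : ∀ d : Fin 2 →₀ ℕ, MvPowerSeries.coeff m (d.prod fun i j =>
      (![(MvPowerSeries.X 0 : Base k) ^ e, MvPowerSeries.X 1 ^ (n * e)] i) ^ j) =
      if m = expo (e * d 0) (n * e * d 1) then 1 else 0 := by
    intro d
    rw [Finsupp.prod_fintype _ _ fun _ => pow_zero _, Fin.prod_univ_two]
    simp only [Matrix.cons_val, ← pow_mul]
    rw [X_pow_mul_X_pow, MvPowerSeries.coeff_monomial]
  simp only [h]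
  have he := NeZero.pos e
  have hN : 0 < n * e := Nat.mul_pos (NeZero.pos n) he
  split_ifs with hd
  · obtain ⟨⟨i, hi⟩, ⟨j, hj⟩⟩ := hd
    rw [finsum_eq_single _ (expo i j)]
    · rw [if_pos (by rw [eq_expo m, hi, hj]; simp), hi, hj, Nat.mul_div_cancel_left _ he,
        Nat.mul_div_cancel_left _ hN, smul_eq_mul, mul_one]
    · intro d hd
      rw [if_neg, smul_zero]
      rintro rfl
      refine hd ?_
      simp only [expo_zero, expo_one] at hi hj
      rw [eq_expo d, Nat.eq_of_mul_eq_mul_left he hi, Nat.eq_of_mul_eq_mul_left hN hj]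
  · refine (finsum_congr fun d => ?_).trans finsum_zero
    rw [if_neg, smul_zero]
    rintro rfl
    exact hd (by simp)

/-- Uniqueness of division with remainder: multiples of `s ^ a * t ^ b` by elements of `k[[u,v]]`
only involve exponents congruent to `a` modulo `e` and `b` modulo `ne`, so different monomials do
not interfere. -/
theorem coeff_baseHom_mul (f : Base k) (i j : ℕ) {a a' b b' : ℕ} (ha : a < e) (ha' : a' < e)
    (hb : b < n * e) (hb' : b' < n * e) :
    MvPowerSeries.coeff (expo (e * i + a) (n * e * j + b)) (baseHom (e := e) (n := n) f *
      (MvPowerSeries.X 0 ^ a' * MvPowerSeries.X 1 ^ b')) =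
      if a = a' ∧ b = b' then MvPowerSeries.coeff (expo i j) f else 0 := by
  have hmod : ∀ {N i a a' : ℕ}, a < N → a' < N → a' ≤ N * i + a → N ∣ N * i + a - a' → a = a' := by
    intro N i a a' ha ha' hle hd
    have h1 : a ≡ a' [MOD N] := by
      have := (Nat.modEq_iff_dvd' hle).2 hd
      exact (this.trans (by simp [Nat.ModEq])).symm
    rwa [Nat.ModEq, Nat.mod_eq_of_lt ha, Nat.mod_eq_of_lt ha'] at h1
  rw [X_pow_mul_X_pow, MvPowerSeries.coeff_mul_monomial, mul_one, coeff_baseHom]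
  have he := NeZero.pos e
  have hN : 0 < n * e := Nat.mul_pos (NeZero.pos n) he
  by_cases h : a = a' ∧ b = b'
  · obtain ⟨rfl, rfl⟩ := h
    rw [if_pos, if_pos, if_pos ⟨rfl, rfl⟩]
    · simp only [Finsupp.tsub_apply, expo_zero, expo_one, Nat.add_sub_cancel]
      rw [Nat.mul_div_cancel_left _ he, Nat.mul_div_cancel_left _ hN]
    · simp
    · intro l; fin_cases l <;> simp
  · rw [if_neg h]
    split_ifs with h1 h2
    · exfalso
      have h10 := h1 0
      have h11 := h1 1
      simp only [expo_zero, expo_one, Finsupp.tsub_apply] at h10 h11 h2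
      exact h ⟨hmod ha ha' h10 h2.1, hmod hb hb' h11 h2.2⟩
    · rfl
    · rfl

/-- The component of a power series at the monomial `s ^ a * t ^ b`. -/
def component (e n : ℕ) (f : Base k) (a b : ℕ) : Base k :=
  fun m => MvPowerSeries.coeff (expo (e * m 0 + a) (n * e * m 1 + b)) f

theorem sum_component (f : Base k) :
    ∑ a ∈ Finset.range e, ∑ b ∈ Finset.range (n * e),
      baseHom (e := e) (n := n) (component e n f a b) *
        (MvPowerSeries.X 0 ^ a * MvPowerSeries.X 1 ^ b) = f := by
  have he := NeZero.pos e
  have hN : 0 < n * e := Nat.mul_pos (NeZero.pos n) he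
  ext m
  rw [eq_expo m, ← Nat.div_add_mod (m 0) e, ← Nat.div_add_mod (m 1) (n * e)]
  have ha := Nat.mod_lt (m 0) he
  have hb := Nat.mod_lt (m 1) hN
  simp only [map_sum]
  rw [Finset.sum_eq_single (m 0 % e), Finset.sum_eq_single (m 1 % (n * e)),
    coeff_baseHom_mul _ _ _ ha ha hb hb, if_pos ⟨rfl, rfl⟩]
  · change MvPowerSeries.coeff (expo _ _) f = _
    simp
  · intro b hb' hne
    rw [coeff_baseHom_mul _ _ _ ha ha hb (Finset.mem_range.1 hb'), if_neg fun h => hne h.2.symm]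
  · intro h; exact absurd (Finset.mem_range.2 hb) h
  · intro a ha' hne
    refine Finset.sum_eq_zero fun b hb' => ?_
    rw [coeff_baseHom_mul _ _ _ ha (Finset.mem_range.1 ha') hb (Finset.mem_range.1 hb'),
      if_neg fun h => hne h.1.symm]
  · intro h; exact absurd (Finset.mem_range.2 ha) h

end PowerSeries

/-! ### Normal forms in `G'` -/

section Group

variable (e n : ℕ)

theorem sigma_pow : sigma e n ^ e = 1 :=
  PresentedGroup.one_of_mem (rels := rels e n) (x := FreeGroup.of 0 ^ e) (by simp [rels])

theorem tau_pow : tau e n ^ (n * e) = 1 :=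
  PresentedGroup.one_of_mem (rels := rels e n) (x := FreeGroup.of 1 ^ (n * e)) (by simp [rels])

theorem sigma_mul_tau : sigma e n * tau e n = rho e n * tau e n * sigma e n :=
  PresentedGroup.mk_eq_mk_of_mul_inv_mem (rels := rels e n)
    (x := FreeGroup.of 0 * FreeGroup.of 1) (y := FreeGroup.of 2 * FreeGroup.of 1 * FreeGroup.of 0)
    (by simp [rels])

theorem rho_mul_sigma : rho e n * sigma e n = sigma e n * rho e n :=
  PresentedGroup.mk_eq_mk_of_mul_inv_mem (rels := rels e n)
    (x := FreeGroup.of 2 * FreeGroup.of 0) (y := FreeGroup.of 0 * FreeGroup.of 2) (by simp [rels])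

theorem rho_mul_tau : rho e n * tau e n = tau e n * rho e n :=
  PresentedGroup.mk_eq_mk_of_mul_inv_mem (rels := rels e n)
    (x := FreeGroup.of 2 * FreeGroup.of 1) (y := FreeGroup.of 1 * FreeGroup.of 2) (by simp [rels])

theorem ExtGroup.induction {p : ExtGroup e n → Prop} (hσ : p (sigma e n)) (hτ : p (tau e n))
    (hρ : p (rho e n)) (h1 : p 1) (hmul : ∀ g h, p g → p h → p (g * h)) (hinv : ∀ g, p g → p g⁻¹)
    (g : ExtGroup e n) : p g := by
  have hg : g ∈ Subgroup.closure (Set.range (PresentedGroup.of (rels := rels e n))) :=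
    PresentedGroup.closure_range_of (rels e n) ▸ Subgroup.mem_top g
  induction hg using Subgroup.closure_induction with
  | mem g hg => obtain ⟨i, rfl⟩ := hg; fin_cases i; exacts [hσ, hτ, hρ]
  | one => exact h1
  | mul g h _ _ hg hh => exact hmul g h hg hh
  | inv g _ hg => exact hinv g hg

theorem rho_commute (g : ExtGroup e n) : Commute (rho e n) g := by
  induction g using ExtGroup.induction with
  | hσ => exact rho_mul_sigma e n
  | hτ => exact rho_mul_tau e n
  | hρ => exact Commute.refl _
  | h1 => exact Commute.one_right _
  | hmul g h hg hh => exact hg.mul_right hh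
  | hinv g hg => exact hg.inv_right

theorem sigma_pow_mul_tau_pow (i j : ℕ) : sigma e n ^ i * tau e n ^ j =
    rho e n ^ (i * j) * (tau e n ^ j * sigma e n ^ i) := by
  have h1 : ∀ i, sigma e n ^ i * tau e n = rho e n ^ i * (tau e n * sigma e n ^ i) := by
    intro i
    induction i with
    | zero => simp
    | succ i ih =>
      rw [pow_succ, mul_assoc, sigma_mul_tau, mul_assoc, ← mul_assoc,
        ← ((rho_commute e n (sigma e n ^ i)).eq), mul_assoc, ← mul_assoc (sigma e n ^ i), ih,
        pow_succ']
      simp only [mul_assoc]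
  induction j with
  | zero => simp
  | succ j ih =>
    rw [pow_succ, ← mul_assoc, ih, mul_assoc, mul_assoc, h1, ← mul_assoc (tau e n ^ j),
      ← (((rho_commute e n (tau e n ^ j)).pow_left i).eq), Nat.mul_succ, pow_add]
    simp only [mul_assoc]

theorem exists_normalForm [NeZero e] [NeZero n] (g : ExtGroup e n) :
    ∃ i c d : ℕ, g = rho e n ^ i * tau e n ^ c * sigma e n ^ d := by
  have hmul : ∀ g h : ExtGroup e n, (∃ i c d : ℕ, g = rho e n ^ i * tau e n ^ c * sigma e n ^ d) →
      (∃ i c d : ℕ, h = rho e n ^ i * tau e n ^ c * sigma e n ^ d) →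
      ∃ i c d : ℕ, g * h = rho e n ^ i * tau e n ^ c * sigma e n ^ d := by
    rintro _ _ ⟨i, c, d, rfl⟩ ⟨i', c', d', rfl⟩
    refine ⟨i + i' + d * c', c + c', d + d', ?_⟩
    calc rho e n ^ i * tau e n ^ c * sigma e n ^ d * (rho e n ^ i' * tau e n ^ c' * sigma e n ^ d')
        = rho e n ^ i * (rho e n ^ i' * (tau e n ^ c * sigma e n ^ d)) *
            tau e n ^ c' * sigma e n ^ d' := by
          rw [((rho_commute e n (tau e n ^ c * sigma e n ^ d)).pow_left i').eq]
          simp only [mul_assoc]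
      _ = rho e n ^ i * rho e n ^ i' * tau e n ^ c * (sigma e n ^ d * tau e n ^ c') *
            sigma e n ^ d' := by simp only [mul_assoc]
      _ = rho e n ^ i * rho e n ^ i' * (tau e n ^ c * rho e n ^ (d * c')) * tau e n ^ c' *
            (sigma e n ^ d * sigma e n ^ d') := by
          rw [sigma_pow_mul_tau_pow]; simp only [mul_assoc]
      _ = _ := by
          rw [← ((rho_commute e n (tau e n ^ c)).pow_left (d * c')).eq]
          simp only [pow_add, mul_assoc]
  induction g using ExtGroup.induction with
  | hσ => exact ⟨0, 0, 1, by simp⟩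
  | hτ => exact ⟨0, 1, 0, by simp⟩
  | hρ => exact ⟨1, 0, 0, by simp⟩
  | h1 => exact ⟨0, 0, 0, by simp⟩
  | hmul g h hg hh => exact hmul g h hg hh
  | hinv g hg =>
    obtain ⟨i, c, d, rfl⟩ := hg
    -- Generators have finite order, so their inverses are positive powers and normal forms with
    -- natural exponents suffice.
    have hinv : ∀ {x : ExtGroup e n} {m : ℕ}, m ≠ 0 → x ^ m = 1 →
        ∀ j, (x ^ j)⁻¹ = x ^ ((m - 1) * j) := by
      intro x m hm hx j
      rw [inv_eq_iff_mul_eq_one, ← pow_add]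
      obtain ⟨l, rfl⟩ : ∃ l, m = l + 1 := Nat.exists_eq_succ_of_ne_zero hm
      rw [Nat.add_sub_cancel, show j + l * j = (l + 1) * j by ring, pow_mul, hx, one_pow]
    rw [mul_inv_rev, mul_inv_rev, hinv (NeZero.ne e) (sigma_pow e n),
      hinv (mul_ne_zero (NeZero.ne n) (NeZero.ne e)) (tau_pow e n),
      hinv (NeZero.ne e) (rho_pow e n)]
    exact hmul _ _ ⟨0, 0, (e - 1) * d, by simp⟩
      (hmul _ _ ⟨0, (n * e - 1) * c, 0, by simp⟩ ⟨(e - 1) * i, 0, 0, by simp⟩)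

instance [NeZero e] [NeZero n] : Finite (ExtGroup e n) := by
  refine Finite.of_surjective (α := ZMod e × ZMod (n * e) × ZMod e)
    (fun x => rho e n ^ x.1.val * tau e n ^ x.2.1.val * sigma e n ^ x.2.2.val) fun g => ?_
  obtain ⟨i, c, d, rfl⟩ := exists_normalForm e n g
  refine ⟨(i, c, d), ?_⟩
  simp only [ZMod.val_natCast]
  rw [← pow_eq_pow_mod _ (rho_pow e n), ← pow_eq_pow_mod _ (tau_pow e n),
    ← pow_eq_pow_mod _ (sigma_pow e n)]

/-- The regular action of `G'`, written in terms of the exponents of `ρ`, `τ` and `σ`. -/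
def regularAction : ExtGroup e n →* Equiv.Perm (ZMod e × ZMod (n * e) × ZMod e) :=
  PresentedGroup.toGroup (f := ![
    -- The triple `(i, c, d)` stands for `ρ^i σ^d τ^c`, with `σ` before `τ`. Left multiplication by
    -- `τ` must then pass `σ^d`, which costs `ρ^{-d}`; that is the shift `x.1 - x.2.2` in the second
    -- permutation.
    ⟨fun x => (x.1, x.2.1, x.2.2 + 1), fun x => (x.1, x.2.1, x.2.2 - 1),
      fun x => by simp, fun x => by simp⟩,
    ⟨fun x => (x.1 - x.2.2, x.2.1 + 1, x.2.2), fun x => (x.1 + x.2.2, x.2.1 - 1, x.2.2),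
      fun x => by simp, fun x => by simp⟩,
    ⟨fun x => (x.1 + 1, x.2.1, x.2.2), fun x => (x.1 - 1, x.2.1, x.2.2),
      fun x => by simp, fun x => by simp⟩]) (by
    set σ : Equiv.Perm (ZMod e × ZMod (n * e) × ZMod e) :=
      ⟨fun x => (x.1, x.2.1, x.2.2 + 1), fun x => (x.1, x.2.1, x.2.2 - 1), _, _⟩
    set τ : Equiv.Perm (ZMod e × ZMod (n * e) × ZMod e) :=
      ⟨fun x => (x.1 - x.2.2, x.2.1 + 1, x.2.2), fun x => (x.1 + x.2.2, x.2.1 - 1, x.2.2), _, _⟩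
    set ρ : Equiv.Perm (ZMod e × ZMod (n * e) × ZMod e) :=
      ⟨fun x => (x.1 + 1, x.2.1, x.2.2), fun x => (x.1 - 1, x.2.1, x.2.2), _, _⟩
    have hσ : ∀ (m : ℕ) x, (σ ^ m) x = (x.1, x.2.1, x.2.2 + m) := by
      intro m
      induction m with
      | zero => simp
      | succ m ih => intro x; rw [pow_succ', Equiv.Perm.mul_apply, ih]; simp [σ, add_assoc]
    have hτ : ∀ (m : ℕ) x, (τ ^ m) x = (x.1 - m * x.2.2, x.2.1 + m, x.2.2) := by
      intro m
      induction m with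
      | zero => simp
      | succ m ih =>
        intro x; rw [pow_succ', Equiv.Perm.mul_apply, ih]
        simp only [τ, Equiv.coe_fn_mk, Nat.cast_add, Nat.cast_one, Prod.mk.injEq]
        refine ⟨by ring, by ring, trivial⟩
    have hρ : ∀ (m : ℕ) x, (ρ ^ m) x = (x.1 + m, x.2.1, x.2.2) := by
      intro m
      induction m with
      | zero => simp
      | succ m ih => intro x; rw [pow_succ', Equiv.Perm.mul_apply, ih]; simp [ρ, add_assoc]
    intro r hr
    simp only [rels, Set.mem_insert_iff, Set.mem_singleton_iff] at hr
    rcases hr with rfl | rfl | rfl | rfl | rfl | rfl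
    · simp only [map_pow, FreeGroup.lift_apply_of, Matrix.cons_val]
      ext1 x; rw [hσ]; simp
    · simp only [map_pow, FreeGroup.lift_apply_of, Matrix.cons_val]
      ext1 x; rw [hτ]
      have : ((n * e : ℕ) : ZMod e) = 0 := by simp
      rw [this]; simp
    · simp only [map_pow, FreeGroup.lift_apply_of, Matrix.cons_val]
      ext1 x; rw [hρ]; simp
    all_goals
      simp only [map_mul, map_inv, FreeGroup.lift_apply_of, Matrix.cons_val]
      rw [mul_inv_eq_one]
      ext1 x
      simp only [Equiv.Perm.mul_apply, σ, τ, ρ, Equiv.coe_fn_mk]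
    · ext <;> simp
      ring
    · ext <;> simp
      ring)

end Group
end SkewTerminal
end

noncomputable section

namespace SkewTerminal

/-! ### The order `A` as a free module over `k[[u,v]]` -/

/-- The image of the base point determines all three exponents modulo `e`, `ne`, `e`, so distinct
normal forms are distinct in `G'`: the presentation does not collapse. -/
theorem regularAction_apply (e n : ℕ) (i c d : ℕ) :
    regularAction e n ((rho e n) ^ i * tau e n ^ c * sigma e n ^ d) (0, 0, 0) =
      ((i : ZMod e) - c * d, (c : ZMod (n * e)), (d : ZMod e)) := by
  have hσ : ∀ (m : ℕ) x, regularAction e n (sigma e n ^ m) x = (x.1, x.2.1, x.2.2 + m) := by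
    intro m
    induction m with
    | zero => simp
    | succ m ih =>
      intro x; rw [pow_succ', map_mul, Equiv.Perm.mul_apply, ih]
      simp [regularAction, sigma, add_assoc]
  have hτ : ∀ (m : ℕ) x, regularAction e n (tau e n ^ m) x =
      (x.1 - m * x.2.2, x.2.1 + m, x.2.2) := by
    intro m
    induction m with
    | zero => simp
    | succ m ih =>
      intro x; rw [pow_succ', map_mul, Equiv.Perm.mul_apply, ih]
      simp only [regularAction, tau, PresentedGroup.toGroup.of, Matrix.cons_val, Equiv.coe_fn_mk,
        Nat.cast_add, Nat.cast_one, Prod.mk.injEq]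
      refine ⟨by ring, by ring, trivial⟩
  have hρ : ∀ (m : ℕ) x, regularAction e n (rho e n ^ m) x = (x.1 + m, x.2.1, x.2.2) := by
    intro m
    induction m with
    | zero => simp
    | succ m ih =>
      intro x; rw [pow_succ', map_mul, Equiv.Perm.mul_apply, ih]
      simp [regularAction, rho, add_assoc]
  rw [map_mul, map_mul, Equiv.Perm.mul_apply, Equiv.Perm.mul_apply, hσ, hτ, hρ]
  simp only [zero_add, Prod.mk.injEq, and_true]
  ring

variable {k : Type*} [Field k] {e n : ℕ} [NeZero e] [NeZero n] {ζ : k}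
  (hζ : IsPrimitiveRoot ζ (n * e))

theorem smul_eq_scale (g : ExtGroup e n) (f : Cover hζ) : g • f = scale (weights hζ g) f := rfl

theorem rescale_X (a : Fin 2 → k) (i : Fin 2) :
    MvPowerSeries.rescale a (MvPowerSeries.X i) = a i • (MvPowerSeries.X i : Base k) := by
  classical
  ext d
  rw [MvPowerSeries.coeff_rescale, MvPowerSeries.coeff_smul, MvPowerSeries.coeff_X]
  split_ifs with h
  · rw [h, Finsupp.prod_single_index (h := fun i m => a i ^ m) (pow_zero _), pow_one]
  · simp

theorem smul_s (g : ExtGroup e n) : g • s hζ = (weights hζ g 0 : k) • s hζ := by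
  rw [smul_eq_scale]
  change MvPowerSeries.rescale _ (MvPowerSeries.X 0) = _
  rw [rescale_X]
  rfl

theorem smul_t (g : ExtGroup e n) : g • t hζ = (weights hζ g 1 : k) • t hζ := by
  rw [smul_eq_scale]
  change MvPowerSeries.rescale _ (MvPowerSeries.X 1) = _
  rw [rescale_X]
  rfl

theorem rho_smul (f : Cover hζ) : rho e n • f = f := by
  rw [smul_eq_scale, show weights hζ (rho e n) = 1 by simp [weights, rho]]
  exact scale_one (k := k) f

theorem commute_grp_rho (x : SkewGroupRing hζ) : Commute (grp hζ (rho e n)) x := by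
  induction x using SkewMonoidAlgebra.induction_on with
  | zero => exact Commute.zero_right _
  | single g f =>
    change SkewMonoidAlgebra.single _ _ * _ = _ * SkewMonoidAlgebra.single _ _
    rw [SkewMonoidAlgebra.single_mul_single, SkewMonoidAlgebra.single_mul_single, rho_smul,
      smul_one, one_mul, mul_one, (rho_commute e n g).eq]
  | add x y hx hy => exact hx.add_right hy

theorem grp_rho_inv : grp hζ (rho e n)⁻¹ = grp hζ (rho e n) ^ (e - 1) := by
  rw [← map_pow]
  congr 1
  rw [inv_eq_iff_mul_eq_one, ← pow_succ', Nat.sub_add_cancel (NeZero.pos e), rho_pow]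

theorem commute_eps (x : SkewGroupRing hζ) : Commute (eps hζ) x := by
  rw [eps_eq_geom_sum, grp_rho_inv]
  refine Commute.smul_left (Commute.sum_left _ _ _ fun i _ => ?_) _
  exact (((commute_grp_rho hζ x).pow_left _).smul_left _).pow_left _

omit [NeZero e] [NeZero n] in
theorem coeff_finset_sum {ι : Type*} (I : Finset ι) (F : ι → SkewGroupRing hζ)
    (g : ExtGroup e n) : (∑ i ∈ I, F i).coeff g = ∑ i ∈ I, (F i).coeff g := by
  classical
  induction I using Finset.induction_on with
  | empty => rfl
  | insert a I ha ih =>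
    rw [Finset.sum_insert ha, Finset.sum_insert ha, SkewMonoidAlgebra.coeff_add, Finsupp.add_apply,
      ih]

/-- The coefficients of an element of `k[[s,t]]`. -/
def coverCoeff (m : Fin 2 →₀ ℕ) : Cover hζ →ₗ[k] k :=
  (MvPowerSeries.coeff m : MvPowerSeries (Fin 2) k →ₗ[k] k)

theorem coverCoeff_smul_smul (f : Base k) (c : k) (i j : ℕ) {a a' b b' : ℕ} (ha : a < e)
    (ha' : a' < e) (hb : b < n * e) (hb' : b' < n * e) :
    coverCoeff hζ (expo (e * i + a) (n * e * j + b)) (f • c • (s hζ ^ a' * t hζ ^ b')) =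
      if a = a' ∧ b = b' then c * MvPowerSeries.coeff (expo i j) f else 0 := by
  rw [Algebra.smul_def, mul_smul_comm, map_smul, smul_eq_mul]
  refine (congrArg (c * ·) (coeff_baseHom_mul f i j ha ha' hb hb')).trans ?_
  split_ifs
  · rfl
  · exact mul_zero c

/-- The root of unity `ζ` in `k[[u,v]]`. -/
abbrev zeta (_ : IsPrimitiveRoot ζ (n * e)) : Base k := algebraMap k (Base k) ζ

theorem algebraMap_base_smul (c : k) (f : Cover hζ) :
    algebraMap k (Base k) c • f = c • f := by
  rw [Algebra.smul_def, Algebra.smul_def]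
  congr 1
  exact (baseHom (e := e) (n := n) : Base k →ₐ[k] _).commutes c

theorem algebraMap_base_smul_skew (c : k) (x : SkewGroupRing hζ) :
    algebraMap k (Base k) c • x = c • x := by
  ext1 g
  exact algebraMap_base_smul hζ c _

theorem baseHom_X_zero : baseHom (e := e) (n := n) (MvPowerSeries.X 0 : Base k) =
    MvPowerSeries.X 0 ^ e := by
  rw [baseHom, MvPowerSeries.substAlgHom_X]; rfl

theorem baseHom_X_one : baseHom (e := e) (n := n) (MvPowerSeries.X 1 : Base k) =
    MvPowerSeries.X 1 ^ (n * e) := by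
  rw [baseHom, MvPowerSeries.substAlgHom_X]; rfl

theorem s_pow_eq : s hζ ^ e = algebraMap (Base k) (Cover hζ) (MvPowerSeries.X 0) :=
  (baseHom_X_zero (e := e) (n := n)).symm

theorem t_pow_eq : t hζ ^ (n * e) = algebraMap (Base k) (Cover hζ) (MvPowerSeries.X 1) :=
  (baseHom_X_one (e := e) (n := n)).symm

variable [CharZero k]

theorem incl_injective : Function.Injective (incl hζ) := Subtype.val_injective

theorem incl_mul (a b : SkewOrder hζ) : incl hζ (a * b) = incl hζ a * incl hζ b := rfl

theorem incl_add (a b : SkewOrder hζ) : incl hζ (a + b) = incl hζ a + incl hζ b := rfl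

theorem incl_one : incl hζ (1 : SkewOrder hζ) = eps hζ := rfl

theorem eps_mul_incl (a : SkewOrder hζ) : eps hζ * incl hζ a = incl hζ a := by
  rw [← incl_one, ← incl_mul, one_mul]

theorem incl_smul (f : Base k) (a : SkewOrder hζ) : incl hζ (f • a) = f • incl hζ a := by
  rw [Algebra.smul_def, incl_mul, incl_algebraMap, smul_mul_assoc, eps_mul_incl]

/-- The projection of the skew group ring onto its direct factor. -/
def toOrder : SkewGroupRing hζ →ₐ[Base k] SkewOrder hζ where
  toFun x := ⟨eps hζ * x, x, by
    change eps hζ * x * eps hζ = eps hζ * x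
    rw [mul_assoc, ← (commute_eps hζ x).eq, ← mul_assoc, (eps_idem hζ).eq]⟩
  map_one' := Subtype.ext (mul_one _)
  map_mul' x y := Subtype.ext (by
    change eps hζ * (x * y) = (eps hζ * x) * (eps hζ * y)
    rw [mul_assoc, ← mul_assoc x, ← (commute_eps hζ x).eq, ← mul_assoc, ← mul_assoc, ← mul_assoc,
      (eps_idem hζ).eq])
  map_zero' := Subtype.ext (mul_zero _)
  map_add' x y := Subtype.ext (mul_add _ _ _)
  commutes' f := Subtype.ext (by
    change eps hζ * algebraMap _ _ f = f • eps hζ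
    rw [← Algebra.commutes, Algebra.smul_def])

theorem incl_toOrder (x : SkewGroupRing hζ) : incl hζ (toOrder hζ x) = eps hζ * x := rfl

theorem toOrder_incl (a : SkewOrder hζ) : toOrder hζ (incl hζ a) = a :=
  incl_injective hζ (by rw [incl_toOrder, eps_mul_incl])

theorem toOrder_surjective : Function.Surjective (toOrder hζ) :=
  fun a => ⟨_, toOrder_incl hζ a⟩

/-- The homomorphism `k[[s,t]] → A`. -/
def coverHom : Cover hζ →ₐ[Base k] SkewOrder hζ :=
  (toOrder hζ).comp
    { SkewMonoidAlgebra.singleOneRingHom with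
      commutes' := fun _ => rfl }

/-- The homomorphism `G' → A`. -/
def groupHom : ExtGroup e n →* SkewOrder hζ :=
  ((toOrder hζ : SkewGroupRing hζ →* SkewOrder hζ)).comp (grp hζ)

theorem coverHom_mul_groupHom (f : Cover hζ) (g : ExtGroup e n) :
    coverHom hζ f * groupHom hζ g = toOrder hζ (SkewMonoidAlgebra.single g f) := by
  change toOrder hζ (SkewMonoidAlgebra.single 1 f) * toOrder hζ (SkewMonoidAlgebra.single g 1) = _
  rw [← map_mul, SkewMonoidAlgebra.single_mul_single, one_mul, one_smul, mul_one]

theorem groupHom_mul_coverHom (g : ExtGroup e n) (f : Cover hζ) :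
    groupHom hζ g * coverHom hζ f = coverHom hζ (g • f) * groupHom hζ g := by
  rw [coverHom_mul_groupHom]
  change toOrder hζ (SkewMonoidAlgebra.single g 1) * toOrder hζ (SkewMonoidAlgebra.single 1 f) = _
  rw [← map_mul, SkewMonoidAlgebra.single_mul_single, mul_one, one_mul]

theorem closure_coverHom_groupHom :
    Subring.closure (Set.range (coverHom hζ) ∪ Set.range (groupHom hζ)) = ⊤ := by
  refine eq_top_iff.2 fun a _ => ?_
  obtain ⟨x, rfl⟩ := toOrder_surjective hζ a
  induction x using SkewMonoidAlgebra.induction_on with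
  | zero => rw [map_zero]; exact zero_mem _
  | single g f =>
    rw [← coverHom_mul_groupHom]
    exact mul_mem (Subring.subset_closure (Or.inl ⟨f, rfl⟩))
      (Subring.subset_closure (Or.inr ⟨g, rfl⟩))
  | add x y hx hy => rw [map_add]; exact add_mem (hx trivial) (hy trivial)

/-- In `A` the central `ρ` is a scalar, which leaves only `τ` and `σ` of the group and turns `στ =
ρτσ` into commutation up to `ζ^n`. -/
theorem groupHom_rho : groupHom hζ (rho e n) = algebraMap _ _ (zeta hζ ^ n) := by
  refine incl_injective hζ ?_
  change eps hζ * grp hζ (rho e n) = _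
  rw [(commute_eps hζ _).eq, rho_mul_eps, incl_algebraMap, ← map_pow, algebraMap_base_smul_skew]

theorem symbolRelations : SymbolRelations e n (zeta hζ) (MvPowerSeries.X 0) (MvPowerSeries.X 1)
    (coverHom hζ (s hζ)) (coverHom hζ (t hζ)) (groupHom hζ (tau e n))
    (groupHom hζ (sigma e n)) where
  s_t := by rw [← map_mul, ← map_mul, mul_comm]
  s_τ := by
    rw [groupHom_mul_coverHom, smul_s]
    simp [weights, tau]
  s_σ := by
    rw [groupHom_mul_coverHom, smul_s, ← smul_mul_assoc, ← map_smul, ← map_pow,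
      algebraMap_base_smul]
    simp [weights, sigma, zetaUnit]
  t_τ := by
    rw [groupHom_mul_coverHom, smul_t, ← smul_mul_assoc, ← map_smul, algebraMap_base_smul]
    simp [weights, tau, zetaUnit]
  t_σ := by
    rw [groupHom_mul_coverHom, smul_t]
    simp [weights, sigma]
  τ_σ := by
    rw [← map_mul, sigma_mul_tau, mul_assoc, map_mul, groupHom_rho, ← Algebra.smul_def, map_mul]
  s_pow := by rw [← map_pow, s_pow_eq, AlgHom.commutes]
  t_pow := by rw [← map_pow, t_pow_eq, AlgHom.commutes]
  τ_pow := by rw [← map_pow, tau_pow, map_one]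
  σ_pow := by rw [← map_pow, sigma_pow, map_one]

/-- The normally ordered monomials in `A`. -/
def orderMonomial (p : Fin 4 → ℕ) : SkewOrder hζ :=
  monomial4 (coverHom hζ (s hζ)) (coverHom hζ (t hζ)) (groupHom hζ (tau e n))
    (groupHom hζ (sigma e n)) p

theorem orderMonomial_eq (p : Fin 4 → ℕ) : orderMonomial hζ p =
    toOrder hζ (SkewMonoidAlgebra.single (tau e n ^ p 2 * sigma e n ^ p 3)
      (s hζ ^ p 0 * t hζ ^ p 1)) := by
  rw [← coverHom_mul_groupHom, orderMonomial, monomial4]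
  simp only [map_mul, map_pow, mul_assoc]

/-- Expanding `ε` spreads a monomial over a coset of `⟨ρ⟩`. By distinctness of normal forms only the
term `i = 0` can meet `τ^c σ^d`, and it carries the weight `1/e`. -/
theorem coeff_orderMonomial (p : Fin 4 → ℕ) (c d : ℕ) (hc : c < n * e) (hd : d < e)
    (hp2 : p 2 < n * e) (hp3 : p 3 < e) :
    (incl hζ (orderMonomial hζ p)).coeff (tau e n ^ c * sigma e n ^ d) =
      if c = p 2 ∧ d = p 3 then (e : k)⁻¹ • (s hζ ^ p 0 * t hζ ^ p 1) else 0 := by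
  classical
  have hmul : ∀ i, grp hζ ((rho e n)⁻¹ ^ i) * (SkewMonoidAlgebra.single
      (tau e n ^ p 2 * sigma e n ^ p 3) (s hζ ^ p 0 * t hζ ^ p 1) : SkewGroupRing hζ) =
      SkewMonoidAlgebra.single ((rho e n)⁻¹ ^ i * (tau e n ^ p 2 * sigma e n ^ p 3))
        (s hζ ^ p 0 * t hζ ^ p 1) := by
    intro i
    have htriv : ∀ f : Cover hζ, ((rho e n)⁻¹ ^ i) • f = f := by
      intro f
      induction i with
      | zero => simp
      | succ i ih => rw [pow_succ, mul_smul, inv_smul_eq_iff.2 (rho_smul hζ f).symm, ih]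
    change SkewMonoidAlgebra.single _ 1 * _ = _
    rw [SkewMonoidAlgebra.single_mul_single, htriv, one_mul]
  have hiff : ∀ i ∈ Finset.range e, (rho e n)⁻¹ ^ i * (tau e n ^ p 2 * sigma e n ^ p 3) =
      tau e n ^ c * sigma e n ^ d ↔ i = 0 ∧ c = p 2 ∧ d = p 3 := by
    intro i hi
    constructor
    · intro h
      rw [inv_pow, inv_mul_eq_iff_eq_mul] at h
      have h' := congrArg (fun g => regularAction e n g (0, 0, 0)) h
      have h0 := regularAction_apply e n 0 (p 2) (p 3)
      rw [pow_zero, one_mul] at h0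
      simp only [h0, ← mul_assoc, regularAction_apply, Prod.mk.injEq] at h'
      obtain ⟨h1, h2, h3⟩ := h'
      have hc' : c = p 2 := by
        have := congrArg ZMod.val h2
        rwa [ZMod.val_natCast_of_lt hp2, ZMod.val_natCast_of_lt hc, eq_comm] at this
      have hd' : d = p 3 := by
        have := congrArg ZMod.val h3
        rwa [ZMod.val_natCast_of_lt hp3, ZMod.val_natCast_of_lt hd, eq_comm] at this
      refine ⟨?_, hc', hd'⟩
      rw [hc', hd', sub_left_inj] at h1
      have := congrArg ZMod.val h1
      rw [ZMod.val_natCast_of_lt (Finset.mem_range.1 hi)] at this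
      simpa using this.symm
    · rintro ⟨rfl, rfl, rfl⟩; simp
  rw [orderMonomial_eq, incl_toOrder, eps, smul_mul_assoc, Finset.sum_mul]
  simp only [smul_mul_assoc, hmul]
  rw [SkewMonoidAlgebra.coeff_smul, Finsupp.smul_apply]
  rw [coeff_finset_sum, Finset.sum_eq_single 0]
  · rw [SkewMonoidAlgebra.smul_single, SkewMonoidAlgebra.coeff_single_apply]
    have h0 := hiff 0 (Finset.mem_range.2 (NeZero.pos e))
    simp only [true_and] at h0
    rw [if_congr h0 rfl rfl, mul_zero, pow_zero, one_smul]
    split_ifs <;> simp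
  · intro i hi hne
    rw [SkewMonoidAlgebra.smul_single, SkewMonoidAlgebra.coeff_single_apply, if_neg]
    exact fun h => hne ((hiff i hi).1 h).1
  · intro h; exact absurd (Finset.mem_range.2 (NeZero.pos e)) h

/-- Coefficients are taken twice: the group coefficient isolates the exponents of `τ` and `σ`, the
power series coefficient those of `s` and `t`. -/
theorem linearIndependent_orderMonomial :
    LinearIndependent (Base k) fun x : Exponents e n => orderMonomial hζ x.toNat := by
  rw [Fintype.linearIndependent_iff]
  intro f hf x
  have hincl : ∀ I : Finset (Exponents e n),
      incl hζ (∑ y ∈ I, f y • orderMonomial hζ y.toNat) =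
      ∑ y ∈ I, f y • incl hζ (orderMonomial hζ y.toNat) := by
    intro I
    induction I using Finset.induction_on with
    | empty => rfl
    | insert a I ha ih => rw [Finset.sum_insert ha, Finset.sum_insert ha, incl_add, ih, incl_smul]
  have h := congrArg (fun a => (incl hζ a).coeff
    (tau e n ^ x.2.2.1.val * sigma e n ^ x.2.2.2.val)) hf
  simp only [hincl, coeff_finset_sum, SkewMonoidAlgebra.coeff_smul, Finsupp.smul_apply] at h
  ext m
  have h' := congrArg (coverCoeff hζ (expo (e * m 0 + x.1.val) (n * e * m 1 + x.2.1.val))) h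
  have hterm : ∀ y : Exponents e n,
      coverCoeff hζ (expo (e * m 0 + x.1.val) (n * e * m 1 + x.2.1.val))
        (f y • (incl hζ (orderMonomial hζ y.toNat)).coeff
          (tau e n ^ x.2.2.1.val * sigma e n ^ x.2.2.2.val)) =
      if y = x then (e : k)⁻¹ * MvPowerSeries.coeff m (f x) else 0 := by
    intro y
    rw [coeff_orderMonomial _ _ _ _ (ZMod.val_lt _) (ZMod.val_lt _)
      (by simpa [Exponents.toNat] using ZMod.val_lt _)
      (by simpa [Exponents.toNat] using ZMod.val_lt _)]
    split_ifs with h1 h2 h2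
    · subst h2
      refine (coverCoeff_smul_smul hζ (f y) _ _ _ (ZMod.val_lt _) (ZMod.val_lt _)
        (ZMod.val_lt _) (ZMod.val_lt _)).trans ?_
      rw [if_pos ⟨rfl, rfl⟩, ← eq_expo]
    · refine (coverCoeff_smul_smul hζ (f y) _ _ _ (ZMod.val_lt _) (ZMod.val_lt _)
        (ZMod.val_lt _) (ZMod.val_lt _)).trans ?_
      rw [if_neg]
      intro h3
      refine h2 ?_
      simp only [Exponents.toNat, Matrix.cons_val] at h1
      exact Prod.ext (ZMod.val_injective _ h3.1.symm) (Prod.ext (ZMod.val_injective _ h3.2.symm)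
        (Prod.ext (ZMod.val_injective _ h1.1.symm) (ZMod.val_injective _ h1.2.symm)))
    · subst h2; exact absurd ⟨rfl, rfl⟩ h1
    · rw [smul_zero, map_zero]
  rw [map_sum, Finset.sum_congr rfl fun y _ => hterm y, Finset.sum_ite_eq' Finset.univ x,
    if_pos (Finset.mem_univ x)] at h'
  have h0 : (e : k)⁻¹ * MvPowerSeries.coeff m (f x) = 0 := h'.trans (map_zero _)
  exact (mul_eq_zero.1 h0).resolve_left (inv_ne_zero (Nat.cast_ne_zero.2 (NeZero.ne e)))

theorem span_orderMonomial :
    ⊤ ≤ Submodule.span (Base k) (Set.range fun x : Exponents e n => orderMonomial hζ x.toNat) := by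
  have hmon : ∀ p, orderMonomial hζ p ∈
      Submodule.span (Base k) (Set.range fun x : Exponents e n => orderMonomial hζ x.toNat) := by
    intro p
    rw [orderMonomial, (symbolRelations hζ).monomial4_eq_smul]
    exact Submodule.smul_mem _ _ (Submodule.subset_span ⟨_, rfl⟩)
  rintro a -
  obtain ⟨x, rfl⟩ := toOrder_surjective hζ a
  induction x using SkewMonoidAlgebra.induction_on with
  | zero => rw [map_zero]; exact zero_mem _
  | add x y hx hy => rw [map_add]; exact add_mem hx hy
  | single g f =>
    -- The power of `ρ` is absorbed as a scalar, and `f` is split into its components over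
    -- `k[[u,v]]`.
    obtain ⟨i, c, d, rfl⟩ := exists_normalForm e n g
    rw [← coverHom_mul_groupHom, mul_assoc, map_mul, map_pow, groupHom_rho, ← map_pow,
      ← Algebra.smul_def, mul_smul_comm]
    refine Submodule.smul_mem _ _ ?_
    have hf : f = ∑ a ∈ Finset.range e, ∑ b ∈ Finset.range (n * e),
        component e n f a b • (s hζ ^ a * t hζ ^ b) :=
      (sum_component (e := e) (n := n) f).symm
    rw [hf, map_sum, Finset.sum_mul]
    refine sum_mem fun a _ => ?_
    rw [map_sum, Finset.sum_mul]
    refine sum_mem fun b _ => ?_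
    rw [map_smul, smul_mul_assoc, coverHom_mul_groupHom]
    refine Submodule.smul_mem _ _ ?_
    have := hmon ![a, b, c, d]
    rw [orderMonomial_eq] at this
    exact this

/-- The normally ordered monomials form a basis of `A`. -/
def orderBasis : Module.Basis (Exponents e n) (Base k) (SkewOrder hζ) :=
  Module.Basis.mk (linearIndependent_orderMonomial hζ) (span_orderMonomial hζ)

theorem orderBasis_apply (x : Exponents e n) : orderBasis hζ x =
    monomial4 (coverHom hζ (s hζ)) (coverHom hζ (t hζ)) (groupHom hζ (tau e n))
      (groupHom hζ (sigma e n)) x.toNat := Module.Basis.mk_apply _ _ x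

instance : Module.Finite (Base k) (SkewOrder hζ) := Module.Finite.of_basis (orderBasis hζ)

instance : Module.Free (Base k) (SkewOrder hζ) := Module.Free.of_basis (orderBasis hζ)

/-! ### The kernel of `x ↦ ε x` -/

/-- The element `1 - ε` is the average of `1 - (ζ^n ρ^{-1})^i`, and each of these is a multiple of
`1 - ζ^n ρ^{-1} = ρ^{-1} (ρ - ζ^n)`. So the ideal of `ρ - ζ^n` contains `1 - ε`, and every `x` with
`ε x = 0` equals `(1 - ε) x`. -/
theorem toOrder_eq_zero_iff (x : SkewGroupRing hζ) : toOrder hζ x = 0 ↔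
    x ∈ TwoSidedIdeal.span
      {grp hζ (rho e n) - algebraMap k (SkewGroupRing hζ) (ζ ^ n)} := by
  set I := TwoSidedIdeal.span {grp hζ (rho e n) - algebraMap k (SkewGroupRing hζ) (ζ ^ n)}
  constructor
  · intro h
    have h0 : eps hζ * x = 0 := by rw [← incl_toOrder, h]; rfl
    have hy : ∀ i, 1 - (ζ ^ n • grp hζ (rho e n)⁻¹) ^ i ∈ I := by
      have h1 : 1 - ζ ^ n • grp hζ (rho e n)⁻¹ ∈ I := by
        have := I.mul_mem_left (grp hζ (rho e n)⁻¹) _ (TwoSidedIdeal.subset_span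
          (Set.mem_singleton (grp hζ (rho e n) - algebraMap k (SkewGroupRing hζ) (ζ ^ n))))
        rwa [mul_sub, ← map_mul, inv_mul_cancel, map_one, ← Algebra.commutes,
          ← Algebra.smul_def] at this
      intro i
      induction i with
      | zero => rw [pow_zero, sub_self]; exact I.zero_mem
      | succ i ih =>
        have := I.add_mem ih (I.mul_mem_left ((ζ ^ n • grp hζ (rho e n)⁻¹) ^ i) _ h1)
        rwa [mul_sub, mul_one, ← pow_succ, sub_add_sub_cancel] at this
    have he : (e : k) ≠ 0 := Nat.cast_ne_zero.2 (NeZero.ne e)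
    have heps : 1 - eps hζ = algebraMap k _ (e : k)⁻¹ *
        ∑ i ∈ Finset.range e, (1 - (ζ ^ n • grp hζ (rho e n)⁻¹) ^ i) := by
      rw [Finset.sum_sub_distrib, mul_sub, ← Algebra.smul_def, ← Algebra.smul_def,
        ← eps_eq_geom_sum, Finset.sum_const, Finset.card_range, ← Nat.cast_smul_eq_nsmul k,
        smul_smul, inv_mul_cancel₀ he, one_smul]
    have h1 : 1 - eps hζ ∈ I := heps ▸ I.mul_mem_left _ _ (sum_mem fun i _ => hy i)
    have := I.mul_mem_right _ x h1
    rwa [sub_mul, one_mul, h0, sub_zero] at this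
  · intro h
    have hle : I ≤ TwoSidedIdeal.ker (toOrder hζ) := by
      refine TwoSidedIdeal.span_le.2 ?_
      rintro _ rfl
      refine (TwoSidedIdeal.mem_ker _).2 (incl_injective hζ ?_)
      rw [incl_toOrder, mul_sub, (commute_eps hζ _).eq, rho_mul_eps, ← Algebra.commutes,
        ← Algebra.smul_def, sub_self]
      rfl
    exact (TwoSidedIdeal.mem_ker _).1 (hle h)

/-- The isomorphism of `k[[s,t]] * G' / (ρ - ζ^n)` with `A`. -/
theorem exists_quotient_equiv :
    ∃ f : (TwoSidedIdeal.span
          {grp hζ (rho e n) - algebraMap k (SkewGroupRing hζ) (ζ ^ n)}).ringCon.Quotient ≃+*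
        SkewOrder hζ,
      ∀ x : SkewGroupRing hζ, incl hζ (f (RingCon.toQuotient x)) = eps hζ * x := by
  have h : ∀ x y, (TwoSidedIdeal.span {grp hζ (rho e n) -
      algebraMap k (SkewGroupRing hζ) (ζ ^ n)}).ringCon x y ↔ toOrder hζ x = toOrder hζ y := by
    intro x y
    rw [TwoSidedIdeal.rel_iff, ← toOrder_eq_zero_iff, map_sub, sub_eq_zero]
  refine ⟨RingEquiv.ofBijective (RingCon.lift _ (toOrder hζ : SkewGroupRing hζ →+* SkewOrder hζ)
    fun x y hxy => (h x y).1 hxy) ⟨?_, ?_⟩, fun x => rfl⟩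
  · intro x y hxy
    obtain ⟨x, rfl⟩ := RingCon.mk'_surjective _ x
    obtain ⟨y, rfl⟩ := RingCon.mk'_surjective _ y
    exact (RingCon.eq _).2 ((h x y).2 hxy)
  · intro a
    obtain ⟨x, rfl⟩ := toOrder_surjective hζ a
    exact ⟨RingCon.toQuotient x, rfl⟩

end SkewTerminal
end

noncomputable section

/-! ### The radical -/

/-- Normality moves all factors `x` of `(y * x) ^ i` to the right, so that the `m`-th power lies in
the radical. A left inverse of `1 - (-y * x) ^ m`, multiplied by the geometric sum, is a left
inverse of `1 + y * x`. -/
theorem Ring.mem_jacobson_of_normal {B : Type*} [Ring B] {x : B} {m : ℕ}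
    (hx : ∀ y, ∃ y', x * y = y' * x) (hm : x ^ m ∈ Ring.jacobson B) : x ∈ Ring.jacobson B := by
  have hB : Ring.jacobson B = Ideal.jacobson ⊥ := (Ideal.jacobson_bot).symm
  rw [hB, Ideal.mem_jacobson_iff] at hm ⊢
  have hpow : ∀ y, ∀ i : ℕ, ∃ y', (y * x) ^ i = y' * x ^ i := by
    intro y i
    induction i with
    | zero => exact ⟨1, by simp⟩
    | succ i ih =>
      obtain ⟨y', hy'⟩ := ih
      obtain ⟨y'', hy''⟩ := hx y'
      refine ⟨y * y'', ?_⟩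
      rw [pow_succ', hy', mul_assoc, ← mul_assoc x, hy'', pow_succ']
      simp only [mul_assoc]
  intro y
  obtain ⟨y', hy'⟩ := hpow (-y) m
  obtain ⟨z, hz⟩ := hm (-y')
  simp only [Ideal.mem_bot] at hz ⊢
  have hz' : z * (1 - (-y * x) ^ m) = 1 := by
    rw [hy', mul_sub, mul_one, ← sub_eq_zero, ← hz]; noncomm_ring
  refine ⟨z * ∑ i ∈ Finset.range m, (-y * x) ^ i, ?_⟩
  have h1 := geom_sum_mul_neg (-y * x) m
  rw [sub_eq_zero, ← hz', ← h1]
  noncomm_ring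

namespace IsTwistedBasis

variable {X Λ B : Type*} [CommRing Λ] [Ring B] [Algebra Λ B]
  {b : Module.Basis X Λ B} {c : X → X → Λ} {X₀ : Set X} {π : B} {m : ℕ}

theorem mem_jacobson_of_notMem (hl : ∀ y, ∃ y', π * y = y' * π) (hm : π ^ m ∈ Ring.jacobson B)
    (hX : ∀ x ∉ X₀, ∃ y, b x = π * y) : ∀ x ∉ X₀, b x ∈ Ring.jacobson B := by
  intro x hx
  obtain ⟨y, hy⟩ := hX x hx
  obtain ⟨y', hy'⟩ := hl y
  rw [hy, hy']
  exact Ideal.mul_mem_left _ _ (Ring.mem_jacobson_of_normal hl hm)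

variable [AddCommGroup X] [Finite X] [IsLocalRing Λ] [CharZero (IsLocalRing.ResidueField Λ)]
  [Module.Finite Λ B]

/-- Each term of a radical element is a multiple of `π`: on `X₀` because its coefficient lies in the
maximal ideal, off `X₀` because the basis element does. Normality of `π` exchanges left and right
multiples. -/
theorem hasPrincipalRadical (h : IsTwistedBasis b c) (hunit : ∀ x ∈ X₀, IsUnit (c x (-x)))
    (hl : ∀ y, ∃ y', π * y = y' * π)
    (hm : π ^ m ∈ Ring.jacobson B) (hX : ∀ x ∉ X₀, ∃ y, b x = π * y)
    (hmax : ∀ r ∈ IsLocalRing.maximalIdeal Λ, ∃ y, algebraMap Λ B r = π * y) :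
    HasPrincipalRadical B := by
  cases nonempty_fintype X
  have hπ := Ring.mem_jacobson_of_normal hl hm
  have key : ∀ z ∈ Ring.jacobson B, ∃ y, z = π * y := by
    intro z hz
    have hz' := (h.mem_jacobson_iff (mem_jacobson_of_notMem hl hm hX) hunit z).1 hz
    have : ∀ x, ∃ y, b.repr z x • b x = π * y := by
      intro x
      by_cases hx : x ∈ X₀
      · obtain ⟨y, hy⟩ := hmax _ (hz' x hx)
        exact ⟨y * b x, by rw [Algebra.smul_def, hy, mul_assoc]⟩
      · obtain ⟨y, hy⟩ := hX x hx
        exact ⟨b.repr z x • y, by rw [hy, mul_smul_comm]⟩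
    choose y hy using this
    refine ⟨∑ x, y x, ?_⟩
    rw [Finset.mul_sum, ← Finset.sum_congr rfl fun x _ => hy x, b.sum_repr]
  refine ⟨π, ?_, ?_⟩ <;> ext z <;> constructor
  · intro hz
    obtain ⟨y, rfl⟩ := key z hz
    exact hl y
  · rintro ⟨y, rfl⟩
    exact Ideal.mul_mem_left _ _ hπ
  · exact key z
  · rintro ⟨y, rfl⟩
    obtain ⟨y', hy'⟩ := hl y
    rw [hy']
    exact Ideal.mul_mem_left _ _ hπ

end IsTwistedBasis

/-! ### Characters -/

/-- The exponent of the root of unity which arises when two monomials are exchanged. -/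
def commutatorExponent (e n : ℕ) (p p' : Fin 4 → ℕ) : ZMod (n * e) :=
  orderingExponent n p p' - orderingExponent n p' p

/-- The scalar through which one monomial acts on another by conjugation. -/
def monomialCharacter {Λ : Type*} [CommRing Λ] (e n : ℕ) (z : Λ) (p p' : Fin 4 → ℕ) : Λ :=
  z ^ (orderingExponent n p p' + (n * e - 1) * orderingExponent n p' p)

section

variable {Λ B : Type*} [CommRing Λ] [Ring B] [Algebra Λ B] {e n : ℕ} [NeZero e] [NeZero n]
  {z u v : Λ} {s t τ σ : B}

theorem cast_monomialCharacter_exponent (p p' : Fin 4 → ℕ) :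
    ((orderingExponent n p p' + (n * e - 1) * orderingExponent n p' p : ℕ) : ZMod (n * e)) =
      commutatorExponent e n p p' := by
  have hN : 1 ≤ n * e := Nat.mul_pos (NeZero.pos n) (NeZero.pos e)
  rw [Nat.cast_add, Nat.cast_mul, Nat.cast_sub hN, ZMod.natCast_self, commutatorExponent]
  simp [sub_eq_add_neg]

theorem IsPrimitiveRoot.pow_eq_pow_iff_cast (hz : IsPrimitiveRoot z (n * e)) (i j : ℕ) :
    z ^ i = z ^ j ↔ (i : ZMod (n * e)) = j := by
  have hN : 0 < n * e := Nat.mul_pos (NeZero.pos n) (NeZero.pos e)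
  rw [ZMod.natCast_eq_natCast_iff, pow_eq_pow_mod i hz.pow_eq_one, pow_eq_pow_mod j hz.pow_eq_one]
  exact ⟨hz.pow_inj (Nat.mod_lt _ hN) (Nat.mod_lt _ hN), fun h => congrArg (z ^ ·) h⟩

theorem monomialCharacter_eq_iff (hz : IsPrimitiveRoot z (n * e)) (p p' q q' : Fin 4 → ℕ) :
    monomialCharacter e n z p p' = monomialCharacter e n z q q' ↔
      commutatorExponent e n p p' = commutatorExponent e n q q' := by
  rw [monomialCharacter, monomialCharacter, hz.pow_eq_pow_iff_cast,
    cast_monomialCharacter_exponent, cast_monomialCharacter_exponent]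

theorem monomialCharacter_eq_one_iff (hz : IsPrimitiveRoot z (n * e)) (p p' : Fin 4 → ℕ) :
    monomialCharacter e n z p p' = 1 ↔ commutatorExponent e n p p' = 0 := by
  rw [monomialCharacter, ← pow_zero z, hz.pow_eq_pow_iff_cast, cast_monomialCharacter_exponent,
    Nat.cast_zero]

theorem SymbolRelations.mul_eq_smul (H : SymbolRelations e n z u v s t τ σ)
    (hz : IsPrimitiveRoot z (n * e)) (p p' : Fin 4 → ℕ) :
    monomial4 s t τ σ p * monomial4 s t τ σ p' =
      monomialCharacter e n z p p' • (monomial4 s t τ σ p' * monomial4 s t τ σ p) :=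
  H.monomial4_commute hz.pow_eq_one (mul_ne_zero (NeZero.ne n) (NeZero.ne e)) p' p

theorem SymbolRelations.mul_comm_of (H : SymbolRelations e n z u v s t τ σ)
    (hz : IsPrimitiveRoot z (n * e)) {p p' : Fin 4 → ℕ} (h : commutatorExponent e n p p' = 0) :
    monomial4 s t τ σ p * monomial4 s t τ σ p' = monomial4 s t τ σ p' * monomial4 s t τ σ p := by
  rw [H.mul_eq_smul hz, (monomialCharacter_eq_one_iff hz _ _).2 h, one_smul]

/-- The exponents of `s`, `t`, `τ` and `σ`. -/
def generatorExponent (i : Fin 4) : Fin 4 → ℕ := Pi.single i 1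

omit [NeZero n] in
theorem commutatorExponent_generator_zero (x : Exponents e n) :
    commutatorExponent e n (generatorExponent 0) x.toNat = -(n * x.2.2.2.val : ℕ) := by
  simp [commutatorExponent, orderingExponent, generatorExponent, Exponents.toNat]

theorem commutatorExponent_generator_one (x : Exponents e n) :
    commutatorExponent e n (generatorExponent 1) x.toNat = -x.2.2.1 := by
  simp [commutatorExponent, orderingExponent, generatorExponent, Exponents.toNat]

theorem commutatorExponent_generator_two (x : Exponents e n) :
    commutatorExponent e n (generatorExponent 2) x.toNat = x.2.1 - (n * x.2.2.2.val : ℕ) := by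
  simp [commutatorExponent, orderingExponent, generatorExponent, Exponents.toNat]

theorem commutatorExponent_generator_three (x : Exponents e n) :
    commutatorExponent e n (generatorExponent 3) x.toNat = (n * (x.1.val + x.2.2.1.val) : ℕ) := by
  simp [commutatorExponent, orderingExponent, generatorExponent, Exponents.toNat]

-- Multiplication by `n` embeds `ℤ/e` into `ℤ/ne`; through it, conditions on powers of `ζ^n` become
-- conditions modulo `e`.
omit [NeZero e] in
theorem cast_mul_eq_cast_mul_iff (i j : ℕ) :
    ((n * i : ℕ) : ZMod (n * e)) = (n * j : ℕ) ↔ (i : ZMod e) = j := by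
  rw [ZMod.natCast_eq_natCast_iff, ZMod.natCast_eq_natCast_iff]
  exact ⟨Nat.ModEq.mul_left_cancel' (NeZero.ne n), Nat.ModEq.mul_left' n⟩

omit [NeZero e] in
theorem cast_mul_eq_zero_iff (i : ℕ) : ((n * i : ℕ) : ZMod (n * e)) = 0 ↔ (i : ZMod e) = 0 := by
  have := cast_mul_eq_cast_mul_iff (e := e) (n := n) i 0
  simpa using this

/-- Nondegeneracy of the commutator pairing: `s` detects the exponent of `σ` and `t` that of `τ`;
once these are known, `τ` detects the exponent of `t` and `σ` that of `s`. -/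
theorem commutatorExponent_separates {x y : Exponents e n}
    (h : ∀ i, commutatorExponent e n (generatorExponent i) x.toNat =
      commutatorExponent e n (generatorExponent i) y.toNat) : x = y := by
  have h0 := h 0
  have h1 := h 1
  have h2 := h 2
  have h3 := h 3
  rw [commutatorExponent_generator_zero, commutatorExponent_generator_zero, neg_inj] at h0
  rw [commutatorExponent_generator_one, commutatorExponent_generator_one, neg_inj] at h1
  rw [commutatorExponent_generator_two, commutatorExponent_generator_two, h0, sub_left_inj] at h2
  rw [commutatorExponent_generator_three, commutatorExponent_generator_three, h1,
    cast_mul_eq_cast_mul_iff] at h3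
  rw [cast_mul_eq_cast_mul_iff] at h0
  simp only [Nat.cast_add, ZMod.natCast_val, ZMod.cast_id', id_eq, add_left_inj] at h0 h3
  exact Prod.ext h3 (Prod.ext h2 (Prod.ext h1 h0))

theorem monomial4_generatorExponent (i : Fin 4) :
    monomial4 s t τ σ (generatorExponent i) = ![s, t, τ, σ] i := by
  fin_cases i <;> simp [monomial4, generatorExponent]

/-- The monomials normalise the algebra. -/
theorem SymbolRelations.normal (H : SymbolRelations e n z u v s t τ σ)
    (hz : IsPrimitiveRoot z (n * e)) {b : Module.Basis (Exponents e n) Λ B}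
    (hb : ∀ x, b x = monomial4 s t τ σ x.toNat) (p : Fin 4 → ℕ) (y : B) :
    ∃ y', monomial4 s t τ σ p * y = y' * monomial4 s t τ σ p := by
  refine ⟨∑ x, (b.repr y x * monomialCharacter e n z p x.toNat) • b x, ?_⟩
  conv_lhs => rw [← b.sum_repr y]
  rw [Finset.mul_sum, Finset.sum_mul]
  refine Finset.sum_congr rfl fun x _ => ?_
  rw [mul_smul_comm, hb, H.mul_eq_smul hz, smul_smul, smul_mul_assoc]

end

/-! ### Idempotents attached to roots of unity -/

section

variable {κ Z : Type*} [Field κ] [CommRing Z] [Algebra κ Z] {n : ℕ} [NeZero n] {ξ : κ} {y : Z}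

/-- The projection onto the eigenspace of `y` for the eigenvalue `ξ ^ i`. -/
def rootIdempotent (n : ℕ) (ξ : κ) (y : Z) (i : Fin n) : Z :=
  (n : κ)⁻¹ • ∑ j ∈ Finset.range n, (ξ⁻¹ ^ (i : ℕ) • y) ^ j

/-- The `n`-th power of `ξ^{-i} y` is `1`, so multiplication by it fixes the geometric sum of its
powers. -/
theorem mul_rootIdempotent (hξ : IsPrimitiveRoot ξ n) (hy : y ^ n = 1) (i : Fin n) :
    y * rootIdempotent n ξ y i = ξ ^ (i : ℕ) • rootIdempotent n ξ y i := by
  have hξ0 : ξ ≠ 0 := hξ.ne_zero (NeZero.ne n)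
  have h := mul_geom_sum (ξ⁻¹ ^ (i : ℕ) • y) n
  rw [smul_pow, hy, ← pow_mul, mul_comm _ n, pow_mul, hξ.inv.pow_eq_one, one_pow, one_smul,
    sub_self, sub_mul, one_mul, sub_eq_zero, smul_mul_assoc] at h
  rw [rootIdempotent, mul_smul_comm, smul_comm]
  congr 1
  conv_rhs => rw [← h]
  rw [smul_smul, ← mul_pow, mul_inv_cancel₀ hξ0, one_pow, one_smul]

theorem pow_mul_rootIdempotent (hξ : IsPrimitiveRoot ξ n) (hy : y ^ n = 1) (i : Fin n) (j : ℕ) :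
    y ^ j * rootIdempotent n ξ y i = ξ ^ (i * j : ℕ) • rootIdempotent n ξ y i := by
  induction j with
  | zero => simp
  | succ j ih =>
    rw [pow_succ, mul_assoc, mul_rootIdempotent hξ hy, mul_smul_comm, ih, smul_smul, ← pow_add,
      Nat.mul_succ, add_comm]

/-- Orthogonality holds because `y` has the distinct eigenvalues `ξ^i` and `ξ^j` on the two factors.
In the sum over all `i`, the coefficient of `y^j` is a sum of powers of a nontrivial `n`-th root of
unity unless `j = 0`. -/
theorem completeOrthogonalIdempotents_rootIdempotent [CharZero κ] (hξ : IsPrimitiveRoot ξ n)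
    (hy : y ^ n = 1) : CompleteOrthogonalIdempotents (rootIdempotent n ξ y) where
  idem i := by
    have hn : (n : κ) ≠ 0 := Nat.cast_ne_zero.2 (NeZero.ne n)
    have hξ0 : ξ ≠ 0 := hξ.ne_zero (NeZero.ne n)
    rw [IsIdempotentElem]
    conv_lhs => rw [rootIdempotent, smul_mul_assoc, Finset.sum_mul, ← rootIdempotent]
    have : ∀ j ∈ Finset.range n, (ξ⁻¹ ^ (i : ℕ) • y) ^ j * rootIdempotent n ξ y i =
        rootIdempotent n ξ y i := by
      intro j _
      rw [smul_pow, smul_mul_assoc, pow_mul_rootIdempotent hξ hy, smul_smul, ← pow_mul, inv_pow,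
        inv_mul_cancel₀ (pow_ne_zero _ hξ0), one_smul]
    rw [Finset.sum_congr rfl this, Finset.sum_const, Finset.card_range, ← Nat.cast_smul_eq_nsmul κ,
      smul_smul, inv_mul_cancel₀ hn, one_smul]
  ortho i j hij := by
    have h1 : ξ ^ (i : ℕ) • (rootIdempotent n ξ y i * rootIdempotent n ξ y j) =
        ξ ^ (j : ℕ) • (rootIdempotent n ξ y i * rootIdempotent n ξ y j) := by
      rw [← smul_mul_assoc, ← mul_rootIdempotent hξ hy, ← mul_smul_comm, ← mul_rootIdempotent hξ hy]
      ring
    rw [← sub_eq_zero, ← sub_smul] at h1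
    have h2 : ξ ^ (i : ℕ) - ξ ^ (j : ℕ) ≠ 0 :=
      sub_ne_zero.2 fun h => hij (Fin.ext (hξ.pow_inj i.2 j.2 h))
    change rootIdempotent n ξ y i * rootIdempotent n ξ y j = 0
    rw [← one_smul κ (_ * _), ← inv_mul_cancel₀ h2, mul_smul, h1, smul_zero]
  complete := by
    have hn : (n : κ) ≠ 0 := Nat.cast_ne_zero.2 (NeZero.ne n)
    simp only [rootIdempotent]
    rw [← Finset.smul_sum, Finset.sum_comm, Finset.sum_eq_single 0]
    · simp [← Nat.cast_smul_eq_nsmul κ, smul_smul, hn]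
    · intro j hj hj0
      have hξj : ξ⁻¹ ^ j ≠ 1 := hξ.inv.pow_ne_one_of_pos_of_lt hj0 (Finset.mem_range.1 hj)
      have h := mul_neg_geom_sum (ξ⁻¹ ^ j) n
      rw [← pow_mul, mul_comm j, pow_mul, hξ.inv.pow_eq_one, one_pow, sub_self] at h
      have h0 := (mul_eq_zero.1 h).resolve_left (sub_ne_zero.2 hξj.symm)
      rw [← Fin.sum_univ_eq_sum_range] at h0
      have : ∀ i : Fin n, (ξ⁻¹ ^ (i : ℕ) • y) ^ j = (ξ⁻¹ ^ j) ^ (i : ℕ) • y ^ j := by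
        intro i
        rw [smul_pow, ← pow_mul, ← pow_mul, mul_comm j]
      rw [Finset.sum_congr rfl fun i _ => this i, ← Finset.sum_smul, h0, zero_smul]
    · intro h; exact absurd (Finset.mem_range.2 (NeZero.pos n)) h

end
end

/-! ### Radical and residue centre of the localised order -/

noncomputable section

section

variable {Λ B : Type*} [CommRing Λ] [IsLocalRing Λ] [CharZero (IsLocalRing.ResidueField Λ)]
  [Ring B] [Algebra Λ B] [Module.Finite Λ B] {e n : ℕ} [NeZero e] [NeZero n]
  {z u v : Λ} {s t τ σ : B} {b : Module.Basis (Exponents e n) Λ B}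

theorem SymbolRelations.isUnit_τ {Λ B : Type*} [CommRing Λ] [Ring B] [Algebra Λ B] {e n : ℕ}
    [NeZero e] [NeZero n] {z u v : Λ} {s t τ σ : B} (H : SymbolRelations e n z u v s t τ σ) :
    IsUnit τ :=
  IsUnit.of_pow_eq_one H.τ_pow (mul_ne_zero (NeZero.ne n) (NeZero.ne e))

theorem SymbolRelations.isUnit_σ {Λ B : Type*} [CommRing Λ] [Ring B] [Algebra Λ B] {e n : ℕ}
    [NeZero e] {z u v : Λ} {s t τ σ : B} (H : SymbolRelations e n z u v s t τ σ) : IsUnit σ :=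
  IsUnit.of_pow_eq_one H.σ_pow (NeZero.ne e)

theorem SymbolRelations.isUnit_s {Λ B : Type*} [CommRing Λ] [Ring B] [Algebra Λ B] {e n : ℕ}
    [NeZero e] {z u v : Λ} {s t τ σ : B} (H : SymbolRelations e n z u v s t τ σ) (hu : IsUnit u) :
    IsUnit s :=
  (isUnit_pow_iff (NeZero.ne e)).1 (H.s_pow ▸ hu.map (algebraMap Λ B))

theorem SymbolRelations.isUnit_t {Λ B : Type*} [CommRing Λ] [Ring B] [Algebra Λ B] {e n : ℕ}
    [NeZero e] [NeZero n] {z u v : Λ} {s t τ σ : B} (H : SymbolRelations e n z u v s t τ σ)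
    (hv : IsUnit v) : IsUnit t :=
  (isUnit_pow_iff (mul_ne_zero (NeZero.ne n) (NeZero.ne e))).1 (H.t_pow ▸ hv.map (algebraMap Λ B))

/-- The exponents of the central elements of the residue algebra at `u = 0`. -/
def centralExponentsLeft (e n : ℕ) : Set (Exponents e n) :=
  {x | x.1 = 0 ∧ x.2.2.1 = 0 ∧ x.2.1 = (n * x.2.2.2.val : ℕ)}

/-- The exponents of the central elements of the residue algebra at `v = 0`. -/
def centralExponentsRight (e n : ℕ) : Set (Exponents e n) :=
  {x | x.2.1 = 0 ∧ x.2.2.2 = 0 ∧ ((x.1.val + x.2.2.1.val : ℕ) : ZMod e) = 0}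

omit [NeZero e] [NeZero n] in
theorem natCard_centralExponentsLeft : Nat.card (centralExponentsLeft e n) = e := by
  rw [Nat.card_congr (β := ZMod e)]
  · exact Nat.card_zmod e
  · exact
      { toFun := fun x => x.1.2.2.2
        invFun := fun d => ⟨(0, (n * d.val : ℕ), 0, d), rfl, rfl, rfl⟩
        left_inv := fun ⟨⟨a, b, c, d⟩, ha, hc, hb⟩ => by
          simp only at ha hb hc
          subst ha hb hc
          rfl
        right_inv := fun _ => rfl }

theorem natCard_centralExponentsRight : Nat.card (centralExponentsRight e n) = n * e := by
  rw [Nat.card_congr (β := ZMod (n * e))]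
  · exact Nat.card_zmod (n * e)
  · exact
      { toFun := fun x => x.1.2.2.1
        invFun := fun c => ⟨(-(c.val : ZMod e), 0, c, 0), rfl, rfl, by simp⟩
        left_inv := fun ⟨⟨a, b, c, d⟩, hb, hd, ha⟩ => by
          simp only at ha hb hd
          subst hb hd
          rw [Nat.cast_add, ZMod.natCast_zmod_val, add_eq_zero_iff_eq_neg] at ha
          subst ha
          rfl
        right_inv := fun _ => rfl }

omit [NeZero e] [NeZero n] in
theorem natCast_val_natCast (p : ℕ) : (((p : ZMod (n * e)).val : ℕ) : ZMod e) = p := by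
  rw [ZMod.val_natCast, ZMod.natCast_eq_natCast_iff]
  exact (Nat.mod_modEq p (n * e)).of_mul_left n

variable (H : SymbolRelations e n z u v s t τ σ) (hz : IsPrimitiveRoot z (n * e))
  (hb : ∀ x, b x = monomial4 s t τ σ x.toNat)

include H hz hb

/-- Here `s` is normal and `s^e = u` lies in the radical, so `s` does too. Monomials with a positive
power of `s` are multiples of it, and the others are units since `v` is a unit. -/
theorem SymbolRelations.hasPrincipalRadical_left (hu : IsLocalRing.maximalIdeal Λ = Ideal.span {u})
    (hv : IsUnit v) :
    HasPrincipalRadical B ∧ ∀ x : Exponents e n, x.1 ≠ 0 → b x ∈ Ring.jacobson B := by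
  have hl : ∀ y, ∃ y', s * y = y' * s := by
    simpa [monomial4_generatorExponent] using H.normal hz hb (generatorExponent 0)
  have hm : s ^ e ∈ Ring.jacobson B := by
    rw [H.s_pow]
    exact algebraMap_mem_jacobson (hu ▸ Ideal.mem_span_singleton_self u)
  have hX : ∀ x ∉ {x : Exponents e n | x.1 = 0}, ∃ y, b x = s * y := by
    intro x hx
    have : x.1.val ≠ 0 := fun h => hx ((ZMod.val_eq_zero _).1 h)
    refine ⟨s ^ (x.1.val - 1) * t ^ x.2.1.val * τ ^ x.2.2.1.val * σ ^ x.2.2.2.val, ?_⟩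
    rw [hb]
    simp only [monomial4, Exponents.toNat, Matrix.cons_val, ← mul_assoc, mul_pow_sub_one this]
  refine ⟨(H.isTwistedBasis hb).hasPrincipalRadical (X₀ := {x : Exponents e n | x.1 = 0})
    (fun x hx => isUnit_structureConstant_neg hz.pow_eq_one (Or.inl hx) (Or.inr hv)) hl hm hX ?_,
    fun x hx => IsTwistedBasis.mem_jacobson_of_notMem hl hm hX x hx⟩
  intro r hr
  obtain ⟨r', rfl⟩ := Ideal.mem_span_singleton.1 (hu ▸ hr)
  exact ⟨s ^ (e - 1) * algebraMap Λ B r', by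
    rw [← mul_assoc, mul_pow_sub_one (NeZero.ne e), H.s_pow, map_mul]⟩

theorem SymbolRelations.hasPrincipalRadical_right
    (hv : IsLocalRing.maximalIdeal Λ = Ideal.span {v}) (hu : IsUnit u) :
    HasPrincipalRadical B ∧ ∀ x : Exponents e n, x.2.1 ≠ 0 → b x ∈ Ring.jacobson B := by
  have hN : n * e ≠ 0 := mul_ne_zero (NeZero.ne n) (NeZero.ne e)
  have hl : ∀ y, ∃ y', t * y = y' * t := by
    simpa [monomial4_generatorExponent] using H.normal hz hb (generatorExponent 1)
  have hm : t ^ (n * e) ∈ Ring.jacobson B := by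
    rw [H.t_pow]
    exact algebraMap_mem_jacobson (hv ▸ Ideal.mem_span_singleton_self v)
  have hX : ∀ x ∉ {x : Exponents e n | x.2.1 = 0}, ∃ y, b x = t * y := by
    intro x hx
    have : x.2.1.val ≠ 0 := fun h => hx ((ZMod.val_eq_zero _).1 h)
    refine ⟨s ^ x.1.val * t ^ (x.2.1.val - 1) * τ ^ x.2.2.1.val * σ ^ x.2.2.2.val, ?_⟩
    rw [hb]
    -- The generator `t` must stand in front, so it is moved past the power of `s`, with which it
    -- commutes.
    simp only [monomial4, Exponents.toNat, Matrix.cons_val, ← mul_assoc,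
      ((show Commute t s from H.s_t).pow_right _).eq]
    rw [mul_assoc (s ^ _) t, mul_pow_sub_one this]
  refine ⟨(H.isTwistedBasis hb).hasPrincipalRadical (X₀ := {x : Exponents e n | x.2.1 = 0})
    (fun x hx => isUnit_structureConstant_neg hz.pow_eq_one (Or.inr hu) (Or.inl hx)) hl hm hX ?_,
    fun x hx => IsTwistedBasis.mem_jacobson_of_notMem hl hm hX x hx⟩
  intro r hr
  obtain ⟨r', rfl⟩ := Ideal.mem_span_singleton.1 (hv ▸ hr)
  exact ⟨t ^ (n * e - 1) * algebraMap Λ B r', by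
    rw [← mul_assoc, mul_pow_sub_one hN, H.t_pow, map_mul]⟩

theorem SymbolRelations.hasPrincipalRadical_of_isUnit {p : Λ}
    (hp : IsLocalRing.maximalIdeal Λ = Ideal.span {p}) (hu : IsUnit u) (hv : IsUnit v) :
    HasPrincipalRadical B := by
  refine (H.isTwistedBasis hb).hasPrincipalRadical (X₀ := Set.univ) (π := algebraMap Λ B p)
    (m := 1) (fun x _ => isUnit_structureConstant_neg hz.pow_eq_one (Or.inr hu) (Or.inr hv))
    (fun y => ⟨y, Algebra.commutes _ _⟩) ?_ (fun x hx => (hx trivial).elim) ?_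
  · rw [pow_one]
    exact algebraMap_mem_jacobson (hp ▸ Ideal.mem_span_singleton_self p)
  · intro r hr
    obtain ⟨r', rfl⟩ := Ideal.mem_span_singleton.1 (hp ▸ hr)
    exact ⟨algebraMap Λ B r', map_mul _ _ _⟩

variable (hz1 : ∀ m, z ^ m = 1 ∨ IsUnit (z ^ m - 1))
include hz1

theorem SymbolRelations.exists_basis_residueCentre {I : Set (Fin 4)}
    {X₀ X₁ : Set (Exponents e n)} (hrad : ∀ x ∉ X₀, b x ∈ Ring.jacobson B)
    (hX₀ : ∀ x ∈ X₀, (x.1 = 0 ∨ IsUnit u) ∧ (x.2.1 = 0 ∨ IsUnit v))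
    (hI : ∀ i ∈ I, IsUnit (![s, t, τ, σ] i))
    (hX₁ : ∀ x, x ∈ X₁ ↔ x ∈ X₀ ∧
      ∀ i ∈ I, commutatorExponent e n (generatorExponent i) x.toNat = 0)
    (hcomm : ∀ x ∈ X₁, ∀ y ∈ X₀, commutatorExponent e n x.toNat y.toNat = 0) :
    ∃ β : Module.Basis X₁ (IsLocalRing.ResidueField Λ) (ResidueCentre B),
      ∀ x : X₁, ResidueCentre.val B (β x) = Ideal.Quotient.mk (Ring.jacobson B) (b x) := by
  refine (H.isTwistedBasis hb).exists_basis_residueCentre hrad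
    (fun x hx => isUnit_structureConstant_neg hz.pow_eq_one (hX₀ x hx).1 (hX₀ x hx).2)
    (g := fun i : I => ![s, t, τ, σ] i)
    (χ := fun i x => monomialCharacter e n z (generatorExponent i) x.toNat)
    (fun i => hI i i.2) (fun i x => ?_) (fun i x => hz1 _) (fun x => ?_) (fun x hx y hy => ?_)
  · rw [← monomial4_generatorExponent, hb, ← H.mul_eq_smul hz]
  · simp only [hX₁, monomialCharacter_eq_one_iff hz, Subtype.forall]
  · rw [hb, hb, H.mul_comm_of hz (hcomm x hx y hy)]

/-- As `s` lies in the radical, centrality is tested only against `t`, `τ` and `σ`: `t` forces the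
exponent of `τ` to vanish, and `τ` ties the exponent of `t` to `n` times that of `σ`. The condition
from `σ` is then automatic. -/
theorem SymbolRelations.exists_basis_residueCentre_left
    (hu : IsLocalRing.maximalIdeal Λ = Ideal.span {u}) (hv : IsUnit v) :
    ∃ β : Module.Basis (centralExponentsLeft e n) (IsLocalRing.ResidueField Λ) (ResidueCentre B),
      ∀ x, ResidueCentre.val B (β x) = Ideal.Quotient.mk (Ring.jacobson B) (b x) := by
  refine H.exists_basis_residueCentre hz hb hz1 (I := {i | i ≠ 0}) (X₀ := {x | x.1 = 0})
    (fun x hx => (H.hasPrincipalRadical_left hz hb hu hv).2 x hx)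
    (fun x hx => ⟨Or.inl hx, Or.inr hv⟩) ?_ ?_ ?_
  · intro i hi
    fin_cases i
    exacts [(hi rfl).elim, H.isUnit_t hv, H.isUnit_τ, H.isUnit_σ]
  · intro x
    constructor
    · rintro ⟨ha, hc, hd⟩
      refine ⟨ha, fun i hi => ?_⟩
      fin_cases i
      · exact (hi rfl).elim
      · exact (commutatorExponent_generator_one x).trans (by rw [hc, neg_zero])
      · exact (commutatorExponent_generator_two x).trans (by rw [hd, sub_self])
      · exact (commutatorExponent_generator_three x).trans (by rw [ha, hc]; simp)
    · rintro ⟨ha, h⟩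
      have h1 := h 1 (by simp)
      have h2 := h 2 (by simp)
      rw [commutatorExponent_generator_one, neg_eq_zero] at h1
      rw [commutatorExponent_generator_two, sub_eq_zero] at h2
      exact ⟨ha, h1, h2⟩
  · rintro x ⟨ha, hc, hd⟩ y hy
    simp only [Set.mem_ofPred_eq] at hy
    simp only [commutatorExponent, orderingExponent, Exponents.toNat, Matrix.cons_val, ha, hc, hy,
      ZMod.val_zero, Nat.cast_add, Nat.cast_mul, ZMod.natCast_zmod_val, hd]
    ring

/-- Now `t` is the generator in the radical. The test against `s` removes `σ`, and the test against
`σ` makes the exponents of `s` and `τ` opposite modulo `e`; `τ` adds nothing. -/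
theorem SymbolRelations.exists_basis_residueCentre_right
    (hv : IsLocalRing.maximalIdeal Λ = Ideal.span {v}) (hu : IsUnit u) :
    ∃ β : Module.Basis (centralExponentsRight e n) (IsLocalRing.ResidueField Λ) (ResidueCentre B),
      ∀ x, ResidueCentre.val B (β x) = Ideal.Quotient.mk (Ring.jacobson B) (b x) := by
  refine H.exists_basis_residueCentre hz hb hz1 (I := {i | i ≠ 1}) (X₀ := {x | x.2.1 = 0})
    (fun x hx => (H.hasPrincipalRadical_right hz hb hv hu).2 x hx)
    (fun x hx => ⟨Or.inr hu, Or.inl hx⟩) ?_ ?_ ?_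
  · intro i hi
    fin_cases i
    exacts [H.isUnit_s hu, (hi rfl).elim, H.isUnit_τ, H.isUnit_σ]
  · intro x
    constructor
    · rintro ⟨hb', hd, ha⟩
      refine ⟨hb', fun i hi => ?_⟩
      fin_cases i
      · exact (commutatorExponent_generator_zero x).trans (by rw [hd]; simp)
      · exact (hi rfl).elim
      · exact (commutatorExponent_generator_two x).trans (by rw [hb', hd]; simp)
      · exact (commutatorExponent_generator_three x).trans ((cast_mul_eq_zero_iff _).2 ha)
    · rintro ⟨hb', h⟩
      have h0 := h 0 (by simp)
      have h3 := h 3 (by simp)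
      rw [commutatorExponent_generator_zero, neg_eq_zero, cast_mul_eq_zero_iff,
        ZMod.natCast_zmod_val] at h0
      rw [commutatorExponent_generator_three, cast_mul_eq_zero_iff] at h3
      exact ⟨hb', h0, h3⟩
  · rintro x ⟨hb', hd, ha⟩ y hy
    simp only [Set.mem_ofPred_eq] at hy
    have h1 : ((n * (x.1.val + x.2.2.1.val) : ℕ) : ZMod (n * e)) = 0 :=
      (cast_mul_eq_zero_iff _).2 ha
    have h2 : ((n * y.2.2.2.val * (x.1.val + x.2.2.1.val) : ℕ) : ZMod (n * e)) = 0 := by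
      rw [mul_right_comm, Nat.cast_mul, h1, zero_mul]
    simp only [commutatorExponent, orderingExponent, Exponents.toNat, Matrix.cons_val, hb', hd, hy,
      ZMod.val_zero]
    rw [Nat.cast_add, Nat.cast_add, h2]
    simp

theorem SymbolRelations.exists_basis_residueCentre_of_isUnit (hu : IsUnit u) (hv : IsUnit v) :
    ∃ β : Module.Basis ({0} : Set (Exponents e n)) (IsLocalRing.ResidueField Λ) (ResidueCentre B),
      ∀ x, ResidueCentre.val B (β x) = Ideal.Quotient.mk (Ring.jacobson B) (b x) := by
  refine H.exists_basis_residueCentre hz hb hz1 (I := Set.univ) (X₀ := Set.univ)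
    (fun x hx => (hx trivial).elim) (fun x _ => ⟨Or.inr hu, Or.inr hv⟩) ?_ ?_ ?_
  · intro i _
    fin_cases i
    exacts [H.isUnit_s hu, H.isUnit_t hv, H.isUnit_τ, H.isUnit_σ]
  · intro x
    constructor
    · rintro rfl
      refine ⟨trivial, fun i _ => ?_⟩
      simp [commutatorExponent, orderingExponent, Exponents.toNat]
    · rintro ⟨-, h⟩
      refine commutatorExponent_separates fun i => (h i trivial).trans ?_
      simp [commutatorExponent, orderingExponent, Exponents.toNat]
  · rintro _ rfl y -
    simp [commutatorExponent, orderingExponent, Exponents.toNat]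

/-! ### The structure of the residual extensions -/

/-- The generator is the class of `t^n σ`: its factors commute, its `e`-th power is `t^{ne} = v`,
and its powers run through all central monomials. -/
theorem SymbolRelations.exists_generator_left
    (hu : IsLocalRing.maximalIdeal Λ = Ideal.span {u}) (hv : IsUnit v) :
    ∃ w : ResidueCentre B,
      w ^ e = algebraMap (IsLocalRing.ResidueField Λ) _ (IsLocalRing.residue Λ v) ∧
      ∀ x, x ∈ Submodule.span (IsLocalRing.ResidueField Λ) (Set.range fun j : ℕ => w ^ j) := by
  obtain ⟨β, hβ⟩ := H.exists_basis_residueCentre_left hz hb hz1 hu hv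
  obtain ⟨w, hw⟩ : ∃ w : ResidueCentre B, ResidueCentre.val B w =
      Ideal.Quotient.mk (Ring.jacobson B) (t ^ n * σ) := by
    have hp : Exponents.ofNat e n ![0, n, 0, 1] ∈ centralExponentsLeft e n := by
      refine ⟨by simp [Exponents.ofNat], by simp [Exponents.ofNat], ?_⟩
      have := (cast_mul_eq_cast_mul_iff (n := n) (e := e) 1 (1 : ZMod e).val).2 (by simp)
      simpa [Exponents.ofNat] using this
    -- The monomial need not be reduced: for `e = 1` the exponent `n` of `t` is a full block, and
    -- the scalar is then `v`; otherwise it is `1`.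
    refine ⟨IsLocalRing.residue Λ (u ^ (![0, n, 0, 1] 0 / e) * v ^ (![0, n, 0, 1] 1 / (n * e))) •
      β ⟨_, hp⟩, ?_⟩
    rw [ResidueCentre.val_residue_smul, hβ, hb, ← map_mul, ← Algebra.smul_def,
      ← H.monomial4_eq_smul]
    simp [monomial4]
  have hwj : ∀ j, ResidueCentre.val B (w ^ j) =
      Ideal.Quotient.mk (Ring.jacobson B) (t ^ (n * j) * σ ^ j) := by
    intro j
    rw [map_pow, hw, ← map_pow, ((show Commute σ t from H.t_σ).symm.pow_left n).mul_pow, pow_mul]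
  refine ⟨w, ?_, fun x => ?_⟩
  · apply ResidueCentre.val_injective
    rw [hwj, H.t_pow, H.σ_pow, mul_one]
    rfl
  · have hle : Set.range β ⊆ Set.range fun j : ℕ => w ^ j := by
      rintro _ ⟨⟨x, ha, hc, hd⟩, rfl⟩
      refine ⟨x.2.2.2.val, ResidueCentre.val_injective B ?_⟩
      have hlt : n * x.2.2.2.val < n * e :=
        Nat.mul_lt_mul_of_pos_left (ZMod.val_lt _) (NeZero.pos n)
      simp only [hβ, hwj, hb]
      simp [monomial4, Exponents.toNat, ha, hc, hd, ZMod.val_natCast_of_lt hlt, -Nat.cast_mul]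
    exact Submodule.span_mono hle (β.span_eq ▸ Submodule.mem_top)

/-- Here `w` is the class of `s τ^{-1}` and `y` that of `τ^e`; the exponent `n * e - 1` plays the
part of `-1` in both `τ^{-1}` and `y^{-1}`. -/
theorem SymbolRelations.exists_generator_right
    (hv : IsLocalRing.maximalIdeal Λ = Ideal.span {v}) (hu : IsUnit u) :
    ∃ w y : ResidueCentre B, y ^ n = 1 ∧
      w ^ e = algebraMap (IsLocalRing.ResidueField Λ) _ (IsLocalRing.residue Λ u) *
        y ^ (n * e - 1) ∧
      LinearIndependent (IsLocalRing.ResidueField Λ) (fun j : Fin n => y ^ (j : ℕ)) ∧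
      ∀ x, x ∈ Submodule.span (IsLocalRing.ResidueField Λ)
        (Set.range fun j : ℕ × ℕ => w ^ j.1 * y ^ j.2) := by
  have hN : 0 < n * e := Nat.mul_pos (NeZero.pos n) (NeZero.pos e)
  obtain ⟨β, hβ⟩ := H.exists_basis_residueCentre_right hz hb hz1 hv hu
  have hex : ∀ p : Fin 4 → ℕ, Exponents.ofNat e n p ∈ centralExponentsRight e n →
      ∃ w : ResidueCentre B, ResidueCentre.val B w =
        Ideal.Quotient.mk (Ring.jacobson B) (monomial4 s t τ σ p) := by
    intro p hp
    refine ⟨IsLocalRing.residue Λ (u ^ (p 0 / e) * v ^ (p 1 / (n * e))) • β ⟨_, hp⟩, ?_⟩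
    rw [ResidueCentre.val_residue_smul, hβ, hb, ← map_mul, ← Algebra.smul_def,
      ← H.monomial4_eq_smul]
  obtain ⟨w, hw⟩ := hex ![1, 0, n * e - 1, 0] ⟨by simp [Exponents.ofNat], by simp [Exponents.ofNat],
    by
      simp only [Exponents.ofNat, Matrix.cons_val, Nat.cast_add, ZMod.natCast_zmod_val,
        natCast_val_natCast]
      rw [← Nat.cast_add, add_comm, Nat.sub_add_cancel hN]
      simp⟩
  obtain ⟨y, hy⟩ := hex ![0, 0, e, 0] ⟨by simp [Exponents.ofNat], by simp [Exponents.ofNat], by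
    simp only [Exponents.ofNat, Matrix.cons_val, Nat.cast_add, natCast_val_natCast]
    simp⟩
  simp only [monomial4, Matrix.cons_val, pow_one, pow_zero, mul_one, one_mul] at hw hy
  have hyj : ∀ j, ResidueCentre.val B (y ^ j) =
      Ideal.Quotient.mk (Ring.jacobson B) (τ ^ (e * j)) := by
    intro j
    rw [map_pow, hy, ← map_pow, ← pow_mul]
  have hwj : ∀ j, ResidueCentre.val B (w ^ j) =
      Ideal.Quotient.mk (Ring.jacobson B) (s ^ j * τ ^ ((n * e - 1) * j)) := by
    intro j
    rw [map_pow, hw, ← map_pow, ((show Commute τ s from H.s_τ).symm.pow_right _).mul_pow, pow_mul]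
  refine ⟨w, y, ?_, ?_, ?_, fun x => ?_⟩
  · apply ResidueCentre.val_injective
    rw [hyj, mul_comm, H.τ_pow, map_one, map_one]
  · apply ResidueCentre.val_injective
    rw [hwj, map_mul, map_mul, hyj, H.s_pow, mul_comm e]
    rfl
  · have hlt : ∀ j : Fin n, e * (j : ℕ) < n * e := fun j => by
      rw [mul_comm]; exact Nat.mul_lt_mul_of_pos_right j.2 (NeZero.pos e)
    have hmem : ∀ j : Fin n, ((0, 0, ((e * j : ℕ) : ZMod (n * e)), 0) : Exponents e n) ∈
        centralExponentsRight e n := fun j =>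
      ⟨rfl, rfl, by simp⟩
    have hβy : ∀ j : Fin n, β ⟨_, hmem j⟩ = y ^ (j : ℕ) := by
      intro j
      apply ResidueCentre.val_injective
      rw [hβ, hyj, hb]
      simp only [monomial4, Exponents.toNat, Matrix.cons_val, ZMod.val_zero, pow_zero, one_mul,
        mul_one, ZMod.val_natCast_of_lt (hlt j)]
    simp only [← hβy]
    refine β.linearIndependent.comp _ fun i j hij => ?_
    simp only [Subtype.mk.injEq, Prod.mk.injEq, true_and, and_true] at hij
    have := congrArg ZMod.val hij
    rw [ZMod.val_natCast_of_lt (hlt i), ZMod.val_natCast_of_lt (hlt j)] at this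
    exact Fin.ext (Nat.eq_of_mul_eq_mul_left (NeZero.pos e) this)
  · have hle : Set.range β ⊆ Set.range fun j : ℕ × ℕ => w ^ j.1 * y ^ j.2 := by
      rintro _ ⟨⟨x, hb', hd, ha⟩, rfl⟩
      -- If the exponents `a` of `s` and `c` of `τ` satisfy `a + c = e j`, the monomial is `w^a
      -- y^j`, since `τ^{-a} τ^{ej} = τ^c`.
      obtain ⟨j, hj⟩ := (ZMod.natCast_eq_zero_iff _ _).1 ha
      refine ⟨(x.1.val, j), ResidueCentre.val_injective B ?_⟩
      have hτ : τ ^ ((n * e - 1) * x.1.val + e * j) = τ ^ x.2.2.1.val := by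
        rw [← hj, ← add_assoc, ← Nat.succ_mul, Nat.succ_eq_add_one, Nat.sub_add_cancel hN,
          pow_add, pow_mul, H.τ_pow, one_pow, one_mul]
      simp only [map_mul, hβ, hwj, hyj, hb]
      rw [mul_assoc, ← map_mul, ← pow_add, hτ]
      simp [monomial4, Exponents.toNat, hb', hd]
    exact Submodule.span_mono hle (β.span_eq ▸ Submodule.mem_top)

end
end

/-! ### Criteria for the ramification of the cover of a curve -/

noncomputable section

section

variable {D κ Z : Type*} [CommRing D] [IsDomain D] [IsDiscreteValuationRing D] [Field κ]
  [Algebra D κ] [IsFractionRing D κ] [CommRing Z] [Algebra κ Z]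

/-- A criterion for total ramification over a discrete valuation ring. -/
theorem OrderRamification.coverRamifiesWithIndex_of_orthogonalIdempotents {ι : Type*} [Fintype ι]
    {ϖ : D} {ε : ι → Z} {w : Z} {r : ℕ} {c : ι → Dˣ} (hϖ : Irreducible ϖ) (hr : r ≠ 0)
    (hε : CompleteOrthogonalIdempotents ε) (hε0 : ∀ i, ε i ≠ 0)
    (hwr : ∀ i, ε i * w ^ r = algebraMap κ Z (algebraMap D κ (c i * ϖ)) * ε i)
    (hspan : ∀ i x, ε i * x ∈ Submodule.span κ (Set.range fun j : ℕ => ε i * w ^ j)) :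
    CoverRamifiesWithIndex D κ Z r := by
  -- A discrete valuation ring is integrally closed, so `D` coincides with its normalisation in `κ`
  -- and the Eisenstein criterion applies over the latter.
  have hbij : Function.Bijective (algebraMap D (integralClosure D κ)) := by
    refine ⟨fun x y h => IsFractionRing.injective D κ (congrArg Subtype.val h), fun x => ?_⟩
    obtain ⟨y, hy⟩ := IsIntegrallyClosed.isIntegral_iff.1 x.2
    exact ⟨y, Subtype.ext hy⟩
  let f : D ≃+* integralClosure D κ := RingEquiv.ofBijective _ hbij
  have : IsDiscreteValuationRing (integralClosure D κ) :=
    IsDiscreteValuationRing.RingEquivClass.isDiscreteValuationRing f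
  have : IsFractionRing (integralClosure D κ) κ :=
    integralClosure.isFractionRing_of_finite_extension (A := D) κ κ
  intro P hP
  exact ramificationIdx_integralClosure_eq (ϖ := f ϖ) (c := fun i => Units.map (f : D →* _) (c i))
    ((MulEquiv.irreducible_iff f.toMulEquiv).2 hϖ) hr hε hε0 
    (fun i => (hwr i).trans (by rw [map_mul (algebraMap D κ)]; rfl)) hspan P hP

theorem OrderRamification.coverRamifiesWithIndex_of_pow_eq [Nontrivial Z] {ϖ : D} {w : Z} {r : ℕ}
    (hϖ : Irreducible ϖ) (hr : r ≠ 0) (hwr : w ^ r = algebraMap κ Z (algebraMap D κ ϖ))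
    (hspan : ∀ x, x ∈ Submodule.span κ (Set.range fun j : ℕ => w ^ j)) :
    CoverRamifiesWithIndex D κ Z r := by
  refine coverRamifiesWithIndex_of_orthogonalIdempotents (ι := Unit) (ε := fun _ => 1) (w := w)
    (c := fun _ => 1) hϖ hr ⟨⟨fun _ => IsIdempotentElem.one, fun i j h => (h rfl).elim⟩, by simp⟩
    (fun _ => one_ne_zero) (fun _ => by simp [hwr]) (fun _ x => ?_)
  simpa using hspan x

/-- The case of a product of copies of a totally ramified extension, permuted by a root of unity. -/
theorem OrderRamification.coverRamifiesWithIndex_of_root [CharZero κ] {ϖ ξ : D} {w y : Z}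
    {r n m : ℕ} [NeZero n] (hϖ : Irreducible ϖ) (hr : r ≠ 0) (hξ : IsPrimitiveRoot ξ n)
    (hy : y ^ n = 1) (hwr : w ^ r = algebraMap κ Z (algebraMap D κ ϖ) * y ^ m)
    (hlin : LinearIndependent κ fun j : Fin n => y ^ (j : ℕ))
    (hspan : ∀ x, x ∈ Submodule.span κ (Set.range fun j : ℕ × ℕ => w ^ j.1 * y ^ j.2)) :
    CoverRamifiesWithIndex D κ Z r := by
  have hξ' : IsPrimitiveRoot (algebraMap D κ ξ) n :=
    hξ.map_of_injective (IsFractionRing.injective D κ)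
  have hn : (n : κ) ≠ 0 := Nat.cast_ne_zero.2 (NeZero.ne n)
  have hξu : IsUnit ξ := IsUnit.of_pow_eq_one hξ.pow_eq_one (NeZero.ne n)
  have hmul := pow_mul_rootIdempotent hξ' hy
  -- On component `i` the element `y` acts as `ξ^i`, hence `w^r` is `ξ^{im} ϖ` there: a unit times
  -- the uniformiser.
  refine coverRamifiesWithIndex_of_orthogonalIdempotents (w := w) (ϖ := ϖ)
    (c := fun i : Fin n => hξu.unit ^ (i * m : ℕ)) hϖ hr
    (completeOrthogonalIdempotents_rootIdempotent hξ' hy) (fun i hi => ?_) (fun i => ?_)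
    (fun i x => ?_)
  -- The idempotent is a combination of the independent powers of `y` whose coefficient at `y^0` is
  -- `1/n`, so it is nonzero.
  · have h0 : ∑ j : Fin n, ((n : κ)⁻¹ * ((algebraMap D κ ξ)⁻¹ ^ (i : ℕ)) ^ (j : ℕ)) •
        y ^ (j : ℕ) = 0 := by
      rw [← hi, rootIdempotent, Finset.smul_sum, ← Fin.sum_univ_eq_sum_range
        (fun j => (n : κ)⁻¹ • ((algebraMap D κ ξ)⁻¹ ^ (i : ℕ) • y) ^ j)]
      exact Finset.sum_congr rfl fun j _ => by rw [smul_pow, smul_smul]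
    have := Fintype.linearIndependent_iff.1 hlin _ h0 ⟨0, NeZero.pos n⟩
    simp [hn] at this
  · rw [hwr, mul_left_comm, mul_comm (rootIdempotent _ _ _ _), hmul, Algebra.smul_def, ← mul_assoc,
      ← map_mul, ← map_pow, ← map_mul, mul_comm ϖ]
    rfl
  · have hx := hspan x
    induction hx using Submodule.span_induction with
    | mem x hx =>
      obtain ⟨j, rfl⟩ := hx
      have : rootIdempotent n (algebraMap D κ ξ) y i * (w ^ j.1 * y ^ j.2) =
          (algebraMap D κ ξ) ^ (i * j.2 : ℕ) •
            (rootIdempotent n (algebraMap D κ ξ) y i * w ^ j.1) := by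
        rw [← smul_mul_assoc, ← hmul]; ring
      rw [this]
      exact Submodule.smul_mem _ _ (Submodule.subset_span ⟨_, rfl⟩)
    | zero => rw [mul_zero]; exact zero_mem _
    | add x y _ _ hx hy => rw [mul_add]; exact add_mem hx hy
    | smul a x _ hx => rw [mul_smul_comm]; exact Submodule.smul_mem _ _ hx

end
end

/-! ### The order is central simple over the fraction field, and hereditary at each curve -/

noncomputable section

section

variable {Λ B : Type*} [CommRing Λ] [IsDomain Λ] [Ring B] [Algebra Λ B] {e n : ℕ} [NeZero e]
  [NeZero n] {z u v : Λ} {s t τ σ : B} {b : Module.Basis (Exponents e n) Λ B}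

/-- Each generator has a power that is a nonzero scalar, so it can be cancelled although it may not
be invertible. The same argument therefore serves over `k[[u,v]]` and over its fraction field. -/
theorem SymbolRelations.mem_range_of_mem_center (H : SymbolRelations e n z u v s t τ σ)
    (hz : IsPrimitiveRoot z (n * e)) (hb : ∀ x, b x = monomial4 s t τ σ x.toNat) (hu : u ≠ 0)
    (hv : v ≠ 0) {w : B} (hw : w ∈ Subring.center B) : w ∈ (algebraMap Λ B).range := by
  have hreg : ∀ (c : Λ) (x : B), c ≠ 0 → x * algebraMap Λ B c = 0 → x = 0 := by
    intro c x hc h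
    rw [← Algebra.commutes, ← Algebra.smul_def] at h
    refine b.ext_elem fun i => ?_
    have := congrArg (fun w => b.repr w i) h
    simpa [hc] using this
  have hpow : ∀ (g : B) (m : ℕ) (c : Λ), c ≠ 0 → m ≠ 0 → g ^ m = algebraMap Λ B c →
      ∀ x, x * g = 0 → x = 0 := by
    intro g m c hc hm hg x hx
    refine hreg c x hc ?_
    rw [← hg, ← mul_pow_sub_one hm, ← mul_assoc, hx, zero_mul]
  have hN : n * e ≠ 0 := mul_ne_zero (NeZero.ne n) (NeZero.ne e)
  have hg : ∀ (i : Fin 4) (x : B), x * ![s, t, τ, σ] i = 0 → x = 0 := by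
    intro i
    fin_cases i
    exacts [hpow s e u hu (NeZero.ne e) H.s_pow, hpow t (n * e) v hv hN H.t_pow,
      hpow τ (n * e) 1 one_ne_zero hN (by rw [H.τ_pow, map_one]),
      hpow σ e 1 one_ne_zero (NeZero.ne e) (by rw [H.σ_pow, map_one])]
  have hzero : ∀ x, x ≠ 0 → b.repr w x = 0 := by
    intro x hx
    refine Module.Basis.repr_eq_zero_of_mem_center (g := ![s, t, τ, σ])
      (χ := fun i x => monomialCharacter e n z (generatorExponent i) x.toNat) hg (fun i x => ?_) hw
      ?_
    · rw [← monomial4_generatorExponent, hb, ← H.mul_eq_smul hz]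
    · by_contra! hc
      refine hx (commutatorExponent_separates fun i => ?_)
      rw [(monomialCharacter_eq_one_iff hz _ _).1 (hc i)]
      simp [commutatorExponent, orderingExponent, Exponents.toNat]
  cases nonempty_fintype (Exponents e n)
  refine ⟨b.repr w 0, ?_⟩
  rw [Algebra.algebraMap_eq_smul_one, ← (H.isTwistedBasis hb).one]
  conv_rhs => rw [← b.sum_repr w]
  exact (Finset.sum_eq_single (f := fun x => b.repr w x • b x) 0
    (fun x _ hx => by rw [hzero x hx, zero_smul]) fun h => (h (Finset.mem_univ _)).elim).symm

theorem SymbolRelations.isSimpleRing {κ Q : Type*} [Field κ] [Ring Q] [Algebra κ Q] {z u v : κ}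
    {s t τ σ : Q} {b : Module.Basis (Exponents e n) κ Q} (H : SymbolRelations e n z u v s t τ σ)
    (hz : IsPrimitiveRoot z (n * e)) (hb : ∀ x, b x = monomial4 s t τ σ x.toNat) (hu : u ≠ 0)
    (hv : v ≠ 0) : IsSimpleRing Q := by
  have : Nontrivial Q := nontrivial_of_ne _ _ (b.ne_zero 0)
  refine IsSimpleRing.of_basis (b := b) (g := ![s, t, τ, σ])
    (χ := fun i x => monomialCharacter e n z (generatorExponent i) x.toNat)
    (fun x => (H.isTwistedBasis hb).isUnit
      (isUnit_structureConstant_neg hz.pow_eq_one (Or.inr hu.isUnit) (Or.inr hv.isUnit))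
      (structureConstant_neg_left hz.pow_eq_one (Or.inr hu.isUnit) (Or.inr hv.isUnit)))
    (fun i => ?_) (fun i x => ?_) (fun x y h => ?_)
  · fin_cases i
    exacts [H.isUnit_s hu.isUnit, H.isUnit_t hv.isUnit, H.isUnit_τ, H.isUnit_σ]
  · rw [← monomial4_generatorExponent, hb, ← H.mul_eq_smul hz]
  · exact commutatorExponent_separates fun i => (monomialCharacter_eq_iff hz _ _ _ _).1 (h i)

end

namespace SkewTerminal

variable {k : Type*} [Field k] {e n : ℕ} [NeZero e] [NeZero n] {ζ : k}
  (hζ : IsPrimitiveRoot ζ (n * e)) [CharZero k]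

section BaseChange

variable (Λ : Type*) [CommRing Λ] [Algebra (Base k) Λ]

theorem orderBasis_baseChange_apply (x : Exponents e n) : (orderBasis hζ).baseChange Λ x =
    monomial4 ((1 : Λ) ⊗ₜ[Base k] coverHom hζ (s hζ)) (1 ⊗ₜ coverHom hζ (t hζ))
      (1 ⊗ₜ groupHom hζ (tau e n)) (1 ⊗ₜ groupHom hζ (sigma e n)) x.toNat := by
  rw [Module.Basis.baseChange_apply, orderBasis_apply]
  simp only [monomial4, Algebra.TensorProduct.tmul_pow, Algebra.TensorProduct.tmul_mul_tmul,
    one_pow, one_mul]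

omit [NeZero e] [NeZero n] [CharZero k] in
theorem isPrimitiveRoot_zeta : IsPrimitiveRoot (zeta hζ) (n * e) :=
  hζ.map_of_injective (FaithfulSMul.algebraMap_injective k (Base k))

-- The element `ζ^m - 1` comes from the field `k`, so if it is nonzero it remains a unit in every
-- algebra over it.
omit [NeZero e] [NeZero n] [CharZero k] in
theorem zeta_pow_eq_one_or_isUnit (m : ℕ) :
    algebraMap (Base k) Λ (zeta hζ) ^ m = 1 ∨
      IsUnit (algebraMap (Base k) Λ (zeta hζ) ^ m - 1) := by
  by_cases h : ζ ^ m = 1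
  · left
    rw [← map_pow, ← map_pow, h, map_one, map_one]
  · right
    have : IsUnit (ζ ^ m - 1) := isUnit_iff_ne_zero.2 (sub_ne_zero.2 h)
    have := (this.map (algebraMap k (Base k))).map (algebraMap (Base k) Λ)
    rwa [map_sub, map_sub, map_one, map_one, map_pow, map_pow] at this

end BaseChange

theorem order_isOrder : IsOrder (Base k) (SkewOrder hζ) := by
  have hinj : Function.Injective (algebraMap (Base k) (FractionRing (Base k))) :=
    IsFractionRing.injective _ _
  have hX : ∀ i, algebraMap (Base k) (FractionRing (Base k)) (MvPowerSeries.X i) ≠ 0 := fun i =>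
    (map_ne_zero_iff _ hinj).2 (X_prime i).ne_zero
  have hz := (isPrimitiveRoot_zeta hζ).map_of_injective hinj
  refine ⟨inferInstance, inferInstance, ⟨fun x hx => ?_⟩, ?_⟩
  · have := ((symbolRelations hζ).baseChange (FractionRing (Base k))).mem_range_of_mem_center hz
      (orderBasis_baseChange_apply hζ _) (hX 0) (hX 1) (w := x)
      (Subring.mem_center_iff.2 fun y => (Subalgebra.mem_center_iff.1 hx y))
    exact Algebra.mem_bot.2 this
  · exact ((symbolRelations hζ).baseChange (FractionRing (Base k))).isSimpleRing hz
      (orderBasis_baseChange_apply hζ _) (hX 0) (hX 1)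

theorem algebraMap_order_injective :
    Function.Injective (algebraMap (Base k) (SkewOrder hζ)) := by
  have : Nontrivial (SkewOrder hζ) := nontrivial_of_ne _ _ ((orderBasis hζ).ne_zero 0)
  exact FaithfulSMul.algebraMap_injective _ _

theorem range_algebraMap_eq_center :
    (algebraMap (Base k) (SkewOrder hζ)).range = Subring.center (SkewOrder hζ) := by
  refine le_antisymm ?_ fun x hx => ?_
  · rintro _ ⟨f, rfl⟩
    exact Subring.mem_center_iff.2 fun y => (Algebra.commutes f y).symm
  · exact (symbolRelations hζ).mem_range_of_mem_center (isPrimitiveRoot_zeta hζ)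
      (orderBasis_apply hζ) (X_prime 0).ne_zero (X_prime 1).ne_zero hx

theorem incl_algebraMap_eq (f : Base k) (g : Cover hζ) (h : algebraMap (Base k) (Cover hζ) f = g) :
    incl hζ (algebraMap (Base k) (SkewOrder hζ) f) = eps hζ * SkewMonoidAlgebra.single 1 g := by
  subst h
  exact congrArg (incl hζ) ((toOrder hζ).commutes f).symm

/-! ### Localisation at a prime divisor -/

section Hereditary

omit [CharZero k] in
theorem baseHom_injective : Function.Injective (baseHom (k := k) (e := e) (n := n)) := by
  rw [injective_iff_map_eq_zero]
  intro f hf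
  ext m
  have he := NeZero.pos e
  have hN : 0 < n * e := Nat.mul_pos (NeZero.pos n) he
  have := coeff_baseHom_mul (e := e) (n := n) f (m 0) (m 1) he he hN hN
  rw [hf, zero_mul, if_pos ⟨rfl, rfl⟩, ← eq_expo] at this
  exact this.symm

omit [CharZero k] in
theorem cover_finite : Module.Finite (Base k) (Cover hζ) := by
  refine ⟨Submodule.fg_def.2 ⟨(fun p : ℕ × ℕ => s hζ ^ p.1 * t hζ ^ p.2) ''
    (Set.Iio e ×ˢ Set.Iio (n * e)), Set.toFinite _, eq_top_iff.2 fun f _ => ?_⟩⟩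
  have hf : f = ∑ a ∈ Finset.range e, ∑ b ∈ Finset.range (n * e),
      component e n f a b • (s hζ ^ a * t hζ ^ b) :=
    (sum_component (e := e) (n := n) f).symm
  rw [hf]
  refine sum_mem fun a ha => sum_mem fun b hb => Submodule.smul_mem _ _ (Submodule.subset_span ?_)
  exact ⟨(a, b), ⟨Finset.mem_range.1 ha, Finset.mem_range.1 hb⟩, rfl⟩

variable {C : PrimeSpectrum (Base k)}

/-- The localisation of `k[[s,t]]` at a curve of `Spec k[[u,v]]`. -/
abbrev LocalizedCover (C : PrimeSpectrum (Base k)) : Type _ :=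
  Localization.AtPrime C.asIdeal ⊗[Base k] Cover hζ

-- Normality and noetherianity pass from `k[[s,t]]` to a localisation. Finiteness over the discrete
-- valuation ring `R_C` bounds the dimension by one, as nonzero primes contract to nonzero primes.
omit [CharZero k] in
theorem localizedCover_isDedekindDomain (hC : IsPrimeDivisor C) :
    ∃ _ : IsDomain (LocalizedCover hζ C), IsDedekindDomain (LocalizedCover hζ C) := by
  have : IsDiscreteValuationRing (Localization.AtPrime C.asIdeal) :=
    localization_isDiscreteValuationRing hC
  have : IsDomain (Cover hζ) := inferInstanceAs (IsDomain (Base k))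
  have : IsNoetherianRing (Cover hζ) := inferInstanceAs (IsNoetherianRing (Base k))
  have : IsIntegrallyClosed (Cover hζ) := inferInstanceAs (IsIntegrallyClosed (Base k))
  have : Module.Finite (Base k) (Cover hζ) := cover_finite hζ
  have hinj : Function.Injective (algebraMap (Base k) (Cover hζ)) :=
    baseHom_injective
  let M := Algebra.algebraMapSubmonoid (Cover hζ) C.asIdeal.primeCompl
  have hM : M ≤ nonZeroDivisors (Cover hζ) := by
    rintro _ ⟨f, hf, rfl⟩
    refine mem_nonZeroDivisors_of_ne_zero ((map_ne_zero_iff _ hinj).2 ?_)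
    rintro rfl
    exact hf C.asIdeal.zero_mem
  let _ : Algebra (Cover hζ) (LocalizedCover hζ C) := Algebra.TensorProduct.rightAlgebra
  have : IsLocalization M (LocalizedCover hζ C) := inferInstance
  have hdom : IsDomain (LocalizedCover hζ C) := IsLocalization.isDomain_of_le_nonZeroDivisors _ hM
  have : IsNoetherianRing (LocalizedCover hζ C) :=
    IsLocalization.isNoetherianRing M _ inferInstance
  have : IsIntegrallyClosed (LocalizedCover hζ C) := isIntegrallyClosed_of_isLocalization _ M hM
  have hinj' : Function.Injective
      (algebraMap (Localization.AtPrime C.asIdeal) (LocalizedCover hζ C)) :=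
    Algebra.TensorProduct.includeLeft_injective (S := Base k) hinj
  have : Ring.DimensionLEOne (LocalizedCover hζ C) := by
    refine ⟨fun {P} hP0 hP => ?_⟩
    obtain ⟨x, hx, hx0⟩ := Submodule.exists_mem_ne_zero_of_ne_bot hP0
    have : P.comap (algebraMap (Localization.AtPrime C.asIdeal) (LocalizedCover hζ C)) ≠ ⊥ :=
      Ideal.comap_ne_bot_of_integral_mem hx0 hx (Algebra.IsIntegral.isIntegral x)
    exact Ideal.isMaximal_of_isIntegral_of_isMaximal_comap P
      (Ideal.IsPrime.isMaximal inferInstance this)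
  exact ⟨hdom, { }⟩

/-- Averaging over `G'`, with the localised `k[[s,t]]` as Dedekind domain: `G'` permutes that ring
by conjugation, together they generate the order, and `|G'|` is a unit in characteristic zero. -/
theorem localizedOrder_isHereditaryRing (hC : IsPrimeDivisor C) :
    IsHereditaryRing (LocalizedOrder (SkewOrder hζ) C) := by
  obtain ⟨_, _⟩ := localizedCover_isDedekindDomain hζ hC
  have : IsDiscreteValuationRing (Localization.AtPrime C.asIdeal) :=
    localization_isDiscreteValuationRing hC
  have : Module.Finite (Base k) (Cover hζ) := cover_finite hζ
  let φ : LocalizedCover hζ C →ₐ[Localization.AtPrime C.asIdeal] LocalizedOrder (SkewOrder hζ) C :=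
    Algebra.TensorProduct.map (AlgHom.id _ _) (coverHom hζ)
  let γ : ExtGroup e n →* LocalizedOrder (SkewOrder hζ) C :=
    ((Algebra.TensorProduct.includeRight : SkewOrder hζ →ₐ[Base k]
      LocalizedOrder (SkewOrder hζ) C).toRingHom.toMonoidHom).comp (groupHom hζ)
  have hγ : ∀ g, γ g = 1 ⊗ₜ groupHom hζ g := fun _ => rfl
  have hφ : ∀ r f, φ (r ⊗ₜ f) = r ⊗ₜ coverHom hζ f := fun _ _ => rfl
  refine IsHereditaryRing.of_average (Λ := Localization.AtPrime C.asIdeal)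
    (T := LocalizedCover hζ C) (φ := φ) (γ := γ)
    (fun g x => ?_) (eq_top_iff.2 fun x _ => ?_) ?_
  · induction x using TensorProduct.induction_on with
    | zero => exact ⟨0, by simp⟩
    | tmul r f =>
      refine ⟨r ⊗ₜ (g • f), ?_⟩
      rw [hγ, hφ, hφ, Algebra.TensorProduct.tmul_mul_tmul, Algebra.TensorProduct.tmul_mul_tmul,
        groupHom_mul_coverHom, one_mul, mul_one]
    | add x y hx hy =>
      obtain ⟨x', hx'⟩ := hx
      obtain ⟨y', hy'⟩ := hy
      exact ⟨x' + y', by rw [map_add, map_add, mul_add, add_mul, hx', hy']⟩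
  · have key : ∀ a : SkewOrder hζ, (1 : Localization.AtPrime C.asIdeal) ⊗ₜ[Base k] a ∈
        Subring.closure (Set.range φ ∪ Set.range γ) := by
      intro a
      have hle : Subring.closure (Set.range (coverHom hζ) ∪ Set.range (groupHom hζ)) ≤
          (Subring.closure (Set.range φ ∪ Set.range γ)).comap
            (Algebra.TensorProduct.includeRight : SkewOrder hζ →ₐ[Base k]
              LocalizedOrder (SkewOrder hζ) C).toRingHom := by
        rw [Subring.closure_le]
        rintro _ (⟨f, rfl⟩ | ⟨g, rfl⟩)
        · exact Subring.subset_closure (Or.inl ⟨1 ⊗ₜ f, hφ 1 f⟩)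
        · exact Subring.subset_closure (Or.inr ⟨g, rfl⟩)
      exact hle (closure_coverHom_groupHom hζ ▸ Subring.mem_top a)
    induction x using TensorProduct.induction_on with
    | zero => exact zero_mem _
    | tmul r a =>
      have : r ⊗ₜ[Base k] a = φ (r ⊗ₜ 1) * (1 ⊗ₜ a) := by
        rw [hφ, map_one, Algebra.TensorProduct.tmul_mul_tmul, mul_one, one_mul]
      rw [this]
      exact mul_mem (Subring.subset_closure (Or.inl ⟨_, rfl⟩)) (key a)
    | add x y hx hy => exact add_mem (hx trivial) (hy trivial)
  · have h : IsUnit ((Nat.card (ExtGroup e n) : k)) :=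
      isUnit_iff_ne_zero.2 (Nat.cast_ne_zero.2 Nat.card_pos.ne')
    have := ((h.map (algebraMap k (Base k))).map (algebraMap (Base k)
      (Localization.AtPrime C.asIdeal))).map (algebraMap _ (LocalizedOrder (SkewOrder hζ) C))
    simpa using this

end Hereditary

end SkewTerminal
end

noncomputable section

namespace SkewTerminal

variable {k : Type*} [Field k] {e n : ℕ} [NeZero e] [NeZero n] {ζ : k}
  (hζ : IsPrimitiveRoot ζ (n * e)) [CharZero k]

/-! ### Ramification -/

variable (C : PrimeSpectrum (Base k))

instance charZero_residueField :
    CharZero (IsLocalRing.ResidueField (Localization.AtPrime C.asIdeal)) :=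
  charZero_of_injective_ringHom (((IsLocalRing.residue _).comp (algebraMap (Base k)
    (Localization.AtPrime C.asIdeal))).comp (algebraMap k (Base k))).injective

omit [NeZero e] [NeZero n] [CharZero k] in
theorem isPrimitiveRoot_zeta_localization : IsPrimitiveRoot
    (algebraMap (Base k) (Localization.AtPrime C.asIdeal) (zeta hζ)) (n * e) :=
  (isPrimitiveRoot_zeta hζ).map_of_injective (algebraMap_localization_injective C)

theorem localizedOrder_hasPrincipalRadical (hC : IsPrimeDivisor C) :
    HasPrincipalRadical (LocalizedOrder (SkewOrder hζ) C) := by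
  have H := (symbolRelations hζ).baseChange (Localization.AtPrime C.asIdeal)
  have hz := isPrimitiveRoot_zeta_localization hζ C
  have hb := orderBasis_baseChange_apply hζ (Localization.AtPrime C.asIdeal)
  by_cases h0 : C = axis k 0
  · subst h0
    exact (H.hasPrincipalRadical_left hz hb (maximalIdeal_localization_eq_span rfl)
      (isUnit_X_localization hC 1 ((axis_injective k).ne zero_ne_one))).1
  by_cases h1 : C = axis k 1
  · subst h1
    exact (H.hasPrincipalRadical_right hz hb (maximalIdeal_localization_eq_span rfl)
      (isUnit_X_localization hC 0 ((axis_injective k).ne one_ne_zero))).1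
  obtain ⟨p, -, hp⟩ := C.isPrime.exists_prime_eq_span_of_height_eq_one hC
  exact H.hasPrincipalRadical_of_isUnit hz hb (maximalIdeal_localization_eq_span hp)
    (isUnit_X_localization hC 0 h0) (isUnit_X_localization hC 1 h1)

theorem order_isNormalOrder : IsNormalOrder (Base k) (SkewOrder hζ) where
  base := base_isCompleteNormalSurface k
  order := order_isOrder hζ
  reflexive := inferInstance
  hereditary _ hC := localizedOrder_isHereditaryRing hζ hC
  principalRadical C hC := localizedOrder_hasPrincipalRadical hζ C hC

theorem ramificationIndex_axis_zero : ramificationIndex (SkewOrder hζ) (axis k 0) = e := by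
  have H := (symbolRelations hζ).baseChange (Localization.AtPrime (axis k 0).asIdeal)
  obtain ⟨β, -⟩ := H.exists_basis_residueCentre_left (isPrimitiveRoot_zeta_localization hζ _)
    (orderBasis_baseChange_apply hζ _) (zeta_pow_eq_one_or_isUnit hζ _)
    (maximalIdeal_localization_eq_span rfl)
    (isUnit_X_localization (axis_isPrimeDivisor k 0) 1 ((axis_injective k).ne zero_ne_one))
  exact (Module.finrank_eq_nat_card_basis β).trans natCard_centralExponentsLeft

theorem ramificationIndex_axis_one : ramificationIndex (SkewOrder hζ) (axis k 1) = n * e := by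
  have H := (symbolRelations hζ).baseChange (Localization.AtPrime (axis k 1).asIdeal)
  obtain ⟨β, -⟩ := H.exists_basis_residueCentre_right (isPrimitiveRoot_zeta_localization hζ _)
    (orderBasis_baseChange_apply hζ _) (zeta_pow_eq_one_or_isUnit hζ _)
    (maximalIdeal_localization_eq_span rfl)
    (isUnit_X_localization (axis_isPrimeDivisor k 1) 0 ((axis_injective k).ne one_ne_zero))
  exact (Module.finrank_eq_nat_card_basis β).trans natCard_centralExponentsRight

variable {C} in
theorem ramificationIndex_of_ne (hC : IsPrimeDivisor C) (h0 : C ≠ axis k 0) (h1 : C ≠ axis k 1) :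
    ramificationIndex (SkewOrder hζ) C = 1 := by
  have H := (symbolRelations hζ).baseChange (Localization.AtPrime C.asIdeal)
  obtain ⟨β, -⟩ := H.exists_basis_residueCentre_of_isUnit (isPrimitiveRoot_zeta_localization hζ _)
    (orderBasis_baseChange_apply hζ _) (zeta_pow_eq_one_or_isUnit hζ _)
    (isUnit_X_localization hC 0 h0) (isUnit_X_localization hC 1 h1)
  exact (Module.finrank_eq_nat_card_basis β).trans (by simp)

omit [CharZero k] in
theorem irreducible_mk_X {i j : Fin 2} (hij : i ≠ j) :
    Irreducible (Ideal.Quotient.mk (axis k i).asIdeal (MvPowerSeries.X j)) :=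
  (IsDiscreteValuationRing.irreducible_iff_uniformizer _).2 (maximalIdeal_axis_quotient k i j hij)

theorem hasSecondaryRamification_axis_zero :
    HasSecondaryRamification (SkewOrder hζ) (axis k 0) e := by
  have H := (symbolRelations hζ).baseChange (Localization.AtPrime (axis k 0).asIdeal)
  obtain ⟨w, hw, hspan⟩ := H.exists_generator_left (isPrimitiveRoot_zeta_localization hζ _)
    (orderBasis_baseChange_apply hζ _) (zeta_pow_eq_one_or_isUnit hζ _)
    (maximalIdeal_localization_eq_span rfl)
    (isUnit_X_localization (axis_isPrimeDivisor k 0) 1 ((axis_injective k).ne zero_ne_one))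
  have : Nontrivial (ResidueCentre (LocalizedOrder (SkewOrder hζ) (axis k 0))) :=
    Module.nontrivial_of_finrank_pos (R := (axis k 0).asIdeal.ResidueField)
      ((ramificationIndex_axis_zero hζ).symm ▸ NeZero.pos e :
        0 < ramificationIndex (SkewOrder hζ) (axis k 0))
  exact coverRamifiesWithIndex_of_pow_eq (irreducible_mk_X zero_ne_one) (NeZero.ne e) hw hspan

theorem hasSecondaryRamification_axis_one :
    HasSecondaryRamification (SkewOrder hζ) (axis k 1) e := by
  have H := (symbolRelations hζ).baseChange (Localization.AtPrime (axis k 1).asIdeal)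
  obtain ⟨w, y, hy, hw, hlin, hspan⟩ := H.exists_generator_right
    (isPrimitiveRoot_zeta_localization hζ _)
    (orderBasis_baseChange_apply hζ _) (zeta_pow_eq_one_or_isUnit hζ _)
    (maximalIdeal_localization_eq_span rfl)
    (isUnit_X_localization (axis_isPrimeDivisor k 1) 0 ((axis_injective k).ne one_ne_zero))
  have hξ : IsPrimitiveRoot (algebraMap k (Base k ⧸ (axis k 1).asIdeal) (ζ ^ e)) n :=
    (hζ.pow (Nat.mul_pos (NeZero.pos n) (NeZero.pos e)) (mul_comm n e)).map_of_injective
      (algebraMap k (Base k ⧸ (axis k 1).asIdeal)).injective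
  have : CharZero (axis k 1).asIdeal.ResidueField := charZero_residueField (axis k 1)
  exact coverRamifiesWithIndex_of_root (irreducible_mk_X one_ne_zero) (NeZero.ne e) hξ hy hw hlin
    hspan

variable {C} in
theorem eq_axis_of_isRamificationCurve (hC : IsRamificationCurve (SkewOrder hζ) C) :
    C = axis k 0 ∨ C = axis k 1 := by
  by_contra! h
  exact hC.2.ne' (ramificationIndex_of_ne hζ hC.1 h.1 h.2)

theorem order_isTerminalOrder : IsTerminalOrder (Base k) (SkewOrder hζ) where
  normal := order_isNormalOrder hζ
  smooth := base_isRegularLocalRing k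
  normalCrossing := by
    refine ⟨MvPowerSeries.X 0, MvPowerSeries.X 1, maximalIdeal_base k, fun C hC => ?_⟩
    rcases eq_axis_of_isRamificationCurve hζ hC with rfl | rfl
    exacts [Or.inl rfl, Or.inr rfl]
  secondary_single := by
    intro C hC huniq
    -- For `e > 1` both axes ramify, so a lone ramification curve forces `e = 1`, and the secondary
    -- index `e` is then the required `1`.
    have he : e = 1 := by
      by_contra he
      have he : 1 < e := lt_of_le_of_ne (NeZero.pos e) (Ne.symm he)
      have h0 : IsRamificationCurve (SkewOrder hζ) (axis k 0) :=
        ⟨axis_isPrimeDivisor k 0, by rwa [ramificationIndex_axis_zero]⟩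
      have h1 : IsRamificationCurve (SkewOrder hζ) (axis k 1) :=
        ⟨axis_isPrimeDivisor k 1, by
          rw [ramificationIndex_axis_one]
          exact he.trans_le (Nat.le_mul_of_pos_left e (NeZero.pos n))⟩
      exact zero_ne_one (axis_injective k ((huniq _ h0).trans (huniq _ h1).symm))
    -- The index is generalised because `e` also occurs in the type of the order and must stay fixed
    -- there.
    suffices h : ∀ r, e = r → HasSecondaryRamification (SkewOrder hζ) C r from h 1 he
    rintro _ rfl
    rcases eq_axis_of_isRamificationCurve hζ hC with rfl | rfl
    exacts [hasSecondaryRamification_axis_zero hζ, hasSecondaryRamification_axis_one hζ]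
  secondary_pair := by
    intro C C' hC hC' hne
    have h0 := hasSecondaryRamification_axis_zero hζ
    have h1 := hasSecondaryRamification_axis_one hζ
    rcases eq_axis_of_isRamificationCurve hζ hC with rfl | rfl <;>
      rcases eq_axis_of_isRamificationCurve hζ hC' with rfl | rfl
    · exact (hne rfl).elim
    · left
      rw [ramificationIndex_axis_zero, ramificationIndex_axis_one]
      exact ⟨Dvd.intro_left n rfl, h0, h1⟩
    · right
      rw [ramificationIndex_axis_zero, ramificationIndex_axis_one]
      exact ⟨Dvd.intro_left n rfl, h1, h0⟩
    · exact (hne rfl).elim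

end SkewTerminal
end

theorem proposition3p3 {k : Type*} [Field k] [IsAlgClosed k] [CharZero k]
    (e n : ℕ) [NeZero e] [NeZero n] (ζ : k) (hζ : IsPrimitiveRoot ζ (n * e)) :
    -- the isomorphism of `k[[s,t]] * G' / (ρ - ζ^n)` with `A`, induced by `x ↦ ε x`
    (∃ f : (TwoSidedIdeal.span
          {grp hζ (rho e n) - algebraMap k (SkewGroupRing hζ) (ζ ^ n)}).ringCon.Quotient ≃+*
        SkewOrder hζ,
      ∀ x : SkewGroupRing hζ, incl hζ (f (RingCon.toQuotient x)) = eps hζ * x) ∧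
    -- the centre is `k[[u,v]]`, where `u = s^e` and `v = t^{ne}`
    Function.Injective (algebraMap (Base k) (SkewOrder hζ)) ∧
    (algebraMap (Base k) (SkewOrder hζ)).range = Subring.center (SkewOrder hζ) ∧
    incl hζ (algebraMap (Base k) (SkewOrder hζ) (MvPowerSeries.X 0)) =
      eps hζ * SkewMonoidAlgebra.single 1 (s hζ ^ e) ∧
    incl hζ (algebraMap (Base k) (SkewOrder hζ) (MvPowerSeries.X 1)) =
      eps hζ * SkewMonoidAlgebra.single 1 (t hζ ^ (n * e)) ∧
    ∃ _ : Module.Finite (Base k) (SkewOrder hζ),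
      IsTerminalOrder (Base k) (SkewOrder hζ) ∧
      -- the ramification indices along `u = 0`, along `v = 0` and along all other curves
      IsPrimeDivisor (axis k 0) ∧ IsPrimeDivisor (axis k 1) ∧
      ramificationIndex (SkewOrder hζ) (axis k 0) = e ∧
      ramificationIndex (SkewOrder hζ) (axis k 1) = n * e ∧
      (∀ C : PrimeSpectrum (Base k), IsPrimeDivisor C → C ≠ axis k 0 → C ≠ axis k 1 →
        ramificationIndex (SkewOrder hζ) C = 1) ∧
      -- the secondary ramification at the node
      HasSecondaryRamification (SkewOrder hζ) (axis k 0) e ∧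
      HasSecondaryRamification (SkewOrder hζ) (axis k 1) e := by
  exact ⟨exists_quotient_equiv hζ, algebraMap_order_injective hζ, range_algebraMap_eq_center hζ,
    incl_algebraMap_eq hζ _ _ (s_pow_eq hζ).symm, incl_algebraMap_eq hζ _ _ (t_pow_eq hζ).symm,
    inferInstance, order_isTerminalOrder hζ, axis_isPrimeDivisor k 0, axis_isPrimeDivisor k 1,
    ramificationIndex_axis_zero hζ, ramificationIndex_axis_one hζ,
    fun _ hC h0 h1 => ramificationIndex_of_ne hζ hC h0 h1,
    hasSecondaryRamification_axis_zero hζ, hasSecondaryRamification_axis_one hζ⟩
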